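/- **Theorem (Optimal Finite-State and Markov Model Log Loss on the LZ78 source).** Let $\mathcal A$ be a finite alphabet, $\mathcal M(\mathcal A)$ the simplex of probability mass functions on $\mathcal A$, and $\Pi$ any Borel probability measure on $\mathcal M(\mathcal A)$. All logarithms have base $2$, and $H(p)=-\sum_a p(a)\log p(a)$. *The source.* The LZ78 source with prior $\Pi$ is the law of the process $\mathbf X=(X_1,X_2,\dots)$ generated as follows. Draw $\Theta_0,\Theta_1,\dots$ i.i.d. from $\Pi$, and start at the root of a tree that consists of the root only. At each time $t\ge 1$: if the current node has no parameter yet, assign to it the next unused $\Theta_j$; let $B_t$ be the parameter of the current node; given all $\Theta_j$ and $X_1,\dots,X_{t-1}$, draw $X_t\sim B_t$; if the current node has a child along the edge labelled $X_t$, move to this child, and otherwise add this child as a new leaf and return to the root. *Log losses of an individual sequence $\mathbf x$.* Let $\mu_k(\mathbf x)=\limsup_{n\to\infty}\hat H_{X_{k+1}|X^k}(x^n)$, where $\hat H_{X_{k+1}|X^k}(x^n)$ is the conditional entropy of the last symbol given the first $k$ under the empirical distribution of the $(k+1)$-tuples of consecutive symbols in $x^n=(x_1,\dots,x_n)$, and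 let $\mu(\mathbf x)=\lim_{k\to\infty}\mu_k(\mathbf x)$. Let $\lambda(\mathbf x)=\lim_{M\to\infty}\limsup_{n\to\infty}\lambda_M(x^n)$, where $\lambda_M(x^n)$ is the least value of $\frac1n\sum_{t=1}^n\log\frac1{q(x_t\mid s_t)}$ over all sequential probability assignments with at most $M$ states (a start state $s_1$, a next-state function $s_{t+1}=g(s_t,x_t)$, and a probability mass function $q(\cdot\mid s)$ for each state $s$). Let $\rho(\mathbf x)=\lim_{s\to\infty}\limsup_{n\to\infty}\rho_s(x^n)$ be the finite-state compressibility, where $\rho_s(x^n)$ is the least value of $L/(n\log|\mathcal A|)$ over all information lossless finite-state encoders with at most $s$ states, $L$ being the number of bits that the encoder outputs on $x^n$. (An encoder has a start state, a next-state function, and outputs a possibly empty binary word at each step; it is information lossless if, for every initial state and every $n$, the initial state, the concatenated output and the final state determine the input word of length $n$.) *Claim.* Let $\mathbf X$ be generated from the LZ78 source with prior $\Pi$, and let $\Theta\sim\Pi$ and, given $\Theta$, $Y\sim\Theta$. Then, almost surely, the limits defining $\mu(\mathbf X)$, $\lambda(\mathbf X)$ and $\rho(\mathbf X)$ exist and $$\mu(\mathbf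 X)=\lambda(\mathbf X)=\rho(\mathbf X)\log|\mathcal A|=H\big(\mathbb E[\Theta]\big).$$ Moreover the entropy rate of $\mathbf X$ exists and is $$\lim_{n\to\infty}\tfrac1n H(X^n)=\mathbb E[H(\Theta)],$$ the mutual information $I(\Theta;Y)$ is finite, and $$H\big(\mathbb E[\Theta]\big)=\mathbb E[H(\Theta)]+I(\Theta;Y),$$ so that, almost surely, the finite-state compressibility of $\mathbf X$ (scaled by $\log|\mathcal A|$) exceeds the entropy rate by the Jensen gap $H(\mathbb E[\Theta])-\mathbb E[H(\Theta)]=I(\Theta;Y)$. -/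

import Mathlib

open MeasureTheory ProbabilityTheory Filter Topology

namespace LZ78

/-! ### Incremental parsing and the prefix tree -/

/-- A node of the prefix tree is the word spelled on the path from the root, so `[]` is the root.
`tree` holds the nodes present so far, `seen` the nodes that have been current at some earlier time
(those that already have a parameter), in order of first visit, and `cur` the current node. -/
structure ParseState (A : Type*) where
  tree : List (List A)
  seen : List (List A)
  cur : List A

namespace ParseState

variable {A : Type*} [DecidableEq A]

/-- Only the root is present; no node has a parameter yet. -/
def init : ParseState A := ⟨[[]], [], []⟩

/-- The number `j` such that the current node carries the `j`-th parameter `Θ_j`. A node that is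
current for the first time gets the next unused parameter, whose number is `seen.length`
(this is the value of `List.idxOf` for a word that is not in the list). -/
def index (s : ParseState A) : ℕ := s.seen.idxOf s.cur

/-- Read the symbol `a` at the current node: go to its child along `a` if that child is present;
otherwise add the child as a new leaf and return to the root. -/
def step (s : ParseState A) (a : A) : ParseState A where
  tree := if s.cur ++ [a] ∈ s.tree then s.tree else s.tree ++ [s.cur ++ [a]]
  seen := if s.cur ∈ s.seen then s.seen else s.seen ++ [s.cur]
  cur := if s.cur ++ [a] ∈ s.tree then s.cur ++ [a] else []

end ParseState

section Source

variable {A : Type*} [DecidableEq A]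

/-- The parsing state before time `t` when the symbols are read off an array: `y j t` is the symbol
that is produced at time `t` if the current node at time `t` carries the parameter `Θ_j`. -/
def parseState (y : ℕ → ℕ → A) : ℕ → ParseState A
  | 0 => ParseState.init
  | t + 1 => (parseState y t).step (y (parseState y t).index t)

/-- The sequence produced from the array `y`. -/
def sequence (y : ℕ → ℕ → A) (t : ℕ) : A := y (parseState y t).index t

end Source

section Law

variable {A : Type*} [Fintype A] [MeasurableSpace A]

/-- The probability measure on the alphabet with mass function `θ`. -/
noncomputable def symbolMeasure (θ : stdSimplex ℝ A) : Measure A :=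
  ∑ a, ENNReal.ofReal (θ.1 a) • Measure.dirac a

instance (θ : stdSimplex ℝ A) : IsProbabilityMeasure (symbolMeasure θ) := by
  constructor
  simp only [symbolMeasure, Measure.coe_finsetSum, Finset.sum_apply, Measure.smul_apply,
    measure_univ, smul_eq_mul, mul_one]
  rw [← ENNReal.ofReal_sum_of_nonneg (fun a _ => θ.2.1 a), θ.2.2, ENNReal.ofReal_one]

theorem measurable_symbolMeasure :
    Measurable (symbolMeasure : stdSimplex ℝ A → Measure A) := by
  refine Measure.measurable_of_measurable_coe _ fun s _ => ?_
  simp only [symbolMeasure, Measure.coe_finsetSum, Finset.sum_apply, Measure.smul_apply,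
    smul_eq_mul]
  refine Finset.measurable_fun_sum _ fun a _ => Measurable.mul_const ?_ _
  exact ENNReal.measurable_ofReal.comp ((measurable_pi_apply a).comp measurable_subtype_coe)

/-- One symbol drawn from `θ`. -/
noncomputable def symbolKernel : Kernel (stdSimplex ℝ A) A := ⟨symbolMeasure, measurable_symbolMeasure⟩

instance : IsMarkovKernel (symbolKernel (A := A)) :=
  ⟨fun θ => inferInstanceAs (IsProbabilityMeasure (symbolMeasure θ))⟩

theorem measurable_iid :
    Measurable fun θ : stdSimplex ℝ A => Measure.infinitePi fun _ : ℕ => symbolMeasure θ := by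
  refine Measurable.measure_of_isPiSystem_of_isProbabilityMeasure
    (generateFrom_squareCylinders (α := fun _ : ℕ => A)).symm
    (isPiSystem_squareCylinders (fun _ => MeasurableSpace.isPiSystem_measurableSet) (by simp)) ?_
  rintro _ ⟨s, t, ht, rfl⟩
  have ht' : ∀ i, MeasurableSet (t i) := fun i => ht i (Set.mem_univ i)
  have h : ∀ θ : stdSimplex ℝ A, (Measure.infinitePi fun _ : ℕ => symbolMeasure θ)
      ((s : Set ℕ).pi t) = ∏ i ∈ s, symbolMeasure θ (t i) := fun θ =>
    Measure.infinitePi_pi _ (fun i _ => ht' i)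
  simp only [h]
  exact Finset.measurable_fun_prod _ fun i _ =>
    (Measure.measurable_coe (ht' i)).comp measurable_symbolMeasure

/-- An infinite sequence of independent symbols drawn from `θ`. -/
noncomputable def iidKernel : Kernel (stdSimplex ℝ A) (ℕ → A) :=
  ⟨fun θ => Measure.infinitePi fun _ => symbolMeasure θ, measurable_iid⟩

instance : IsMarkovKernel (iidKernel (A := A)) :=
  ⟨fun θ => inferInstanceAs (IsProbabilityMeasure (Measure.infinitePi fun _ : ℕ => symbolMeasure θ))⟩

/-- The joint law of `(Θ_j, (Y_{j,t})_t)_j`: the `Θ_j` are i.i.d. with law `prior`, and given all of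
them the `Y_{j,t}` are independent with `Y_{j,t} ∼ Θ_j`. -/
noncomputable def arrayMeasure (prior : Measure (stdSimplex ℝ A)) :
    Measure (ℕ → stdSimplex ℝ A × (ℕ → A)) :=
  Measure.infinitePi fun _ => prior ⊗ₘ iidKernel

variable [MeasurableSingletonClass A] [DecidableEq A]

/-- The law of the LZ78 source with prior `prior`. At time `t` the current node is determined by
the earlier symbols, and carries some parameter `B_t = Θ_j`; the symbol emitted is `Y_{j,t}`, which
given all parameters and all earlier symbols has the law `Θ_j`, since no earlier step used an entry
of the array with time index `t`. -/
noncomputable def source (prior : Measure (stdSimplex ℝ A)) : Measure (ℕ → A) :=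
  (arrayMeasure prior).map fun ω => sequence fun j => (ω j).2

/-- The push-forward in `source` is along a measurable map. -/
theorem measurable_sequence :
    Measurable fun ω : ℕ → stdSimplex ℝ A × (ℕ → A) => sequence fun j => (ω j).2 := by
  let _ : MeasurableSpace (ParseState A) := ⊤
  have _ : Countable (ParseState A) := by
    have hinj : Function.Injective
        (fun s : ParseState A => ((s.tree, s.seen, s.cur) : List (List A) × List (List A) × List A)) := by
      rintro ⟨a, b, c⟩ ⟨a', b', c'⟩ h
      simpa using h
    exact hinj.countable
  have key : ∀ (t : ℕ) (f : (ℕ → stdSimplex ℝ A × (ℕ → A)) → ParseState A), Measurable f →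
      Measurable fun ω : ℕ → stdSimplex ℝ A × (ℕ → A) => (ω (f ω).index).2 t := by
    intro t f hf
    have hF : Measurable fun p : (ℕ → stdSimplex ℝ A × (ℕ → A)) × ParseState A =>
        (p.1 p.2.index).2 t := by
      refine measurable_from_prod_countable_left fun s => ?_
      exact (measurable_pi_apply t).comp (measurable_snd.comp (measurable_pi_apply s.index))
    exact hF.comp (measurable_id.prodMk hf)
  have hstep : Measurable fun p : ParseState A × A => p.1.step p.2 :=
    measurable_from_prod_countable_right fun s => measurable_of_countable _
  have hstate : ∀ t : ℕ, Measurable fun ω : ℕ → stdSimplex ℝ A × (ℕ → A) =>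
      parseState (fun j => (ω j).2) t := by
    intro t
    induction t with
    | zero => exact measurable_const
    | succ t ih => exact hstep.comp (ih.prodMk (key t _ ih))
  exact measurable_pi_lambda _ fun t => key t _ (hstate t)

end Law

/-! ### Entropies, in bits -/

/-- Shannon entropy of a mass function (with `0 log 0 = 0`). -/
noncomputable def entropy {ι : Type*} [Fintype ι] (p : ι → ℝ) : ℝ :=
  -∑ i, p i * Real.logb 2 (p i)

section

variable {A : Type*} [Fintype A] [MeasurableSpace A]

/-- The mass function `E[Θ]`. -/
noncomputable def meanPMF (prior : Measure (stdSimplex ℝ A)) (a : A) : ℝ := ∫ θ, θ.1 a ∂prior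

/-- `H(X^n)` for a sequence with law `Q`. -/
noncomputable def blockEntropy (Q : Measure (ℕ → A)) (n : ℕ) : ℝ :=
  entropy fun w : Fin n → A => Q.real {x | ∀ i : Fin n, x i = w i}

/-- The mutual information `I(Θ; Y)` in bits, where `Θ` has law `prior` and `Y ∼ Θ` given `Θ`:
the relative entropy of the joint law with respect to the product of the marginals. -/
noncomputable def mutualInformation (prior : Measure (stdSimplex ℝ A)) : ENNReal :=
  InformationTheory.klDiv (prior ⊗ₘ symbolKernel) (prior.prod (symbolKernel ∘ₘ prior)) /
    ENNReal.ofReal (Real.log 2)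

end

/-! ### Markov log loss of an individual sequence -/

section Markov

variable {A : Type*} [DecidableEq A]

/-- Relative frequency of the `(k+1)`-tuple `(u, a)` among the `n - k` windows of length `k + 1`
in the first `n` symbols of `x` (zero if there is no window). -/
noncomputable def empirical (k : ℕ) (x : ℕ → A) (n : ℕ) (u : Fin k → A) (a : A) : ℝ :=
  (((Finset.range (n - k)).filter
    fun i => (∀ j : Fin k, x (i + j) = u j) ∧ x (i + k) = a).card : ℝ) / ((n - k : ℕ) : ℝ)

variable [Fintype A]

/-- The `k`-th order empirical conditional entropy `∑ p(u,a) log (p(u) / p(u,a))` of the first `n`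
symbols of `x`; terms with `p(u,a) = 0` vanish. -/
noncomputable def empiricalCondEntropy (k : ℕ) (x : ℕ → A) (n : ℕ) : ℝ :=
  ∑ u : Fin k → A, ∑ a : A, empirical k x n u a *
    Real.logb 2 ((∑ b : A, empirical k x n u b) / empirical k x n u a)

/-- `μ_k(x)`. The sequence whose limsup is taken lies in `[0, log |A|]`. -/
noncomputable def markovLogLoss (k : ℕ) (x : ℕ → A) : ℝ :=
  limsup (fun n => empiricalCondEntropy k x n) atTop

end Markov

/-! ### Finite-state sequential probability assignments -/

section FiniteState

variable {A : Type*} [Fintype A]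

/-- A sequential probability assignment with `m` states. -/
structure FSModel (m : ℕ) (A : Type*) [Fintype A] where
  start : Fin m
  next : Fin m → A → Fin m
  prob : Fin m → stdSimplex ℝ A

/-- The state before reading `x t`. -/
def FSModel.state {m : ℕ} (q : FSModel m A) (x : ℕ → A) : ℕ → Fin m
  | 0 => q.start
  | t + 1 => q.next (q.state x t) (x t)

/-- The probability assigned to `x t` given the earlier symbols. -/
def FSModel.assigned {m : ℕ} (q : FSModel m A) (x : ℕ → A) (t : ℕ) : ℝ :=
  (q.prob (q.state x t)).1 (x t)

/-- The least per-symbol log loss on the first `n` symbols of `x` among all assignments with at most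
`M` states. An assignment that gives probability zero to one of these symbols has infinite loss and
is left out. -/
noncomputable def fsLogLossAt (M : ℕ) (x : ℕ → A) (n : ℕ) : ℝ :=
  sInf {r | ∃ m ≤ M, ∃ q : FSModel m A, (∀ t < n, 0 < q.assigned x t) ∧
    r = (∑ t ∈ Finset.range n, -Real.logb 2 (q.assigned x t)) / n}

/-- The asymptotic log loss of the best assignments with at most `M` states. -/
noncomputable def fsLogLoss (M : ℕ) (x : ℕ → A) : ℝ :=
  limsup (fun n => fsLogLossAt M x n) atTop

/-! ### Finite-state compressibility -/

/-- A finite-state encoder with `m` states; each step outputs a (possibly empty) binary word. -/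
structure FSEncoder (m : ℕ) (A : Type*) where
  start : Fin m
  next : Fin m → A → Fin m
  out : Fin m → A → List Bool

end FiniteState

namespace FSEncoder

variable {m : ℕ} {A : Type*}

/-- Final state after reading a word from state `z`. -/
def run (E : FSEncoder m A) (z : Fin m) (w : List A) : Fin m := w.foldl E.next z

/-- Concatenated output when a word is read from state `z`. -/
def output (E : FSEncoder m A) : Fin m → List A → List Bool
  | _, [] => []
  | z, a :: w => E.out z a ++ E.output (E.next z a) w

/-- Initial state, output and final state determine the input among the words of its length. -/
def InformationLossless (E : FSEncoder m A) : Prop :=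
  ∀ (z : Fin m) (v w : List A), v.length = w.length → E.output z v = E.output z w →
    E.run z v = E.run z w → v = w

end FSEncoder

section Compressibility

variable {A : Type*} [Fintype A]

/-- The least compression ratio (output bits divided by `n log |A|`) on the first `n` symbols of
`x` among all information lossless encoders with at most `s` states. -/
noncomputable def fsCompressionRatio (s : ℕ) (x : ℕ → A) (n : ℕ) : ℝ :=
  sInf {r | ∃ m ≤ s, ∃ E : FSEncoder m A, E.InformationLossless ∧
    r = ((E.output E.start ((List.range n).map x)).length : ℝ) /
      (n * Real.logb 2 (Fintype.card A))}

/-- `ρ_s(x)`; the finite-state compressibility of `x` is the limit of this as `s → ∞`. -/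
noncomputable def fsCompressibility (s : ℕ) (x : ℕ → A) : ℝ :=
  limsup (fun n => fsCompressionRatio s x n) atTop

end Compressibility

end LZ78

set_option linter.unusedSectionVars false

/-! The theorem rests on a law of large numbers along the tree. Give every node its own parameter
and its own symbols, indexed by the phrase number; `source_eq_map_nodeSeq` identifies the law of the
source with that of the resulting sequence. Symbols emitted at one node share a parameter and are
dependent, so the averaging has to take place across nodes.

Fix a rank `b`. Along the path followed in one phrase the numbers of earlier visits strictly
decrease, so a phrase contains at most one node that is visited for the `b`-th time, and a node is
selected in at most one phrase. Whether `v` is selected depends only on the data at its proper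
prefixes, and the data at `v` can influence only the nodes below it, whose `b`-th visits come later.
Hence bounded functions of the data at the selected nodes, centred at each node, behave like
martingale differences (`predictableSelection_hitNode`), and an exponential supermartingale with
Borel–Cantelli controls their sums. Ranks are grouped into blocks of geometrically growing length,
so that after `m` phrases only O(log m) blocks matter. The additive errors sum to a small multiple
of m log m, and m log m = O(n) because the phrases are distinct. This gives `ae_tendsto_average`.

Applied to 1[node ends in u] (1[X = a] - p(a)) with p = E[Θ], it shows by induction on the length
that every word has its i.i.d. frequency under p (`ae_hasIIDFrequencies`); the node is shorter than
u at only o(n) times. What remains for the log losses is deterministic. Empirical conditional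
entropies converge by continuity. A machine with boundedly many states satisfies a Kraft-type
inequality on windows of length k up to a factor that is at most linear in k, so its cost per symbol
is at least H(p) - O((log k)/k) asymptotically (`HasIIDFrequencies.eventually_le_average`). A
smoothed one-state model and a block code attain H(p).

For the entropy rate, H(X^n) is at least the conditional entropy given all parameters, by Jensen.
Conversely, quantised parameters of the o(n) visited nodes can be described at cost o(n). In both
bounds the mean loss per symbol converges by the same law of large numbers. The mutual information
is computed from the density θ(a) / p(a). -/

namespace LZ78

/-! ### Combinatorics of the incremental parsing of a fixed sequence. -/

section Parse

variable {A : Type*} [DecidableEq A]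

/-- The parsing state before time `t` of an individual sequence. -/
def parse (x : ℕ → A) : ℕ → ParseState A
  | 0 => ParseState.init
  | t + 1 => (parse x t).step (x t)

/-- The current node at time `t`. -/
def node (x : ℕ → A) (t : ℕ) : List A := (parse x t).cur

/-- The number of phrases completed before time `t`. -/
def phrase (x : ℕ → A) (t : ℕ) : ℕ := (parse x t).tree.length - 1

theorem parse_congr {x y : ℕ → A} {t : ℕ} (h : ∀ s < t, x s = y s) : parse x t = parse y t := by
  induction t with
  | zero => rfl
  | succ t ih =>
    rw [parse, parse, ih fun s hs => h s (by omega), h t (by omega)]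

theorem node_congr {x y : ℕ → A} {t : ℕ} (h : ∀ s < t, x s = y s) : node x t = node y t := by
  rw [node, node, parse_congr h]

theorem nil_mem_tree (x : ℕ → A) (t : ℕ) : [] ∈ (parse x t).tree := by
  induction t with
  | zero => simp [parse, ParseState.init]
  | succ t ih =>
    simp only [parse, ParseState.step]
    split_ifs <;> simp [ih]

theorem tree_length_eq (x : ℕ → A) (t : ℕ) : (parse x t).tree.length = phrase x t + 1 := by
  have := List.length_pos_of_mem (nil_mem_tree x t)
  simp only [phrase]; omega

/-- A step inside the tree, or the end of a phrase. -/
theorem parse_succ_cases (x : ℕ → A) (t : ℕ) :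
    (node x t ++ [x t] ∈ (parse x t).tree ∧ (parse x (t + 1)).tree = (parse x t).tree ∧
      node x (t + 1) = node x t ++ [x t] ∧ phrase x (t + 1) = phrase x t) ∨
    (node x t ++ [x t] ∉ (parse x t).tree ∧
      (parse x (t + 1)).tree = (parse x t).tree ++ [node x t ++ [x t]] ∧
      node x (t + 1) = [] ∧ phrase x (t + 1) = phrase x t + 1) := by
  have h := tree_length_eq x t
  by_cases hm : node x t ++ [x t] ∈ (parse x t).tree
  · left
    rw [node] at hm
    simp [node, phrase, parse, ParseState.step, hm]
  · right
    rw [node] at hm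
    simp [node, phrase, parse, ParseState.step, hm]
    rw [h]; simp

theorem node_mem_tree (x : ℕ → A) (t : ℕ) : node x t ∈ (parse x t).tree := by
  cases t with
  | zero => simp [node, parse, ParseState.init]
  | succ t =>
    rcases parse_succ_cases x t with ⟨h1, h2, h3, -⟩ | ⟨-, -, h3, -⟩
    · rw [h2, h3]; exact h1
    · rw [h3]; exact nil_mem_tree x _

theorem tree_subset (x : ℕ → A) {s t : ℕ} (h : s ≤ t) :
    (parse x s).tree ⊆ (parse x t).tree := by
  induction t, h using Nat.le_induction with
  | base => exact fun _ h => h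
  | succ t _ ih =>
    rcases parse_succ_cases x t with ⟨-, h2, -⟩ | ⟨-, h2, -⟩ <;> rw [h2]
    · exact ih
    · exact fun v hv => List.mem_append_left _ (ih hv)

theorem phrase_mono (x : ℕ → A) : Monotone (phrase x) := by
  refine monotone_nat_of_le_succ fun t => ?_
  rcases parse_succ_cases x t with ⟨-, -, -, h⟩ | ⟨-, -, -, h⟩ <;> omega

theorem phrase_succ_le (x : ℕ → A) (t : ℕ) : phrase x (t + 1) ≤ phrase x t + 1 := by
  rcases parse_succ_cases x t with ⟨-, -, -, h⟩ | ⟨-, -, -, h⟩ <;> omega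

theorem phrase_zero (x : ℕ → A) : phrase x 0 = 0 := rfl

theorem tree_nodup (x : ℕ → A) (t : ℕ) : (parse x t).tree.Nodup := by
  induction t with
  | zero => simp [parse, ParseState.init]
  | succ t ih =>
    rcases parse_succ_cases x t with ⟨-, h2, -⟩ | ⟨h1, h2, -⟩ <;> rw [h2]
    · exact ih
    · exact List.nodup_append.2 ⟨ih, by simp, by
        intro a ha b hb hab
        rw [List.mem_singleton] at hb
        exact h1 (by rw [← hb, ← hab]; exact ha)⟩

theorem length_lt_of_mem_tree (x : ℕ → A) (t : ℕ) :
    ∀ v ∈ (parse x t).tree, v.length < (parse x t).tree.length := by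
  induction t with
  | zero => simp [parse, ParseState.init]
  | succ t ih =>
    rcases parse_succ_cases x t with ⟨-, h2, -⟩ | ⟨-, h2, -⟩ <;> rw [h2]
    · exact ih
    · intro v hv
      have hn := ih _ (node_mem_tree x t)
      rcases List.mem_append.1 hv with hv | hv
      · have := ih v hv; simp; omega
      · rw [List.mem_singleton] at hv
        subst hv; simp; omega

theorem length_node_le (x : ℕ → A) (t : ℕ) : (node x t).length ≤ phrase x t := by
  have := length_lt_of_mem_tree x t _ (node_mem_tree x t)
  rw [tree_length_eq] at this; omega

/-- Time is the total length of the phrases. -/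
theorem sum_length_tree (x : ℕ → A) (t : ℕ) :
    ((parse x t).tree.map List.length).sum + (node x t).length = t := by
  induction t with
  | zero => simp [node, parse, ParseState.init]
  | succ t ih =>
    rcases parse_succ_cases x t with ⟨-, h2, h3, -⟩ | ⟨-, h2, h3, -⟩ <;> rw [h2, h3] <;>
      simp <;> omega

/-- A crude bound, from phrases no longer than the number of phrases; it serves only to show that
the phrase number is unbounded. -/
theorem le_phrase_sq (x : ℕ → A) (t : ℕ) : t ≤ (phrase x t + 1) * phrase x t + phrase x t := by
  have h1 := sum_length_tree x t
  have h2 := length_node_le x t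
  have h3 := List.sum_le_card_nsmul ((parse x t).tree.map List.length) (phrase x t) (by
    intro a ha
    obtain ⟨v, hv, rfl⟩ := List.mem_map.1 ha
    have := length_lt_of_mem_tree x t v hv
    rw [tree_length_eq] at this; omega)
  rw [List.length_map, tree_length_eq, smul_eq_mul] at h3
  omega

theorem phrase_unbounded (x : ℕ → A) (m : ℕ) : ∃ t, m ≤ phrase x t := by
  refine ⟨(m + 1) * m + m, ?_⟩
  by_contra! h
  have h1 := le_phrase_sq x ((m + 1) * m + m)
  set p := phrase x ((m + 1) * m + m)
  nlinarith

/-- The last clause turns sums over the times before `t` into sums over the phrases before `m`. -/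
theorem exists_phrase_start (x : ℕ → A) (m : ℕ) : ∃ t, phrase x t = m ∧ node x t = [] ∧
    ∀ s, s < t ↔ phrase x s < m := by
  classical
  have hex := phrase_unbounded x m
  have hs := Nat.find_spec hex
  have hm := fun s (hs : s < Nat.find hex) => Nat.find_min hex hs
  have key : ∀ s, s < Nat.find hex ↔ phrase x s < m := fun s =>
    ⟨fun h => not_le.1 (hm s h), fun h => by
      by_contra! h'
      exact absurd (hs.trans (phrase_mono x h')) (not_le.2 h)⟩
  refine ⟨Nat.find hex, ?_, ?_, key⟩
  · rcases h0 : Nat.find hex with _ | s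
    · rw [h0, phrase_zero] at hs; rw [phrase_zero]; omega
    · have h1 := hm s (by omega)
      have h2 := phrase_succ_le x s
      rw [h0] at hs; omega
  · rcases h0 : Nat.find hex with _ | s
    · rfl
    · have h1 := hm s (by omega)
      rw [h0] at hs
      rcases parse_succ_cases x s with ⟨-, -, -, h⟩ | ⟨-, -, h3, h⟩
      · omega
      · exact h3

theorem node_of_phrase_eq (x : ℕ → A) {s t : ℕ} (hst : s ≤ t) (h : phrase x s = phrase x t) :
    node x s <+: node x t ∧ (node x t).length = (node x s).length + (t - s) := by
  induction t, hst using Nat.le_induction with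
  | base => exact ⟨List.prefix_rfl, by omega⟩
  | succ t hst ih =>
    have h1 := phrase_mono x hst
    rcases parse_succ_cases x t with ⟨-, -, h3, h4⟩ | ⟨-, -, -, h4⟩
    · obtain ⟨i1, i2⟩ := ih (by omega)
      rw [h3]
      exact ⟨i1.trans (List.prefix_append _ _), by simp [i2]; omega⟩
    · omega

/-- Depth grows by one at each step within a phrase, so phrase number and depth together label the
times injectively. -/
theorem eq_of_node_phrase_eq (x : ℕ → A) {s t : ℕ} (hn : (node x s).length = (node x t).length)
    (hp : phrase x s = phrase x t) : s = t := by
  rcases le_total s t with h | h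
  · have := (node_of_phrase_eq x h hp).2; omega
  · have := (node_of_phrase_eq x h hp.symm).2; omega

theorem node_suffix (x : ℕ → A) (t : ℕ) : node x t <:+ (List.range t).map x := by
  induction t with
  | zero => simp [node, parse, ParseState.init]
  | succ t ih =>
    rcases parse_succ_cases x t with ⟨-, -, h3, -⟩ | ⟨-, -, h3, -⟩ <;> rw [h3]
    · rw [List.range_succ, List.map_append]
      obtain ⟨w, hw⟩ := ih
      exact ⟨w, by rw [← hw]; simp⟩
    · exact List.nil_suffix

/-- The word of the current node is the most recent part of the past, so at depth at least `k` the
last `k` symbols can be read off the node. Window events thus become events about nodes. -/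
theorem ofFn_suffix_node_iff (x : ℕ → A) {t k : ℕ} (hk : k ≤ (node x t).length) (u : Fin k → A) :
    List.ofFn u <:+ node x t ↔ ∀ j : Fin k, x (t - k + j) = u j := by
  have hs := node_suffix x t
  have hkt : k ≤ t := by have := hs.length_le; simp at this; omega
  have hlast : (List.range t).map x = (List.range (t - k)).map x ++
      List.ofFn fun j : Fin k => x (t - k + j) := by
    conv_lhs => rw [show t = t - k + k by omega, List.range_add, List.map_append]
    congr 1
    apply List.ext_getElem <;> simp
  have h1 : List.ofFn u <:+ node x t ↔ List.ofFn u <:+ (List.range t).map x :=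
    ⟨fun h => h.trans hs, fun h => List.suffix_of_suffix_length_le h hs (by simpa using hk)⟩
  rw [h1, hlast]
  constructor
  · rintro ⟨w, hw⟩
    have := (List.append_inj' hw (by simp)).2
    rw [List.ofFn_inj] at this
    intro j; rw [this]
  · intro h
    rw [show u = fun j : Fin k => x (t - k + j) from funext fun j => (h j).symm]
    exact List.suffix_append _ _

/-- Each phrase passes each depth at most once, so it contributes at most `k` such times. -/
theorem card_short_node_le (x : ℕ → A) (n k : ℕ) :
    ((Finset.range n).filter fun t => (node x t).length < k).card ≤ (phrase x n + 1) * k := by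
  rw [← Finset.card_range (phrase x n + 1), ← Finset.card_range k, ← Finset.card_product,
    Finset.card_range]
  refine Finset.card_le_card_of_injOn (fun t => (phrase x t, (node x t).length)) ?_ ?_
  · intro t ht
    simp only [Finset.coe_filter, Finset.mem_range, Set.mem_ofPred_eq] at ht
    have := phrase_mono x ht.1.le
    simp only [Finset.coe_product, Set.mem_prod, Finset.coe_range, Set.mem_Iio]
    omega
  · intro s _ t _ h
    simp only [Prod.mk.injEq] at h
    exact eq_of_node_phrase_eq x h.2 h.1

variable [Fintype A]

/-- A word of length at most `d`, padded with `none`, is a function from `Fin d` to `Option A`. -/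
theorem card_filter_length_le (s : Finset (List A)) (d : ℕ) :
    (s.filter fun v => v.length ≤ d).card ≤ (Fintype.card A + 1) ^ d := by
  have h : Fintype.card (Fin d → Option A) = (Fintype.card A + 1) ^ d := by simp
  rw [← h, ← Finset.card_univ]
  refine Finset.card_le_card_of_injOn (fun v (i : Fin d) => v[(i : ℕ)]?) (fun _ _ => by simp) ?_
  intro v hv w hw hvw
  simp only [Finset.coe_filter, Set.mem_ofPred_eq] at hv hw
  refine List.ext_getElem? fun i => ?_
  by_cases hi : i < d
  · exact congrFun hvw ⟨i, hi⟩
  · rw [List.getElem?_eq_none (by omega), List.getElem?_eq_none (by omega)]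

/-- Distinct phrases are long on average. -/
theorem mul_phrase_le (x : ℕ → A) (t d : ℕ) :
    d * phrase x t ≤ t + d * (Fintype.card A + 1) ^ d := by
  have h1 := sum_length_tree x t
  have h2 : ((parse x t).tree.map List.length).sum = ∑ v ∈ (parse x t).tree.toFinset, v.length :=
    (List.sum_toFinset _ (tree_nodup x t)).symm
  have h3 : (parse x t).tree.toFinset.card = phrase x t + 1 := by
    rw [List.toFinset_card_of_nodup (tree_nodup x t), tree_length_eq]
  have h4 := card_filter_length_le (parse x t).tree.toFinset d
  have h5 := Finset.card_filter_add_card_filter_not (s := (parse x t).tree.toFinset)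
    (fun v => v.length ≤ d)
  -- Only the words longer than `d` are charged, each at least `d`; the shorter ones are few by
  -- `h4`.
  have h6 : d * ((parse x t).tree.toFinset.filter fun v => ¬ v.length ≤ d).card ≤
      ∑ v ∈ (parse x t).tree.toFinset, v.length := by
    rw [mul_comm, ← smul_eq_mul]
    refine (Finset.card_nsmul_le_sum _ _ d ?_).trans
      (Finset.sum_le_sum_of_subset (Finset.filter_subset _ _))
    intro v hv
    have := (Finset.mem_filter.1 hv).2
    omega
  have h7 : d * (phrase x t + 1) ≤ d * (Fintype.card A + 1) ^ d +
      d * ((parse x t).tree.toFinset.filter fun v => ¬ v.length ≤ d).card := by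
    rw [← mul_add]; exact Nat.mul_le_mul_left _ (by omega)
  nlinarith

end Parse

/-! ### Parameter numbers correspond to nodes. -/

section Index

variable {A : Type*} [DecidableEq A]

theorem seen_prefix (x : ℕ → A) {s t : ℕ} (h : s ≤ t) :
    (parse x s).seen <+: (parse x t).seen := by
  induction t, h using Nat.le_induction with
  | base => exact List.prefix_rfl
  | succ t _ ih =>
    simp only [parse, ParseState.step]
    split_ifs
    · exact ih
    · exact ih.trans (List.prefix_append _ _)

theorem node_mem_seen (x : ℕ → A) {s t : ℕ} (h : s < t) : node x s ∈ (parse x t).seen := by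
  refine (seen_prefix x h).subset ?_
  simp only [parse, ParseState.step, node]
  split_ifs with h
  · exact h
  · simp

/-- Since `seen` grows only at its end, numbers assigned at different times can all be read as
positions in one later list, where equality of positions is equality of nodes. -/
theorem index_eq_idxOf (x : ℕ → A) {s t : ℕ} (h : s < t) :
    (parse x s).index = (parse x t).seen.idxOf (node x s) := by
  obtain ⟨w, hw⟩ := seen_prefix x h
  rw [← hw, List.idxOf_append_of_mem (node_mem_seen x (Nat.lt_succ_self s))]
  simp only [parse, ParseState.step, node, ParseState.index]
  split_ifs with h
  · rfl
  · rw [List.idxOf_append_of_notMem h, List.idxOf_cons_self, List.idxOf_eq_length h]; simp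

theorem index_eq_iff (x : ℕ → A) (s t : ℕ) :
    (parse x s).index = (parse x t).index ↔ node x s = node x t := by
  have hs : s < s + t + 1 := by omega
  have ht : t < s + t + 1 := by omega
  rw [index_eq_idxOf x hs, index_eq_idxOf x ht]
  exact List.idxOf_inj (node_mem_seen x hs)

end Index

/-! ### Visits of nodes by phrases. -/

section Visits

variable {A : Type*} [DecidableEq A]

/-- The node `v` is visited during the phrase number `m`. -/
def Visits (x : ℕ → A) (v : List A) (m : ℕ) : Prop := ∃ t, node x t = v ∧ phrase x t = m

theorem visits_nil (x : ℕ → A) (m : ℕ) : Visits x [] m := by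
  obtain ⟨t, h1, h2, -⟩ := exists_phrase_start x m
  exact ⟨t, h2, h1⟩

theorem Visits.comparable {x : ℕ → A} {v w : List A} {m : ℕ} (hv : Visits x v m)
    (hw : Visits x w m) : v <+: w ∨ w <+: v := by
  obtain ⟨s, rfl, hs⟩ := hv
  obtain ⟨t, rfl, ht⟩ := hw
  rcases le_total s t with h | h
  · exact .inl (node_of_phrase_eq x h (by omega)).1
  · exact .inr (node_of_phrase_eq x h (by omega)).1

theorem exists_of_mem_tree (x : ℕ → A) {t : ℕ} {v : List A} {a : A}
    (h : v ++ [a] ∈ (parse x t).tree) :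
    ∃ s < t, phrase x s < phrase x t ∧ node x s = v ∧ x s = a := by
  induction t with
  | zero => simp [parse, ParseState.init] at h
  | succ t ih =>
    rcases parse_succ_cases x t with ⟨-, h2, -, h4⟩ | ⟨-, h2, -, h4⟩
    · rw [h2] at h
      obtain ⟨s, h5, h6⟩ := ih h
      exact ⟨s, by omega, by rw [h4]; exact h6⟩
    · rw [h2, List.mem_append, List.mem_singleton] at h
      rcases h with h | h
      · obtain ⟨s, h5, h6, h7⟩ := ih h
        exact ⟨s, by omega, by omega, h7⟩
      · obtain ⟨h5, h6⟩ := List.append_inj' h rfl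
        exact ⟨t, by omega, by omega, h5.symm, by simpa using h6.symm⟩

theorem mem_tree_succ (x : ℕ → A) (t : ℕ) : node x t ++ [x t] ∈ (parse x (t + 1)).tree := by
  rcases parse_succ_cases x t with ⟨h1, h2, -⟩ | ⟨-, h2, -⟩ <;> rw [h2]
  · exact h1
  · simp

/-- A child is entered when its symbol is read at the parent and the child is already present, which
means that an earlier phrase read the same symbol there. This recursion expresses the visits to a
node through its parent alone. -/
theorem visits_concat_iff (x : ℕ → A) (v : List A) (a : A) (m : ℕ) :
    Visits x (v ++ [a]) m ↔ (∃ t, node x t = v ∧ phrase x t = m ∧ x t = a) ∧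
      ∃ s, node x s = v ∧ phrase x s < m ∧ x s = a := by
  constructor
  · rintro ⟨t, h1, h2⟩
    rcases t with _ | t
    · simp [node, parse, ParseState.init] at h1
    · rcases parse_succ_cases x t with ⟨h3, h4, h5, h6⟩ | ⟨-, -, h5, -⟩
      · rw [h5] at h1
        obtain ⟨s, -, h7, h8, h9⟩ := exists_of_mem_tree x h3
        have h10 := List.append_inj' h1 rfl
        have h11 : x t = a := by simpa using h10.2
        exact ⟨⟨t, h10.1, by omega, h11⟩, s, h8.trans h10.1, by omega, h9.trans h11⟩
      · rw [h5] at h1; simp at h1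
  · rintro ⟨⟨t, h1, h2, h3⟩, s, h4, h5, h6⟩
    have hst : s < t := by
      by_contra! h
      have := phrase_mono x h
      omega
    have hm : node x t ++ [x t] ∈ (parse x t).tree := by
      have := tree_subset x hst (mem_tree_succ x s)
      rwa [h4, h6, ← h1, ← h3] at this
    rcases parse_succ_cases x t with ⟨-, -, h7, h8⟩ | ⟨h7, -⟩
    · exact ⟨t + 1, by rw [h7, h1, h3], by omega⟩
    · exact absurd hm h7

theorem Visits.of_prefix {x : ℕ → A} {v w : List A} {m : ℕ} (hw : Visits x w m)
    (h : v <+: w) : Visits x v m := by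
  obtain ⟨u, rfl⟩ := h
  induction u using List.reverseRecOn with
  | nil => simpa using hw
  | append_singleton u a ih =>
    rw [← List.append_assoc, visits_concat_iff] at hw
    obtain ⟨⟨t, h1, h2, -⟩, -⟩ := hw
    exact ih ⟨t, h1, h2⟩

/-- Before a node is visited, each of its proper prefixes has a visit that did not reach it. -/
theorem Visits.exists_parent {x : ℕ → A} {v w : List A} {m : ℕ} (hw : Visits x w m)
    (h : v <+: w) (hne : v ≠ w) : ∃ m' < m, Visits x v m' ∧ ¬ Visits x w m' := by
  classical
  induction m using Nat.strong_induction_on with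
  | _ m ih =>
    obtain ⟨u, rfl⟩ := h
    rcases u with _ | ⟨a, u⟩
    · simp at hne
    · have hva : Visits x (v ++ [a]) m := hw.of_prefix ⟨u, by simp⟩
      obtain ⟨-, s, h1, h2, -⟩ := (visits_concat_iff x v a m).1 hva
      by_cases hc : Visits x (v ++ a :: u) (phrase x s)
      · obtain ⟨m', h3, h4⟩ := ih _ h2 hc
        exact ⟨m', by omega, h4⟩
      · exact ⟨_, h2, ⟨s, h1, rfl⟩, hc⟩

-- Every visit to `w` passes through `v`, and by `Visits.exists_parent` some earlier visit to `v`
-- misses `w`. The strict inequality is what makes the node of a given visit rank unique within a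
-- phrase.
open Classical in
theorem count_visits_lt {x : ℕ → A} {v w : List A} {m : ℕ} (hw : Visits x w m)
    (h : v <+: w) (hne : v ≠ w) :
    Nat.count (Visits x w) m < Nat.count (Visits x v) m := by
  obtain ⟨m', h1, h2, h3⟩ := hw.exists_parent h hne
  rw [Nat.count_eq_card_filter_range, Nat.count_eq_card_filter_range]
  refine Finset.card_lt_card (Finset.ssubset_iff_of_subset ?_ |>.2 ⟨m', ?_, ?_⟩)
  · exact Finset.monotone_filter_right _ fun i _ hi => hi.of_prefix h
  · simp [h1, h2]
  · simp [h3]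

end Visits

/-! ### Redrawing a coordinate of a product measure. -/

section Resample

open scoped ENNReal

variable {ι E : Type*} [DecidableEq ι] [MeasurableSpace E]

theorem measurePreserving_update_infinitePi (P : ι → Measure E) [∀ i, IsProbabilityMeasure (P i)]
    (i : ι) :
    MeasurePreserving (fun p : (ι → E) × E => Function.update p.1 i p.2)
      ((Measure.infinitePi P).prod (P i)) (Measure.infinitePi P) := by
  refine ⟨measurable_update', Measure.eq_infinitePi P fun s t ht => ?_⟩
  rw [Measure.map_apply measurable_update' (.pi s.countable_toSet fun i _ => ht i)]
  have hpre : (fun p : (ι → E) × E => Function.update p.1 i p.2) ⁻¹' (s : Set ι).pi t =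
      ((s.erase i : Finset ι) : Set ι).pi t ×ˢ (if i ∈ s then t i else Set.univ) := by
    ext ⟨ω, d⟩
    simp only [Set.mem_preimage, Set.mem_pi, Finset.mem_coe, Set.mem_prod, Finset.mem_erase]
    constructor
    · intro h
      refine ⟨fun j hj => by simpa [hj.1] using h j hj.2, ?_⟩
      split_ifs with hi
      · simpa using h i hi
      · trivial
    · rintro ⟨h1, h2⟩ j hj
      by_cases hji : j = i
      · subst hji; simpa [hj] using h2
      · simpa [hji] using h1 j ⟨hji, hj⟩
  rw [hpre, Measure.prod_prod, Measure.infinitePi_pi _ fun i _ => ht i]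
  split_ifs with hi
  · rw [mul_comm, Finset.mul_prod_erase s (fun j => P j (t j)) hi]
  · rw [Finset.erase_eq_of_notMem hi]; simp

/-- Redrawing one coordinate of a product measure does not change the law. -/
theorem lintegral_infinitePi_update (P : ι → Measure E) [∀ i, IsProbabilityMeasure (P i)] (i : ι)
    {f : (ι → E) → ℝ≥0∞} (hf : Measurable f) :
    ∫⁻ ω, f ω ∂Measure.infinitePi P =
      ∫⁻ ω, ∫⁻ d, f (Function.update ω i d) ∂P i ∂Measure.infinitePi P := by
  have h := measurePreserving_update_infinitePi P i
  rw [← h.lintegral_comp hf]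
  exact lintegral_prod _ (hf.comp h.measurable).aemeasurable

end Resample

/-! ### Exponential maximal inequality for predictable selections of coordinates. -/

section Ville

open scoped ENNReal

variable {ι E : Type*} [DecidableEq ι] [Countable ι] [MeasurableSpace E]

/-- A sequence of increments such that the `m`-th one is `ψ m v` if a coordinate `v` is selected at
step `m`, and zero if none is. -/
def increment (J : ℕ → (ι → E) → Option ι) (ψ : ℕ → ι → (ι → E) → ℝ) (m : ℕ) (ω : ι → E) : ℝ :=
  (J m ω).elim 0 fun v => ψ m v ω

/-- The exponent of the exponential supermartingale. -/
noncomputable def exponent (J : ℕ → (ι → E) → Option ι) (ψ : ℕ → ι → (ι → E) → ℝ) (r : ℝ) (m : ℕ)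
    (ω : ι → E) : ℝ :=
  r * increment J ψ m ω - if (J m ω).isSome then r ^ 2 / 2 else 0

/-- The exponential process, frozen once it has reached `c`. -/
noncomputable def stoppedExp (J : ℕ → (ι → E) → Option ι) (ψ : ℕ → ι → (ι → E) → ℝ) (r : ℝ)
    (c : ℝ≥0∞) : ℕ → (ι → E) → ℝ≥0∞
  | 0, _ => 1
  | m + 1, ω => if c ≤ stoppedExp J ψ r c m ω then stoppedExp J ψ r c m ω else
      stoppedExp J ψ r c m ω * ENNReal.ofReal (Real.exp (exponent J ψ r m ω))

/-- Each step selects at most one coordinate, in a way that does not depend on the value at that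
coordinate, and the increment is centred and bounded given the other coordinates. -/
structure PredictableSelection (ν : Measure E) (J : ℕ → (ι → E) → Option ι)
    (ψ : ℕ → ι → (ι → E) → ℝ) : Prop where
  measurableSet_select : ∀ m v, MeasurableSet {ω | J m ω = some v}
  measurable_inc : ∀ m v, Measurable (ψ m v)
  select_update : ∀ m v ω d, J m ω = some v → J m (Function.update ω v d) = some v
  select_past : ∀ m v ω d, J m ω = some v → ∀ m' < m, J m' (Function.update ω v d) = J m' ω
  inc_past : ∀ m v ω d, J m ω = some v → ∀ m' < m,
    increment J ψ m' (Function.update ω v d) = increment J ψ m' ω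
  abs_inc_le : ∀ m v ω, J m ω = some v → |ψ m v ω| ≤ 1
  integral_inc : ∀ m v ω, J m ω = some v → ∫ d, ψ m v (Function.update ω v d) ∂ν = 0

variable {ν : Measure E} [IsProbabilityMeasure ν] {J : ℕ → (ι → E) → Option ι}
  {ψ : ℕ → ι → (ι → E) → ℝ}

namespace PredictableSelection

theorem measurableSet_fiber (h : PredictableSelection ν J ψ) (m : ℕ) (o : Option ι) :
    MeasurableSet {ω | J m ω = o} := by
  rcases o with _ | v
  · have : {ω | J m ω = none} = (⋃ v, {ω | J m ω = some v})ᶜ := by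
      ext ω
      simp only [Set.mem_ofPred_eq, Set.mem_compl_iff, Set.mem_iUnion, not_exists]
      rcases J m ω with _ | v <;> simp
    rw [this]
    exact (MeasurableSet.iUnion fun v => h.measurableSet_select m v).compl
  · exact h.measurableSet_select m v

theorem measurable_of_fiber (h : PredictableSelection ν J ψ) {β : Type*} [MeasurableSpace β]
    (m : ℕ) {f : (ι → E) → β} {g : Option ι → (ι → E) → β} (hg : ∀ o, Measurable (g o))
    (hfg : ∀ ω, f ω = g (J m ω) ω) : Measurable f := by
  intro s hs
  have : f ⁻¹' s = ⋃ o, {ω | J m ω = o} ∩ g o ⁻¹' s := by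
    ext ω; simp [hfg]
  rw [this]
  exact MeasurableSet.iUnion fun o => (h.measurableSet_fiber m o).inter (hg o hs)

theorem measurable_exponent (h : PredictableSelection ν J ψ) (r : ℝ) (m : ℕ) :
    Measurable (exponent J ψ r m) := by
  refine h.measurable_of_fiber m (g := fun o ω => r * (o.elim 0 fun v => ψ m v ω) -
    if o.isSome then r ^ 2 / 2 else 0) (fun o => ?_) fun ω => rfl
  rcases o with _ | v
  · simp
  · exact ((h.measurable_inc m v).const_mul r).sub_const _

theorem measurable_stoppedExp (h : PredictableSelection ν J ψ) (r : ℝ) (c : ℝ≥0∞) (m : ℕ) :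
    Measurable (stoppedExp J ψ r c m) := by
  induction m with
  | zero => exact measurable_const
  | succ m ih =>
    exact Measurable.ite (measurableSet_le measurable_const ih) ih
      (ih.mul ((h.measurable_exponent r m).exp.ennreal_ofReal))

theorem stoppedExp_update (h : PredictableSelection ν J ψ) (r : ℝ) (c : ℝ≥0∞) {m : ℕ} {v : ι}
    {ω : ι → E} (hv : J m ω = some v) (d : E) :
    ∀ m' ≤ m, stoppedExp J ψ r c m' (Function.update ω v d) = stoppedExp J ψ r c m' ω := by
  intro m' hm'
  induction m' with
  | zero => rfl
  | succ m' ih =>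
    simp only [stoppedExp, exponent, ih (by omega), h.select_past m v ω d hv m' (by omega),
      h.inc_past m v ω d hv m' (by omega)]

/-- Hoeffding's lemma: a centred variable with values in [-1, 1] is sub-Gaussian with variance proxy
1, which is exactly compensated by `r ^ 2 / 2`. -/
theorem lintegral_exp_le (h : PredictableSelection ν J ψ) (r : ℝ) {m : ℕ} {v : ι} {ω : ι → E}
    (hv : J m ω = some v) :
    ∫⁻ d, ENNReal.ofReal (Real.exp (exponent J ψ r m (Function.update ω v d))) ∂ν ≤ 1 := by
  have hJ := fun d => h.select_update m v ω d hv
  have hmeas : Measurable fun d => ψ m v (Function.update ω v d) :=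
    (h.measurable_inc m v).comp (measurable_update ω)
  have hb : ∀ d, ψ m v (Function.update ω v d) ∈ Set.Icc (-1 : ℝ) 1 := fun d =>
    abs_le.1 (h.abs_inc_le m v _ (hJ d))
  have hs := hasSubgaussianMGF_of_mem_Icc_of_integral_eq_zero (μ := ν) hmeas.aemeasurable
    (ae_of_all _ hb) (h.integral_inc m v ω hv)
  have h1 := hs.mgf_le r
  have h2 := hs.integrable_exp_mul r
  have heq : ∀ d, exponent J ψ r m (Function.update ω v d) =
      r * ψ m v (Function.update ω v d) - r ^ 2 / 2 := by
    intro d; simp [exponent, increment, hJ d]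
  simp_rw [heq, Real.exp_sub]
  rw [← ofReal_integral_eq_lintegral_ofReal (h2.div_const _) (ae_of_all _ fun d => by positivity),
    integral_div]
  rw [ENNReal.ofReal_le_one, div_le_one (Real.exp_pos _)]
  refine h1.trans (Real.exp_le_exp.2 (le_of_eq ?_))
  norm_num

/-- The supermartingale property without a filtration: split according to the selected coordinate
and redraw it. The process up to step `m` does not change, and the new factor has mean at most one.
-/
theorem lintegral_stoppedExp_succ_le (h : PredictableSelection ν J ψ) (r : ℝ) (c : ℝ≥0∞) (m : ℕ) :
    ∫⁻ ω, stoppedExp J ψ r c (m + 1) ω ∂(Measure.infinitePi fun _ : ι => ν) ≤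
      ∫⁻ ω, stoppedExp J ψ r c m ω ∂(Measure.infinitePi fun _ : ι => ν) := by
  have hU : (⋃ o, {ω | J m ω = o}) = Set.univ := by ext ω; simp
  have hd : Pairwise (Function.onFun Disjoint fun o : Option ι => {ω | J m ω = o}) := by
    intro o o' hoo
    refine Set.disjoint_left.2 fun ω h1 h2 => hoo ?_
    exact h1.symm.trans h2
  rw [← setLIntegral_univ, ← hU, lintegral_iUnion (h.measurableSet_fiber m) hd,
    ← setLIntegral_univ (stoppedExp J ψ r c m), ← hU, lintegral_iUnion (h.measurableSet_fiber m) hd]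
  refine ENNReal.tsum_le_tsum fun o => ?_
  rcases o with _ | v
  · refine setLIntegral_mono (h.measurable_stoppedExp r c m) fun ω hω => ?_
    rw [Set.mem_ofPred_eq] at hω
    simp [stoppedExp, exponent, increment, hω]
  · have hB := h.measurableSet_fiber m (some v)
    rw [← lintegral_indicator hB, ← lintegral_indicator hB,
      lintegral_infinitePi_update (fun _ => ν) v
        ((h.measurable_stoppedExp r c (m + 1)).indicator hB)]
    refine lintegral_mono fun ω => ?_
    by_cases hω : J m ω = some v
    · have hmem : ∀ d, Function.update ω v d ∈ {ω | J m ω = some v} := fun d =>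
        h.select_update m v ω d hω
      rw [Set.indicator_of_mem (by exact hω)]
      simp only [Set.indicator_of_mem (hmem _), stoppedExp, h.stoppedExp_update r c hω _ m le_rfl]
      split_ifs with hc
      · simp
      · have hme : Measurable fun d =>
            ENNReal.ofReal (Real.exp (exponent J ψ r m (Function.update ω v d))) :=
          ((h.measurable_exponent r m).comp (measurable_update ω)).exp.ennreal_ofReal
        rw [lintegral_const_mul _ hme]
        exact mul_le_of_le_one_right' (h.lintegral_exp_le r hω)
    -- Redrawing cannot enter the fibre either, since restoring the old value would stay in the
    -- fibre.
    · have hmem : ∀ d, Function.update ω v d ∉ {ω | J m ω = some v} := fun d hd => by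
        have := h.select_update m v _ (ω v) hd
        rw [Function.update_idem, Function.update_eq_self] at this
        exact hω this
      simp only [Set.indicator_of_notMem (hmem _), lintegral_zero]
      exact zero_le

theorem lintegral_stoppedExp_le (h : PredictableSelection ν J ψ) (r : ℝ) (c : ℝ≥0∞) (m : ℕ) :
    ∫⁻ ω, stoppedExp J ψ r c m ω ∂(Measure.infinitePi fun _ : ι => ν) ≤ 1 := by
  induction m with
  | zero => simp [stoppedExp]
  | succ m ih => exact (h.lintegral_stoppedExp_succ_le r c m).trans ih

/-- A maximal inequality of Ville type. -/
theorem measure_exists_le (h : PredictableSelection ν J ψ) (r x : ℝ) :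
    (Measure.infinitePi fun _ : ι => ν)
      {ω | ∃ m, x ≤ ∑ i ∈ Finset.range m, exponent J ψ r i ω} ≤ ENNReal.ofReal (Real.exp (-x)) := by
  set c := ENNReal.ofReal (Real.exp x) with hc
  have hc0 : c ≠ 0 := by simp [hc, Real.exp_pos]
  have hsub : {ω | ∃ m, x ≤ ∑ i ∈ Finset.range m, exponent J ψ r i ω} ⊆
      ⋃ m, {ω | c ≤ stoppedExp J ψ r c m ω} := by
    rintro ω ⟨m, hm⟩
    by_contra hcon
    simp only [Set.mem_iUnion, Set.mem_ofPred_eq, not_exists, not_le] at hcon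
    -- If the level `c` is never reached, nothing is frozen and the process is the plain
    -- exponential.
    have : ∀ m, stoppedExp J ψ r c m ω =
        ENNReal.ofReal (Real.exp (∑ i ∈ Finset.range m, exponent J ψ r i ω)) := by
      intro m
      induction m with
      | zero => simp [stoppedExp]
      | succ m ih =>
        rw [stoppedExp, if_neg (not_le.2 (hcon m)), ih, Finset.sum_range_succ, Real.exp_add,
          ENNReal.ofReal_mul (Real.exp_pos _).le]
    have h1 := hcon m
    rw [this] at h1
    exact absurd h1 (not_lt.2 (ENNReal.ofReal_le_ofReal (Real.exp_le_exp.2 hm)))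
  -- Freezing makes these events increase, so Markov's inequality at each fixed `m` bounds their
  -- union.
  have hmono : Monotone fun m => {ω | c ≤ stoppedExp J ψ r c m ω} := by
    refine monotone_nat_of_le_succ fun m ω hω => ?_
    simp only [Set.mem_ofPred_eq, stoppedExp] at hω ⊢
    rwa [if_pos hω]
  refine (measure_mono hsub).trans ?_
  rw [hmono.measure_iUnion]
  refine iSup_le fun m => ?_
  have h1 := mul_meas_ge_le_lintegral₀ (μ := Measure.infinitePi fun _ : ι => ν)
    (h.measurable_stoppedExp r c m).aemeasurable c
  have h2 := h1.trans (h.lintegral_stoppedExp_le r c m)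
  rw [Real.exp_neg, ENNReal.ofReal_inv_of_pos (Real.exp_pos _), ← hc]
  rw [mul_comm] at h2
  exact ENNReal.le_inv_iff_mul_le.2 h2

/-- The two-sided version, with a linear boundary. -/
theorem measure_exists_abs_le (h : PredictableSelection ν J ψ) {r : ℝ} (hr : 0 < r) (x : ℝ) :
    (Measure.infinitePi fun _ : ι => ν)
      {ω | ∃ m, (∑ i ∈ Finset.range m, if (J i ω).isSome then (1 : ℝ) else 0) * (r / 2) + x / r ≤
        |∑ i ∈ Finset.range m, increment J ψ i ω|} ≤ 2 * ENNReal.ofReal (Real.exp (-x)) := by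
  have hsub : {ω | ∃ m, (∑ i ∈ Finset.range m, if (J i ω).isSome then (1 : ℝ) else 0) * (r / 2) +
        x / r ≤ |∑ i ∈ Finset.range m, increment J ψ i ω|} ⊆
      {ω | ∃ m, x ≤ ∑ i ∈ Finset.range m, exponent J ψ r i ω} ∪
      {ω | ∃ m, x ≤ ∑ i ∈ Finset.range m, exponent J ψ (-r) i ω} := by
    rintro ω ⟨m, hm⟩
    have hsum : ∀ r : ℝ, ∑ i ∈ Finset.range m, exponent J ψ r i ω =
        r * ∑ i ∈ Finset.range m, increment J ψ i ω -
          (∑ i ∈ Finset.range m, if (J i ω).isSome then (1 : ℝ) else 0) * (r ^ 2 / 2) := by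
      intro r
      simp only [exponent, Finset.sum_sub_distrib, Finset.mul_sum, Finset.sum_mul]
      simp
    set T := ∑ i ∈ Finset.range m, if (J i ω).isSome then (1 : ℝ) else 0
    set S := ∑ i ∈ Finset.range m, increment J ψ i ω
    have hm2 : T * (r ^ 2 / 2) + x ≤ r * |S| := by
      have := mul_le_mul_of_nonneg_left hm hr.le
      have he : r * (T * (r / 2) + x / r) = T * (r ^ 2 / 2) + x := by field_simp
      linarith
    rcases abs_cases S with ⟨h1, -⟩ | ⟨h1, -⟩
    · left; exact ⟨m, by rw [hsum]; rw [h1] at hm2; linarith⟩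
    · right; exact ⟨m, by rw [hsum]; rw [h1] at hm2; rw [neg_sq]; linarith⟩
  refine (measure_mono hsub).trans ((measure_union_le _ _).trans ?_)
  rw [two_mul]
  exact add_le_add (h.measure_exists_le r x) (h.measure_exists_le (-r) x)

end PredictableSelection

/-- Borel–Cantelli for a sequence of selections. -/
theorem ae_eventually_abs_sum_increment_lt {J : ℕ → ℕ → (ι → E) → Option ι}
    {ψ : ℕ → ℕ → ι → (ι → E) → ℝ} (h : ∀ l, PredictableSelection ν (J l) (ψ l)) {ε : ℝ}
    (hε : 0 < ε) :
    ∀ᵐ ω ∂(Measure.infinitePi fun _ : ι => ν), ∀ᶠ l : ℕ in atTop, ∀ m,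
      |∑ i ∈ Finset.range m, increment (J l) (ψ l) i ω| <
        ε * (∑ i ∈ Finset.range m, (if (J l i ω).isSome then (1 : ℝ) else 0) + l) := by
  have hε2 : 0 < 2 * ε ^ 2 := by positivity
  -- With `r = 2ε` and `x = 2ε²l` the boundary is exactly ε times (number of selections + l), and
  -- the probabilities are bounded by a geometric series in `l`.
  have hsum : ∑' l : ℕ, (Measure.infinitePi fun _ : ι => ν)
      {ω | ∃ m, (∑ i ∈ Finset.range m, if (J l i ω).isSome then (1 : ℝ) else 0) * (2 * ε / 2) +
        (2 * ε ^ 2 * l) / (2 * ε) ≤ |∑ i ∈ Finset.range m, increment (J l) (ψ l) i ω|} ≠ ∞ := by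
    refine ne_top_of_le_ne_top (b := ∑' l : ℕ, 2 * ENNReal.ofReal (Real.exp (-(2 * ε ^ 2 * l)))) ?_
      (ENNReal.tsum_le_tsum fun l => (h l).measure_exists_abs_le (by positivity) _)
    rw [ENNReal.tsum_mul_left]
    refine ENNReal.mul_ne_top (by simp) ?_
    have hs : Summable fun l : ℕ => Real.exp (-(2 * ε ^ 2 * l)) := by
      have := Real.summable_exp_nat_mul_iff.2 (neg_lt_zero.2 hε2)
      refine this.congr fun l => by congr 1; ring
    rw [← ENNReal.ofReal_tsum_of_nonneg (fun l => (Real.exp_pos _).le) hs]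
    exact ENNReal.ofReal_ne_top
  filter_upwards [ae_eventually_notMem hsum] with ω hω
  filter_upwards [hω] with l hl m
  simp only [not_exists, not_le] at hl
  refine (hl m).trans_le (le_of_eq ?_)
  field_simp

end Ville

/-! ### Sequences read off an array by an addressing rule. -/

section Address

variable {A : Type*} [DecidableEq A] {ι : Type*}

/-- The parsing state when the symbol at time `t` is read off an array of sequences, at an address
that is a function of the parsing state and of the time. -/
def addrParse (addr : ParseState A → ℕ → ι × ℕ) {T : Type*} (ω : ι → T × (ℕ → A)) :
    ℕ → ParseState A
  | 0 => ParseState.init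
  | t + 1 => (addrParse addr ω t).step
      ((ω (addr (addrParse addr ω t) t).1).2 (addr (addrParse addr ω t) t).2)

/-- The sequence of the symbols that are read. -/
def addrSeq (addr : ParseState A → ℕ → ι × ℕ) {T : Type*} (ω : ι → T × (ℕ → A)) (t : ℕ) : A :=
  (ω (addr (addrParse addr ω t) t).1).2 (addr (addrParse addr ω t) t).2

variable {addr : ParseState A → ℕ → ι × ℕ} {T : Type*}

theorem addrParse_eq_parse (ω : ι → T × (ℕ → A)) (t : ℕ) :
    addrParse addr ω t = parse (addrSeq addr ω) t := by
  induction t with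
  | zero => rfl
  | succ t ih => rw [parse, ← ih]; rfl

theorem addrSeq_eq (ω : ι → T × (ℕ → A)) (t : ℕ) :
    addrSeq addr ω t = (ω (addr (parse (addrSeq addr ω) t) t).1).2
      (addr (parse (addrSeq addr ω) t) t).2 := by
  rw [← addrParse_eq_parse]; rfl

/-- The addresses on the right are computed from the fixed word, so a cylinder event becomes a
condition on a deterministic set of array entries. -/
theorem addrSeq_eq_iff (ω : ι → T × (ℕ → A)) (x : ℕ → A) (n : ℕ) :
    (∀ t < n, addrSeq addr ω t = x t) ↔
      ∀ t < n, (ω (addr (parse x t) t).1).2 (addr (parse x t) t).2 = x t := by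
  induction n with
  | zero => simp
  | succ n ih =>
    simp only [Nat.lt_succ_iff_lt_or_eq, or_imp, forall_and, forall_eq, ← ih]
    refine and_congr_right fun h => ?_
    rw [addrSeq_eq, parse_congr h]

theorem sequence_eq_addrSeq (ω : ℕ → T × (ℕ → A)) :
    sequence (fun j => (ω j).2) = addrSeq (fun s t => (s.index, t)) ω := by
  have h : ∀ t, parseState (fun j => (ω j).2) t = addrParse (fun s t => (s.index, t)) ω t := by
    intro t
    induction t with
    | zero => rfl
    | succ t ih => rw [parseState, addrParse, ← ih]
  funext t
  rw [sequence, addrSeq, h]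

end Address

/-! ### Measurability of the parsing and of the sequences read. -/

section Measurability

variable {A : Type*} [DecidableEq A] [Fintype A] [MeasurableSpace A] [MeasurableSingletonClass A]

instance : Countable (ParseState A) := by
  have hinj : Function.Injective
      (fun s : ParseState A => ((s.tree, s.seen, s.cur) : List (List A) × List (List A) × List A)) := by
    rintro ⟨a, b, c⟩ ⟨a', b', c'⟩ h
    simpa using h
  exact hinj.countable

theorem measurable_parse (t : ℕ) :
    @Measurable _ _ _ ⊤ fun x : ℕ → A => parse x t := by
  let _ : MeasurableSpace (ParseState A) := ⊤
  induction t with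
  | zero => exact measurable_const
  | succ t ih =>
    have hstep : Measurable fun p : ParseState A × A => p.1.step p.2 :=
      measurable_from_prod_countable_right fun s => measurable_of_countable _
    exact hstep.comp (ih.prodMk (measurable_pi_apply t))

theorem measurableSet_parse (t : ℕ) (p : ParseState A → Prop) :
    MeasurableSet {x : ℕ → A | p (parse x t)} :=
  @Measurable.setOf _ _ _ (@Measurable.comp _ _ _ _ ⊤ _ p _ (fun _ _ => trivial) (measurable_parse t))

theorem measurableSet_visits (v : List A) (m : ℕ) :
    MeasurableSet {x : ℕ → A | Visits x v m} := by
  have : {x : ℕ → A | Visits x v m} = ⋃ t, {x : ℕ → A | node x t = v ∧ phrase x t = m} := by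
    ext x; simp [Visits]
  rw [this]
  exact MeasurableSet.iUnion fun t =>
    measurableSet_parse t fun s => s.cur = v ∧ s.tree.length - 1 = m

theorem measurable_addrSeq {ι T : Type*} [MeasurableSpace T] (addr : ParseState A → ℕ → ι × ℕ) :
    Measurable fun ω : ι → T × (ℕ → A) => addrSeq addr ω := by
  let _ : MeasurableSpace (ParseState A) := ⊤
  have key : ∀ (t : ℕ) (f : (ι → T × (ℕ → A)) → ParseState A), Measurable f →
      Measurable fun ω : ι → T × (ℕ → A) => (ω (addr (f ω) t).1).2 (addr (f ω) t).2 := by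
    intro t f hf
    have hF : Measurable fun p : (ι → T × (ℕ → A)) × ParseState A =>
        (p.1 (addr p.2 t).1).2 (addr p.2 t).2 := by
      refine measurable_from_prod_countable_left fun s => ?_
      exact (measurable_pi_apply (addr s t).2).comp
        (measurable_snd.comp (measurable_pi_apply (addr s t).1))
    exact hF.comp (measurable_id.prodMk hf)
  have hstep : Measurable fun p : ParseState A × A => p.1.step p.2 :=
    measurable_from_prod_countable_right fun s => measurable_of_countable _
  have hstate : ∀ t : ℕ, Measurable fun ω : ι → T × (ℕ → A) => addrParse addr ω t := by
    intro t
    induction t with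
    | zero => exact measurable_const
    | succ t ih => exact hstep.comp (ih.prodMk (key t _ ih))
  exact measurable_pi_lambda _ fun t => key t _ (hstate t)

end Measurability

/-! ### Cylinder probabilities, and independence of the law from the addressing. -/

section Cylinder

open scoped ENNReal

variable {A : Type*} [Fintype A] [DecidableEq A] [MeasurableSpace A] [MeasurableSingletonClass A]

theorem symbolMeasure_singleton (θ : stdSimplex ℝ A) (a : A) :
    symbolMeasure θ {a} = ENNReal.ofReal (θ.1 a) := by
  simp only [symbolMeasure, Measure.coe_finsetSum, Finset.sum_apply, Measure.smul_apply,
    Measure.dirac_apply, smul_eq_mul]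
  rw [Finset.sum_eq_single a]
  · simp
  · intro b _ hb; simp [hb]
  · simp

theorem integral_symbolMeasure (θ : stdSimplex ℝ A) (f : A → ℝ) :
    ∫ a, f a ∂symbolMeasure θ = ∑ a, θ.1 a * f a := by
  rw [integral_fintype .of_finite]
  refine Finset.sum_congr rfl fun a _ => ?_
  rw [measureReal_def, symbolMeasure_singleton, ENNReal.toReal_ofReal (θ.2.1 a), smul_eq_mul]

/-- The joint law of a parameter and of a sequence of symbols drawn from it. -/
noncomputable def nodeLaw (prior : Measure (stdSimplex ℝ A)) : Measure (stdSimplex ℝ A × (ℕ → A)) :=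
  prior ⊗ₘ iidKernel

variable (prior : Measure (stdSimplex ℝ A)) [IsProbabilityMeasure prior]

instance : IsProbabilityMeasure (nodeLaw prior) :=
  inferInstanceAs (IsProbabilityMeasure (prior ⊗ₘ iidKernel))

theorem measurePreserving_nodeLaw (m : ℕ) :
    MeasurePreserving (fun d : stdSimplex ℝ A × (ℕ → A) => (d.1, d.2 m)) (nodeLaw prior)
      (prior ⊗ₘ symbolKernel) := by
  have hm : Measurable fun d : stdSimplex ℝ A × (ℕ → A) => (d.1, d.2 m) := by fun_prop
  refine ⟨hm, ?_⟩
  ext s hs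
  rw [Measure.map_apply hm hs, nodeLaw, Measure.compProd_apply (hm hs), Measure.compProd_apply hs]
  refine lintegral_congr fun θ => ?_
  have h := (measurePreserving_eval_infinitePi (fun _ : ℕ => symbolMeasure θ) m).measure_preimage
    (s := Prod.mk θ ⁻¹' s) (measurable_prodMk_left hs).nullMeasurableSet
  exact h

/-- Given everything else, a symbol of the array has the law given by its parameter. -/
theorem lintegral_eval_eq {ι : Type*} [DecidableEq ι] (v : ι) (m : ℕ) (a : A)
    {K : (ι → stdSimplex ℝ A × (ℕ → A)) → ℝ≥0∞} (hK : Measurable K)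
    (hinv : ∀ ω b, K (Function.update ω v ((ω v).1, Function.update (ω v).2 m b)) = K ω) :
    ∫⁻ ω, (if (ω v).2 m = a then K ω else 0) ∂(Measure.infinitePi fun _ : ι => nodeLaw prior) =
      ∫⁻ ω, ENNReal.ofReal ((ω v).1.1 a) * K ω ∂(Measure.infinitePi fun _ : ι => nodeLaw prior) := by
  have hset : MeasurableSet {ω : ι → stdSimplex ℝ A × (ℕ → A) | (ω v).2 m = a} :=
    (measurableSet_singleton a).preimage (by fun_prop :
      Measurable fun ω : ι → stdSimplex ℝ A × (ℕ → A) => (ω v).2 m)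
  have hmeas1 : Measurable fun ω : ι → stdSimplex ℝ A × (ℕ → A) =>
      if (ω v).2 m = a then K ω else 0 := hK.ite hset measurable_const
  have hcoord : Measurable fun θ : stdSimplex ℝ A => θ.1 a :=
    (measurable_pi_apply a).comp measurable_subtype_coe
  have hmeas2 : Measurable fun ω : ι → stdSimplex ℝ A × (ℕ → A) =>
      ENNReal.ofReal ((ω v).1.1 a) * K ω :=
    ((hcoord.comp ((measurable_pi_apply v).fst)).ennreal_ofReal).mul hK
  rw [lintegral_infinitePi_update (fun _ => nodeLaw prior) v hmeas1,
    lintegral_infinitePi_update (fun _ => nodeLaw prior) v hmeas2]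
  refine lintegral_congr fun ω => ?_
  refine (Measure.lintegral_compProd (hmeas1.comp (measurable_update ω))).trans
    (Eq.trans ?_ (Measure.lintegral_compProd (hmeas2.comp (measurable_update ω))).symm)
  refine lintegral_congr fun θ => ?_
  have hθ : Measurable fun y : ℕ → A => Function.update ω v (θ, y) :=
    (measurable_update ω).comp measurable_prodMk_left
  have h1 := lintegral_infinitePi_update (fun _ : ℕ => symbolMeasure θ) m (hmeas1.comp hθ)
  refine h1.trans ?_
  simp only [Function.comp_def, Function.update_self]
  change _ = ∫⁻ y, _ ∂(Measure.infinitePi fun _ : ℕ => symbolMeasure θ)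
  refine lintegral_congr fun y => ?_
  have hK' : ∀ b, K (Function.update ω v (θ, Function.update y m b)) =
      K (Function.update ω v (θ, y)) := by
    intro b
    have := hinv (Function.update ω v (θ, y)) b
    simpa using this
  simp only [hK']
  have : ∀ b, (if b = a then K (Function.update ω v (θ, y)) else 0) =
      Set.indicator {a} (fun _ => K (Function.update ω v (θ, y))) b := by
    intro b; simp [Set.indicator_apply]
  simp only [this]
  rw [lintegral_indicator_const (measurableSet_singleton a), symbolMeasure_singleton, mul_comm]

/-- The probability that finitely many distinct entries of the array take given values. -/
theorem lintegral_prod_eval_eq {ι : Type*} [DecidableEq ι] (e : ℕ → ι × ℕ) (x : ℕ → A) (n : ℕ)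
    (he : ∀ s < n, ∀ t < n, s ≠ t → e s ≠ e t)
    {G : (ι → stdSimplex ℝ A × (ℕ → A)) → ℝ≥0∞} (hG : Measurable G)
    (hinv : ∀ t < n, ∀ ω b, G (Function.update ω (e t).1
      ((ω (e t).1).1, Function.update (ω (e t).1).2 (e t).2 b)) = G ω) :
    ∫⁻ ω, (if ∀ t < n, (ω (e t).1).2 (e t).2 = x t then G ω else 0)
        ∂(Measure.infinitePi fun _ : ι => nodeLaw prior) =
      ∫⁻ ω, (∏ t ∈ Finset.range n, ENNReal.ofReal ((ω (e t).1).1.1 (x t))) * G ω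
        ∂(Measure.infinitePi fun _ : ι => nodeLaw prior) := by
  induction n generalizing G with
  | zero => simp
  | succ n ih =>
    have hcoord : Measurable fun θ : stdSimplex ℝ A => θ.1 (x n) :=
      (measurable_pi_apply _).comp measurable_subtype_coe
    have hset : MeasurableSet
        {ω : ι → stdSimplex ℝ A × (ℕ → A) | ∀ t < n, (ω (e t).1).2 (e t).2 = x t} := by
      simp only [Set.ofPred_forall]
      exact MeasurableSet.iInter fun t => MeasurableSet.iInter fun _ =>
        (measurableSet_singleton (x t)).preimage (by fun_prop :
          Measurable fun ω : ι → stdSimplex ℝ A × (ℕ → A) => (ω (e t).1).2 (e t).2)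
    -- The last entry is integrated out first: the indicator of the other entries does not see it,
    -- because the addresses differ. The resulting parameter factor then joins the weight in the
    -- induction hypothesis.
    have h1 := lintegral_eval_eq prior (e n).1 (e n).2 (x n)
      (K := fun ω => if ∀ t < n, (ω (e t).1).2 (e t).2 = x t then G ω else 0)
      (hG.ite hset measurable_const) (fun ω b => by
        rw [hinv n (by omega)]
        refine if_congr (forall_congr' fun t => imp_congr_right fun ht => ?_) rfl rfl
        have hne := he t (by omega) n (by omega) (by omega)
        by_cases hv : (e t).1 = (e n).1
        · have hm : (e t).2 ≠ (e n).2 := fun h => hne (Prod.ext hv h)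
          rw [hv]; simp [hm]
        · simp [hv])
    have h2 := ih (fun s hs t ht => he s (by omega) t (by omega))
      (G := fun ω => ENNReal.ofReal ((ω (e n).1).1.1 (x n)) * G ω)
      ((hcoord.comp ((measurable_pi_apply _).fst)).ennreal_ofReal.mul hG) (fun t ht ω b => by
        rw [hinv t (by omega)]
        congr 3
        by_cases hv : (e n).1 = (e t).1
        · simp [hv]
        · simp [hv])
    calc _ = ∫⁻ ω, (if (ω (e n).1).2 (e n).2 = x n then
          (if ∀ t < n, (ω (e t).1).2 (e t).2 = x t then G ω else 0) else 0)
          ∂(Measure.infinitePi fun _ : ι => nodeLaw prior) := by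
          refine lintegral_congr fun ω => ?_
          simp only [Nat.lt_succ_iff_lt_or_eq, or_imp, forall_and, forall_eq]
          by_cases h1 : (ω (e n).1).2 (e n).2 = x n <;> simp [h1]
      _ = _ := h1
      _ = ∫⁻ ω, (if ∀ t < n, (ω (e t).1).2 (e t).2 = x t then
          ENNReal.ofReal ((ω (e n).1).1.1 (x n)) * G ω else 0)
          ∂(Measure.infinitePi fun _ : ι => nodeLaw prior) := by
          refine lintegral_congr fun ω => ?_
          simp only [mul_ite, mul_zero]
      _ = _ := h2
      _ = _ := by
          refine lintegral_congr fun ω => ?_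
          rw [Finset.prod_range_succ, mul_assoc]

/-- Addresses are never used twice. -/
def FreshAddr {ι : Type*} (addr : ParseState A → ℕ → ι × ℕ) : Prop :=
  ∀ (x : ℕ → A) (s t : ℕ), s < t → addr (parse x s) s ≠ addr (parse x t) t

variable {prior}

/-- Given the parameters, the entries at distinct addresses are independent. The weight `G` records
the parameters, so that functions of them can be integrated over a cylinder. -/
theorem FreshAddr.lintegral_cylinder {ι : Type*} [DecidableEq ι] {addr : ParseState A → ℕ → ι × ℕ}
    (h : FreshAddr addr) (x : ℕ → A) (n : ℕ) {G : (ι → stdSimplex ℝ A) → ℝ≥0∞}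
    (hG : Measurable G) :
    ∫⁻ ω, (if ∀ t < n, addrSeq addr ω t = x t then G fun i => (ω i).1 else 0)
        ∂(Measure.infinitePi fun _ : ι => nodeLaw prior) =
      ∫⁻ ω, (∏ t ∈ Finset.range n, ENNReal.ofReal ((ω (addr (parse x t) t).1).1.1 (x t))) *
        G (fun i => (ω i).1) ∂(Measure.infinitePi fun _ : ι => nodeLaw prior) := by
  simp only [addrSeq_eq_iff]
  refine lintegral_prod_eval_eq prior (fun t => addr (parse x t) t) x n ?_
    (hG.comp (measurable_pi_lambda _ fun i => (measurable_pi_apply i).fst)) ?_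
  · intro s _ t _ hst
    rcases lt_or_gt_of_ne hst with hst | hst
    · exact h x s t hst
    · exact (h x t s hst).symm
  · intro t _ ω b
    congr 1
    funext i
    by_cases hi : i = (addr (parse x t) t).1
    · subst hi; simp
    · simp [hi]

/-- The law of a process is determined by the probabilities of the words. -/
theorem measure_ext_of_cylinder {μ ν : Measure (ℕ → A)} [IsFiniteMeasure μ] [IsFiniteMeasure ν]
    (h : ∀ (x : ℕ → A) (n : ℕ), μ {y | ∀ t < n, y t = x t} = ν {y | ∀ t < n, y t = x t}) :
    μ = ν := by
  have hr : ∀ n, μ.map ((Finset.range n).restrict (π := fun _ => A)) =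
      ν.map ((Finset.range n).restrict (π := fun _ => A)) := by
    intro n
    refine Measure.ext_of_singleton fun w => ?_
    rw [Measure.map_apply (Finset.measurable_restrict _) (measurableSet_singleton _),
      Measure.map_apply (Finset.measurable_restrict _) (measurableSet_singleton _)]
    rcases isEmpty_or_nonempty A with hA | ⟨⟨a⟩⟩
    · rw [Set.eq_empty_of_isEmpty ((Finset.range n).restrict (π := fun _ => A) ⁻¹' {w})]; simp
    · have : (Finset.range n).restrict (π := fun _ => A) ⁻¹' {w} =
          {y : ℕ → A | ∀ t < n, y t = if ht : t ∈ Finset.range n then w ⟨t, ht⟩ else a} := by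
        ext y
        simp only [Set.mem_preimage, Set.mem_singleton_iff, Set.mem_ofPred_eq, funext_iff,
          Finset.restrict, Subtype.forall, Finset.mem_range]
        refine forall_congr' fun t => forall_congr' fun ht => ?_
        simp [ht]
      rw [this]; exact h _ n
  refine IsProjectiveLimit.unique (P := fun I => μ.map I.restrict) (fun I => rfl) fun I => ?_
  have hI : I ⊆ Finset.range (I.sup id + 1) := fun i hi =>
    Finset.mem_range.2 (Nat.lt_succ_of_le (Finset.le_sup (f := id) hi))
  have := congrArg (fun ρ => ρ.map (Finset.restrict₂ (π := fun _ => A) hI)) (hr (I.sup id + 1))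
  rw [Measure.map_map (Finset.measurable_restrict₂ _) (Finset.measurable_restrict _),
    Measure.map_map (Finset.measurable_restrict₂ _) (Finset.measurable_restrict _),
    Finset.restrict₂_comp_restrict] at this
  exact this.symm

theorem measurableSet_cylinder (x : ℕ → A) (n : ℕ) :
    MeasurableSet {y : ℕ → A | ∀ t < n, y t = x t} := by
  simp only [Set.ofPred_forall]
  exact MeasurableSet.iInter fun t => MeasurableSet.iInter fun _ =>
    (measurableSet_singleton (x t)).preimage (measurable_pi_apply t)

theorem FreshAddr.map_cylinder {ι : Type*} [DecidableEq ι] {addr : ParseState A → ℕ → ι × ℕ}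
    (h : FreshAddr addr) (x : ℕ → A) (n : ℕ) :
    ((Measure.infinitePi fun _ : ι => nodeLaw prior).map (addrSeq addr))
        {y : ℕ → A | ∀ t < n, y t = x t} =
      ∫⁻ ω, (∏ t ∈ Finset.range n, ENNReal.ofReal ((ω (addr (parse x t) t).1).1.1 (x t)))
        ∂(Measure.infinitePi fun _ : ι => nodeLaw prior) := by
  have hm := measurable_addrSeq (T := stdSimplex ℝ A) addr
  rw [Measure.map_apply hm (measurableSet_cylinder x n)]
  have := h.lintegral_cylinder (prior := prior) x n (G := fun _ => 1) measurable_const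
  simp only [mul_one] at this
  rw [← this, ← lintegral_indicator_one (hm (measurableSet_cylinder x n))]
  refine lintegral_congr fun ω => ?_
  simp [Set.indicator_apply]

/-- Two ways of addressing the array that reuse parameters at the same times give the same law. -/
theorem map_addrSeq_eq {ι κ : Type*} [DecidableEq ι] [DecidableEq κ]
    {addr : ParseState A → ℕ → ι × ℕ} {addr' : ParseState A → ℕ → κ × ℕ} (h : FreshAddr addr)
    (h' : FreshAddr addr') (heq : ∀ (x : ℕ → A) s t, (addr (parse x s) s).1 = (addr (parse x t) t).1 ↔
      (addr' (parse x s) s).1 = (addr' (parse x t) t).1) :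
    (Measure.infinitePi fun _ : ι => nodeLaw prior).map (addrSeq addr) =
      (Measure.infinitePi fun _ : κ => nodeLaw prior).map (addrSeq addr') := by
  have hm := measurable_addrSeq (T := stdSimplex ℝ A) addr
  have hm' := measurable_addrSeq (T := stdSimplex ℝ A) addr'
  have : IsProbabilityMeasure ((Measure.infinitePi fun _ : ι => nodeLaw prior).map (addrSeq addr)) :=
    Measure.isProbabilityMeasure_map hm.aemeasurable
  have : IsProbabilityMeasure
      ((Measure.infinitePi fun _ : κ => nodeLaw prior).map (addrSeq addr')) :=
    Measure.isProbabilityMeasure_map hm'.aemeasurable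
  refine measure_ext_of_cylinder fun x n => ?_
  rw [h.map_cylinder, h'.map_cylinder]
  -- The pairs of labels that the two rules use at the same time. By `heq` both projections of `R`
  -- are injective, so both product measures restrict to the same product over `R`, on which the two
  -- integrands agree.
  let R := Set.range fun t => ((addr (parse x t) t).1, (addr' (parse x t) t).1)
  have hinj1 : Function.Injective fun r : R => r.1.1 := by
    rintro ⟨_, s, rfl⟩ ⟨_, t, rfl⟩ hst
    exact Subtype.ext (Prod.ext hst ((heq x s t).1 hst))
  have hinj2 : Function.Injective fun r : R => r.1.2 := by
    rintro ⟨_, s, rfl⟩ ⟨_, t, rfl⟩ hst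
    exact Subtype.ext (Prod.ext ((heq x s t).2 hst) hst)
  let r : ℕ → R := fun t => ⟨_, t, rfl⟩
  have hcoord : ∀ a, Measurable fun θ : stdSimplex ℝ A => θ.1 a := fun a =>
    (measurable_pi_apply a).comp measurable_subtype_coe
  have hF : Measurable fun ω : R → stdSimplex ℝ A × (ℕ → A) =>
      ∏ t ∈ Finset.range n, ENNReal.ofReal ((ω (r t)).1.1 (x t)) :=
    Finset.measurable_fun_prod _ fun t _ =>
      ((hcoord _).comp ((measurable_pi_apply _).fst)).ennreal_ofReal
  have e1 := Measure.map_infinitePi_infinitePi_of_inj (P := fun _ : ι => nodeLaw prior) hinj1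
  have e2 := Measure.map_infinitePi_infinitePi_of_inj (P := fun _ : κ => nodeLaw prior) hinj2
  have i1 := lintegral_map (μ := Measure.infinitePi fun _ : ι => nodeLaw prior) hF
    (g := fun ω (i : R) => ω i.1.1) (by fun_prop)
  have i2 := lintegral_map (μ := Measure.infinitePi fun _ : κ => nodeLaw prior) hF
    (g := fun ω (i : R) => ω i.1.2) (by fun_prop)
  rw [e1] at i1
  rw [e2] at i2
  exact i1.symm.trans i2

end Cylinder

/-! ### Coupling in which each node owns its data. -/

section NodeCoupling

variable {A : Type*} [DecidableEq A]

/-- Read the symbol at the current node under the number of the current phrase. -/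
def nodeAddr (s : ParseState A) (_ : ℕ) : List A × ℕ := (s.cur, s.tree.length - 1)

/-- The sequence produced when each node has its own parameter and its own symbols. -/
def nodeSeq {T : Type*} (ω : List A → T × (ℕ → A)) : ℕ → A := addrSeq nodeAddr ω

variable {T : Type*}

theorem nodeSeq_eq (ω : List A → T × (ℕ → A)) (t : ℕ) :
    nodeSeq ω t = (ω (node (nodeSeq ω) t)).2 (phrase (nodeSeq ω) t) :=
  addrSeq_eq ω t

/-- Given the visits to `v`, those to its children are a function of the symbols stored at `v`
alone. -/
theorem visits_concat_nodeSeq (ω : List A → T × (ℕ → A)) (v : List A) (a : A) (m : ℕ) :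
    Visits (nodeSeq ω) (v ++ [a]) m ↔ (Visits (nodeSeq ω) v m ∧ (ω v).2 m = a) ∧
      ∃ i < m, Visits (nodeSeq ω) v i ∧ (ω v).2 i = a := by
  rw [visits_concat_iff]
  constructor
  · rintro ⟨⟨t, h1, h2, h3⟩, s, h4, h5, h6⟩
    rw [nodeSeq_eq, h1, h2] at h3
    rw [nodeSeq_eq, h4] at h6
    exact ⟨⟨⟨t, h1, h2⟩, h3⟩, _, h5, ⟨s, h4, rfl⟩, h6⟩
  · rintro ⟨⟨⟨t, h1, h2⟩, h3⟩, i, h4, ⟨s, h5, h6⟩, h7⟩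
    refine ⟨⟨t, h1, h2, ?_⟩, s, h5, by omega, ?_⟩
    · rw [nodeSeq_eq, h1, h2, h3]
    · rw [nodeSeq_eq, h5, h6, h7]

/-- The visits to a node depend only on the data at its proper prefixes. -/
theorem visits_nodeSeq_update (ω : List A → T × (ℕ → A)) (v : List A) (d : T × (ℕ → A))
    {w : List A} (h : v <+: w → v = w) (m : ℕ) :
    Visits (nodeSeq (Function.update ω v d)) w m ↔ Visits (nodeSeq ω) w m := by
  induction w using List.reverseRecOn generalizing m with
  | nil => exact iff_of_true (visits_nil _ _) (visits_nil _ _)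
  | append_singleton w a ih =>
    have hvw : ¬ v <+: w := fun hp => by
      have h1 := h (hp.trans (List.prefix_append _ _))
      have h2 := hp.length_le
      rw [h1] at h2; simp at h2
    have hne : w ≠ v := fun h => hvw (h ▸ List.prefix_rfl)
    simp only [visits_concat_nodeSeq, ih fun hp => absurd hp hvw, Function.update_of_ne hne]

theorem freshAddr_nodeAddr [Fintype A] [MeasurableSpace A] [MeasurableSingletonClass A] :
    FreshAddr (nodeAddr (A := A)) := by
  intro x s t hst h
  have h1 := congrArg Prod.fst h
  have h2 := congrArg Prod.snd h
  exact hst.ne (eq_of_node_phrase_eq x (congrArg List.length h1) h2)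

theorem freshAddr_index [Fintype A] [MeasurableSpace A] [MeasurableSingletonClass A] :
    FreshAddr fun (s : ParseState A) t => (s.index, t) :=
  fun _ _ _ hst h => hst.ne (congrArg Prod.snd h)

end NodeCoupling

/-! ### The node visited for the b-th time in a phrase, and averages over its past visits. -/

section Selection

open Classical in
/-- During the phrase number `m`, the node `v` is visited for the `b`-th time. -/
def Hits {A : Type*} [DecidableEq A] (x : ℕ → A) (b : ℕ) (v : List A) (m : ℕ) : Prop :=
  Visits x v m ∧ Nat.count (Visits x v) m + 1 = b

variable {A : Type*} [DecidableEq A]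

open Classical in
theorem Hits.phrase_unique {x : ℕ → A} {b : ℕ} {v : List A} {m m' : ℕ} (h : Hits x b v m)
    (h' : Hits x b v m') : m = m' :=
  Nat.count_injective h.1 h'.1 (by have := h.2; have := h'.2; omega)

theorem Hits.lt_of_prefix {x : ℕ → A} {b : ℕ} {v w : List A} {m m' : ℕ} (h : Hits x b v m)
    (h' : Hits x b w m') (hp : v <+: w) (hne : v ≠ w) : m < m' := by
  classical
  have h1 := count_visits_lt h'.1 hp hne
  by_contra! hle
  have h2 := Nat.count_monotone (Visits x v) hle
  have := h.2
  have := h'.2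
  omega

/-- Nodes visited in one phrase lie on one path, along which the visit counts strictly decrease. -/
theorem Hits.node_unique {x : ℕ → A} {b : ℕ} {v w : List A} {m : ℕ} (h : Hits x b v m)
    (h' : Hits x b w m) : v = w := by
  by_contra hne
  rcases h.1.comparable h'.1 with hp | hp
  · exact (h.lt_of_prefix h' hp hne).false
  · exact (h'.lt_of_prefix h hp (Ne.symm hne)).false

open Classical in
/-- The node that is visited for the `b`-th time during the phrase number `m`. -/
noncomputable def hitNode (x : ℕ → A) (b m : ℕ) : Option (List A) :=
  if h : ∃ v, Hits x b v m then some h.choose else none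

theorem hitNode_eq_some_iff {x : ℕ → A} {b m : ℕ} {v : List A} :
    hitNode x b m = some v ↔ Hits x b v m := by
  unfold hitNode
  split_ifs with h
  · rw [Option.some_inj]
    exact ⟨fun hv => hv ▸ h.choose_spec, fun hv => h.choose_spec.node_unique hv⟩
  · simp only [false_iff]
    exact fun hv => h ⟨v, hv⟩

variable {T : Type*}

theorem hits_nodeSeq_update (ω : List A → T × (ℕ → A)) (v : List A) (d : T × (ℕ → A))
    {w : List A} (h : v <+: w → v = w) (b m : ℕ) :
    Hits (nodeSeq (Function.update ω v d)) b w m ↔ Hits (nodeSeq ω) b w m := by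
  have : Visits (nodeSeq (Function.update ω v d)) w = Visits (nodeSeq ω) w :=
    funext fun m => propext (visits_nodeSeq_update ω v d h m)
  classical
  simp only [Hits, this]

/-- New data at `v` can change visits only strictly below `v`. There the `b`-th visit comes after
that of `v`, both before and after the change, so no hit earlier than phrase `m` is affected. -/
theorem hits_nodeSeq_update_of_lt {ω : List A → T × (ℕ → A)} {v : List A} (d : T × (ℕ → A))
    {b m i : ℕ} (hv : Hits (nodeSeq ω) b v m) (hi : i < m) (w : List A) :
    Hits (nodeSeq (Function.update ω v d)) b w i ↔ Hits (nodeSeq ω) b w i := by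
  by_cases h : v <+: w → v = w
  · exact hits_nodeSeq_update ω v d h b i
  · push Not at h
    have hv' := (hits_nodeSeq_update ω v d (fun _ => rfl) b m).2 hv
    refine iff_of_false (fun hw => ?_) fun hw => ?_
    · have := hv'.lt_of_prefix hw h.1 h.2; omega
    · have := hv.lt_of_prefix hw h.1 h.2; omega

open Classical in
/-- The average of `H v` over the visits to `v` with (zero-based) ranks in `[b, b')`, when the
`b'`-th visit happens during the phrase number `m`. -/
noncomputable def blockAverage (H : List A → T × A → ℝ) (b b' m : ℕ) (v : List A)
    (ω : List A → T × (ℕ → A)) : ℝ :=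
  (∑ i ∈ Finset.range (m + 1), if Visits (nodeSeq ω) v i ∧ b ≤ Nat.count (Visits (nodeSeq ω) v) i
    then H v ((ω v).1, (ω v).2 i) else 0) / ((b' : ℝ) - b)

/-- The visits to `v` do not see the data at `v`, so redrawing these data changes only the arguments
of `H v`, not the set of summands. -/
theorem blockAverage_update_self (H : List A → T × A → ℝ) (b b' m : ℕ) (v : List A)
    (ω : List A → T × (ℕ → A)) (d : T × (ℕ → A)) :
    open Classical in
    blockAverage H b b' m v (Function.update ω v d) =
      (∑ i ∈ Finset.range (m + 1), if Visits (nodeSeq ω) v i ∧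
        b ≤ Nat.count (Visits (nodeSeq ω) v) i then H v (d.1, d.2 i) else 0) / ((b' : ℝ) - b) := by
  have : Visits (nodeSeq (Function.update ω v d)) v = Visits (nodeSeq ω) v :=
    funext fun m => propext (visits_nodeSeq_update ω v d (fun _ => rfl) m)
  classical
  simp only [blockAverage, this, Function.update_self]

theorem blockAverage_update_of_ne (H : List A → T × A → ℝ) (b b' m : ℕ) {v w : List A}
    (ω : List A → T × (ℕ → A)) (d : T × (ℕ → A)) (hvw : v <+: w → v = w) (hne : w ≠ v) :
    blockAverage H b b' m w (Function.update ω v d) = blockAverage H b b' m w ω := by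
  have : Visits (nodeSeq (Function.update ω v d)) w = Visits (nodeSeq ω) w :=
    funext fun m => propext (visits_nodeSeq_update ω v d hvw m)
  classical
  simp only [blockAverage, this, Function.update_of_ne hne]

theorem sum_ite_count_eq (p : ℕ → Prop) [DecidablePred p] (f : ℕ → ℕ → ℝ) (m : ℕ) :
    (∑ i ∈ Finset.range m, if p i then f i (Nat.count p i) else 0) =
      ∑ r ∈ Finset.range (Nat.count p m), f (Nat.nth p r) r := by
  induction m with
  | zero => simp
  | succ m ih =>
    rw [Finset.sum_range_succ, ih, Nat.count_succ]
    split_ifs with h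
    · rw [Finset.sum_range_succ, Nat.nth_count h]
    · simp

open Classical in
theorem blockAverage_eq (H : List A → T × A → ℝ) {b b' m : ℕ} {v : List A}
    {ω : List A → T × (ℕ → A)} (h : Hits (nodeSeq ω) b' v m) :
    blockAverage H b b' m v ω = (∑ r ∈ Finset.Ico b b',
      H v ((ω v).1, (ω v).2 (Nat.nth (Visits (nodeSeq ω) v) r))) / ((b' : ℝ) - b) := by
  unfold blockAverage
  congr 1
  have h1 := sum_ite_count_eq (Visits (nodeSeq ω) v)
    (fun i r => if b ≤ r then H v ((ω v).1, (ω v).2 i) else 0) (m + 1)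
  rw [Nat.count_succ, if_pos h.1, h.2, ← Finset.sum_filter (s := Finset.range b')] at h1
  simp only [ite_and]
  rw [h1]
  refine Finset.sum_congr ?_ fun _ _ => rfl
  ext r; simp; omega

end Selection

/-! ### The selections are predictable and the block averages are centred. -/

section Predictable

variable {A : Type*} [DecidableEq A] [Fintype A] [MeasurableSpace A] [MeasurableSingletonClass A]

theorem measurable_nodeSeq {T : Type*} [MeasurableSpace T] :
    Measurable fun ω : List A → T × (ℕ → A) => nodeSeq ω :=
  measurable_addrSeq nodeAddr

open Classical in
theorem measurable_count_visits (v : List A) (m : ℕ) :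
    Measurable fun x : ℕ → A => Nat.count (Visits x v) m := by
  induction m with
  | zero => simp
  | succ m ih =>
    simp only [Nat.count_succ]
    exact ih.add (Measurable.ite (measurableSet_visits v m) measurable_const measurable_const)

theorem measurableSet_hits (b : ℕ) (v : List A) (m : ℕ) :
    MeasurableSet {x : ℕ → A | Hits x b v m} := by
  classical
  exact (measurableSet_visits v m).inter
    (((measurable_count_visits v m).add_const 1) (measurableSet_singleton b))

variable (prior : Measure (stdSimplex ℝ A)) [IsProbabilityMeasure prior]

/-- Both rules reuse a parameter exactly when the same node is current, and neither reuses an entry;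
hence the laws agree. -/
theorem source_eq_map_nodeSeq :
    source prior = (Measure.infinitePi fun _ : List A => nodeLaw prior).map nodeSeq := by
  have h : (fun ω : ℕ → stdSimplex ℝ A × (ℕ → A) => sequence fun j => (ω j).2) =
      addrSeq fun (s : ParseState A) t => (s.index, t) := funext fun ω => sequence_eq_addrSeq ω
  rw [source, h]
  exact map_addrSeq_eq freshAddr_index freshAddr_nodeAddr fun x s t => index_eq_iff x s t

theorem integrable_of_bounded {Ω : Type*} [MeasurableSpace Ω] {μ : Measure Ω} [IsFiniteMeasure μ]
    {f : Ω → ℝ} (hf : Measurable f) {C : ℝ} (hb : ∀ ω, |f ω| ≤ C) : Integrable f μ :=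
  Integrable.of_bound hf.aestronglyMeasurable C (ae_of_all _ hb)

/-- The core of the law of large numbers. At the `b'`-th visit to `v` the whole block of visits is
known from the data at proper prefixes, while the data at `v` themselves have left no trace in
earlier selections or increments. -/
theorem predictableSelection_hitNode {H : List A → stdSimplex ℝ A × A → ℝ}
    (hm : ∀ v, Measurable (H v)) (hb : ∀ v p, |H v p| ≤ 1)
    (h0 : ∀ v, ∫ p, H v p ∂(prior ⊗ₘ symbolKernel) = 0) {b b' : ℕ} (hbb : b < b') :
    PredictableSelection (nodeLaw prior)
      (fun m (ω : List A → stdSimplex ℝ A × (ℕ → A)) => hitNode (nodeSeq ω) b' m)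
      (blockAverage H b b') := by
  classical
  have hbb' : (0 : ℝ) < (b' : ℝ) - b := by
    have : (b : ℝ) < b' := by exact_mod_cast hbb
    linarith
  constructor
  · intro m v
    simp only [hitNode_eq_some_iff]
    exact measurable_nodeSeq (measurableSet_hits b' v m)
  · intro m v
    refine Measurable.div_const (Finset.measurable_fun_sum _ fun i _ => ?_) _
    refine Measurable.ite ?_ ?_ measurable_const
    · exact measurable_nodeSeq ((measurableSet_visits v i).inter
        (measurable_count_visits v i measurableSet_Ici))
    · exact (hm v).comp (by fun_prop)
  · intro m v ω d h
    rw [hitNode_eq_some_iff] at h ⊢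
    exact (hits_nodeSeq_update ω v d (fun _ => rfl) b' m).2 h
  · intro m v ω d h i hi
    rw [hitNode_eq_some_iff] at h
    refine Option.ext fun w => ?_
    simp only [hitNode_eq_some_iff]
    exact hits_nodeSeq_update_of_lt d h hi w
  · intro m v ω d h i hi
    rw [hitNode_eq_some_iff] at h
    have hJ : hitNode (nodeSeq (Function.update ω v d)) b' i = hitNode (nodeSeq ω) b' i := by
      refine Option.ext fun w => ?_
      simp only [hitNode_eq_some_iff]
      exact hits_nodeSeq_update_of_lt d h hi w
    simp only [increment, hJ]
    rcases hw : hitNode (nodeSeq ω) b' i with _ | w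
    · rfl
    · rw [hitNode_eq_some_iff] at hw
      refine blockAverage_update_of_ne H b b' i ω d (fun hp => ?_) ?_
      · by_contra hne
        have := h.lt_of_prefix hw hp hne
        omega
      · rintro rfl
        have := h.phrase_unique hw
        omega
  · intro m v ω h
    rw [hitNode_eq_some_iff] at h
    rw [blockAverage_eq H h, abs_div, abs_of_pos hbb', div_le_one hbb']
    refine (Finset.abs_sum_le_sum_abs _ _).trans ((Finset.sum_le_card_nsmul _ _ 1 fun r _ => hb _ _).trans ?_)
    rw [Nat.card_Ico, nsmul_eq_mul, mul_one, Nat.cast_sub hbb.le]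
  · intro m v ω h
    simp only [blockAverage_update_self]
    rw [integral_div, integral_finsetSum]
    · rw [Finset.sum_eq_zero, zero_div]
      intro i _
      split_ifs
      -- The summands share the parameter and are dependent, but linearity uses only the law of each
      -- pair of parameter and symbol.
      · have hp := measurePreserving_nodeLaw prior i
        rw [← h0 v, ← hp.map_eq, integral_map hp.measurable.aemeasurable
          (hm v).aestronglyMeasurable]
      · simp
    · intro i _
      split_ifs
      · exact integrable_of_bounded ((hm v).comp (by fun_prop)) fun d => hb v _
      · exact integrable_zero _ _ _

end Predictable

/-! ### Geometric blocks of visit ranks. -/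

section Grid

/-- A grid of visit counts whose relative spacing is about `1 / q`. -/
def grid (q : ℕ) : ℕ → ℕ
  | 0 => 0
  | l + 1 => grid q l + (grid q l / q + 1)

theorem grid_strictMono (q : ℕ) : StrictMono (grid q) :=
  strictMono_nat_of_lt_succ fun _ => Nat.lt_add_of_pos_right (Nat.succ_pos _)

theorem exists_grid (q n : ℕ) : ∃ l, grid q l ≤ n ∧ n < grid q (l + 1) := by
  induction n with
  | zero => exact ⟨0, by simp [grid], by simp [grid]⟩
  | succ n ih =>
    obtain ⟨l, h1, h2⟩ := ih
    rcases (Nat.succ_le_of_lt h2).lt_or_eq with h | h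
    · exact ⟨l, by omega, h⟩
    · exact ⟨l + 1, by omega, h.le.trans_lt (grid_strictMono q (Nat.lt_succ_self (l + 1)))⟩

/-- Each step multiplies the grid point by at least 1 + 1/q, so only logarithmically many blocks lie
below a given number of visits. -/
theorem pow_le_grid {q : ℕ} (hq : 0 < q) (l : ℕ) :
    (1 + 1 / (q : ℝ)) ^ l ≤ grid q (l + 1) := by
  induction l with
  | zero => simp [grid]
  | succ l ih =>
    have hq' : (0 : ℝ) < q := by exact_mod_cast hq
    have h1 : (grid q (l + 1) : ℝ) / q ≤ (grid q (l + 1) / q + 1 : ℕ) := by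
      rw [div_le_iff₀ hq']
      have := Nat.lt_div_mul_add hq (a := grid q (l + 1))
      have h2 : grid q (l + 1) ≤ (grid q (l + 1) / q + 1) * q := by rw [add_mul, one_mul]; omega
      exact_mod_cast h2
    rw [pow_succ, grid, Nat.cast_add]
    calc (1 + 1 / (q : ℝ)) ^ l * (1 + 1 / q) ≤ grid q (l + 1) * (1 + 1 / q) := by gcongr
      _ = grid q (l + 1) + (grid q (l + 1) : ℝ) / q := by ring
      _ ≤ _ := by gcongr

theorem le_log_of_grid_le {q : ℕ} (hq : 0 < q) {l m : ℕ} (h : grid q (l + 1) ≤ m) :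
    (l : ℝ) ≤ Real.log m / Real.log (1 + 1 / (q : ℝ)) := by
  have hq' : (0 : ℝ) < 1 / q := by positivity
  have hlog : 0 < Real.log (1 + 1 / (q : ℝ)) := Real.log_pos (by linarith)
  rw [le_div_iff₀ hlog, ← Real.log_pow]
  exact Real.log_le_log (by positivity) ((pow_le_grid hq l).trans (by exact_mod_cast h))

theorem sum_grid_blocks (q : ℕ) (a : ℕ → ℝ) (L : ℕ) :
    ∑ l ∈ Finset.range L, ∑ r ∈ Finset.Ico (grid q l) (grid q (l + 1)), a r =
      ∑ r ∈ Finset.range (grid q L), a r := by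
  induction L with
  | zero => simp [grid]
  | succ L ih =>
    rw [Finset.sum_range_succ, ih, Finset.sum_range_add_sum_Ico]
    exact (grid_strictMono q (Nat.lt_succ_self L)).le

theorem sum_ite_grid (q : ℕ) {n M : ℕ} (hn : n ≤ M) (f : ℕ → ℝ) {l₀ : ℕ} (h1 : grid q l₀ ≤ n)
    (h2 : n < grid q (l₀ + 1)) :
    (∑ l ∈ Finset.range M, if grid q (l + 1) ≤ n then f l else 0) =
      ∑ l ∈ Finset.range l₀, f l := by
  have hl : l₀ ≤ M := ((grid_strictMono q).le_apply.trans h1).trans hn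
  rw [← Finset.sum_filter]
  refine Finset.sum_congr ?_ fun _ _ => rfl
  ext l
  simp only [Finset.mem_filter, Finset.mem_range]
  constructor
  · rintro ⟨-, h⟩
    have := (grid_strictMono q).lt_iff_lt.1 (h.trans_lt h2)
    omega
  · intro h
    exact ⟨by omega, ((grid_strictMono q).monotone h).trans h1⟩

theorem sum_len_le (q : ℕ) {n M : ℕ} (hn : n ≤ M) :
    (∑ l ∈ Finset.range M, if grid q (l + 1) ≤ n then ((grid q (l + 1) : ℝ) - grid q l) else 0)
      ≤ n := by
  obtain ⟨l₀, h1, h2⟩ := exists_grid q n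
  rw [sum_ite_grid q hn _ h1 h2, Finset.sum_range_sub (fun l => (grid q l : ℝ))]
  simp only [grid, CharP.cast_eq_zero, sub_zero]
  exact_mod_cast h1

/-- The complete blocks of the grid account for most of a bounded sum. -/
theorem abs_sum_sub_blocks_le {q : ℕ} {a : ℕ → ℝ} (ha : ∀ r, |a r| ≤ 1) {n M : ℕ}
    (hn : n ≤ M) :
    |∑ r ∈ Finset.range n, a r - ∑ l ∈ Finset.range M, if grid q (l + 1) ≤ n then
      ∑ r ∈ Finset.Ico (grid q l) (grid q (l + 1)), a r else 0| ≤ n / q := by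
  obtain ⟨l₀, h1, h2⟩ := exists_grid q n
  rw [sum_ite_grid q hn _ h1 h2, sum_grid_blocks, ← Finset.sum_range_add_sum_Ico a h1,
    add_sub_cancel_left]
  refine (Finset.abs_sum_le_sum_abs _ _).trans
    ((Finset.sum_le_card_nsmul _ _ 1 fun r _ => ha r).trans ?_)
  rw [Nat.card_Ico, nsmul_eq_mul, mul_one]
  -- The unfinished block has length `grid q l₀ / q + 1` and is not complete, whence at most `grid q
  -- l₀ / q` of its terms are present.
  have h3 : n - grid q l₀ ≤ n / q := by
    rw [grid] at h2
    have := Nat.div_le_div_right (c := q) h1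
    omega
  exact (Nat.cast_le.2 h3).trans Nat.cast_div_le

end Grid

/-! ### From sums over time to sums over nodes and blocks of ranks. -/

section Accounting

variable {A : Type*} [DecidableEq A]

open Classical in
theorem sum_hits (x : ℕ → A) {b : ℕ} (hb : 0 < b) (v : List A) (m : ℕ) :
    (∑ i ∈ Finset.range m, if Hits x b v i then (1 : ℝ) else 0) =
      if b ≤ Nat.count (Visits x v) m then 1 else 0 := by
  have h := sum_ite_count_eq (Visits x v) (fun _ r => if r + 1 = b then 1 else 0) m
  have h1 : (∑ i ∈ Finset.range m, if Hits x b v i then (1 : ℝ) else 0) =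
      ∑ i ∈ Finset.range m, if Visits x v i then
        if Nat.count (Visits x v) i + 1 = b then (1 : ℝ) else 0 else 0 := by
    refine Finset.sum_congr rfl fun i _ => ?_
    by_cases h1 : Visits x v i <;> by_cases h2 : Nat.count (Visits x v) i + 1 = b <;>
      simp [Hits, h1, h2]
  rw [h1, h]
  rw [← Finset.sum_filter]
  split_ifs with hm
  · have : (Finset.range (Nat.count (Visits x v) m)).filter (fun r => r + 1 = b) = {b - 1} := by
      ext r; simp; omega
    rw [this]; simp
  · refine Finset.sum_eq_zero fun r hr => ?_
    simp only [Finset.mem_filter, Finset.mem_range] at hr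
    omega

/-- The nodes that are visited during one of the first `m` phrases all lie in `F`. -/
theorem sum_hitNode (x : ℕ → A) {b : ℕ} (hb : 0 < b) (m : ℕ) {F : Finset (List A)}
    (hF : ∀ v, ∀ i < m, Visits x v i → v ∈ F) (f : List A → ℝ) :
    open Classical in
    ∑ i ∈ Finset.range m, (hitNode x b i).elim 0 f =
      ∑ v ∈ F, if b ≤ Nat.count (Visits x v) m then f v else 0 := by
  classical
  have h1 : ∀ i ∈ Finset.range m, (hitNode x b i).elim 0 f =
      ∑ v ∈ F, if Hits x b v i then f v else 0 := by
    intro i hi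
    rcases hw : hitNode x b i with _ | w
    · refine (Finset.sum_eq_zero fun v _ => if_neg fun hv => ?_).symm
      rw [hitNode_eq_some_iff.2 hv] at hw
      simp at hw
    · rw [hitNode_eq_some_iff] at hw
      rw [Finset.sum_eq_single_of_mem w (hF w i (Finset.mem_range.1 hi) hw.1)
        fun v _ hv => if_neg fun h => hv (h.node_unique hw), if_pos hw]
      rfl
  rw [Finset.sum_congr rfl h1, Finset.sum_comm]
  refine Finset.sum_congr rfl fun v _ => ?_
  have h2 := congrArg (fun s => s * f v) (sum_hits x hb v m)
  simpa only [Finset.sum_mul, ite_mul, one_mul, zero_mul] using h2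

/-- Times correspond bijectively to pairs of a node and a phrase that visits it; at each node the
phrases are then listed by visit rank. -/
theorem sum_time_eq (x : ℕ → A) {m t : ℕ} (ht : ∀ s, s < t ↔ phrase x s < m)
    {F : Finset (List A)} (hF : ∀ v, ∀ i < m, Visits x v i → v ∈ F) (h : List A → ℕ → ℝ) :
    open Classical in
    ∑ s ∈ Finset.range t, h (node x s) (phrase x s) =
      ∑ v ∈ F, ∑ r ∈ Finset.range (Nat.count (Visits x v) m), h v (Nat.nth (Visits x v) r) := by
  classical
  have h1 : ∀ v, ∑ r ∈ Finset.range (Nat.count (Visits x v) m), h v (Nat.nth (Visits x v) r) =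
      ∑ i ∈ Finset.range m, if Visits x v i then h v i else 0 := fun v =>
    (sum_ite_count_eq (Visits x v) (fun i _ => h v i) m).symm
  simp only [h1]
  rw [← Finset.sum_product' F (Finset.range m) fun v i => if Visits x v i then h v i else 0,
    ← Finset.sum_filter]
  refine Finset.sum_nbij (fun s => (node x s, phrase x s)) ?_ ?_ ?_ fun _ _ => rfl
  · intro s hs
    have hs' := (ht s).1 (Finset.mem_range.1 hs)
    have hv : Visits x (node x s) (phrase x s) := ⟨s, rfl, rfl⟩
    simp [hv, hs', hF _ _ hs' hv]
  · intro s _ s' _ hss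
    simp only [Prod.mk.injEq] at hss
    exact eq_of_node_phrase_eq x (congrArg List.length hss.1) hss.2
  · rintro ⟨v, i⟩ hvi
    simp only [Finset.coe_filter, Finset.mem_product, Finset.mem_range, Set.mem_ofPred_eq] at hvi
    obtain ⟨⟨-, hi⟩, s, rfl, rfl⟩ := hvi
    exact ⟨s, by simpa using (ht s).2 hi, rfl⟩

variable {T : Type*}

/-- The sum over the first `m` phrases, in terms of the block averages. -/
theorem abs_sum_phrases_le (ω : List A → T × (ℕ → A)) {H : List A → T × A → ℝ}
    (hb : ∀ v p, |H v p| ≤ 1) {q : ℕ} (hq : 0 < q) {ε : ℝ} (hε : 0 ≤ ε) {L m t : ℕ}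
    (htm : phrase (nodeSeq ω) t = m) (ht : ∀ s, s < t ↔ phrase (nodeSeq ω) s < m)
    (hL : ∀ l ≥ L, |∑ i ∈ Finset.range m, increment
        (fun m (ω : List A → T × (ℕ → A)) => hitNode (nodeSeq ω) (grid q (l + 1)) m)
        (blockAverage H (grid q l) (grid q (l + 1))) i ω| ≤
      ε * (∑ i ∈ Finset.range m, (if (hitNode (nodeSeq ω) (grid q (l + 1)) i).isSome then (1 : ℝ)
        else 0) + l)) :
    |∑ s ∈ Finset.range t, H (node (nodeSeq ω) s) ((ω (node (nodeSeq ω) s)).1, nodeSeq ω s)| ≤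
      t / q + (m + 1) * grid q L + ε * t +
        ε * (m * (Real.log m / Real.log (1 + 1 / (q : ℝ)))) := by
  classical
  set x := nodeSeq ω with hx
  set F := (parse x t).tree.toFinset with hFdef
  have hF : ∀ v, ∀ i < m, Visits x v i → v ∈ F := by
    rintro v i hi ⟨s, rfl, rfl⟩
    exact List.mem_toFinset.2 (tree_subset x ((ht s).2 hi).le (node_mem_tree x s))
  have hFc : F.card = m + 1 := by
    rw [hFdef, List.toFinset_card_of_nodup (tree_nodup x t), tree_length_eq, htm]
  set n : List A → ℕ := fun v => Nat.count (Visits x v) m with hn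
  have hnm : ∀ v, n v ≤ m := fun v => Nat.count_le _
  have hsumn : ∑ v ∈ F, (n v : ℝ) = t := by
    have := sum_time_eq x ht hF fun _ _ => 1
    simpa using this.symm
  set a : List A → ℕ → ℝ := fun v r => H v ((ω v).1, (ω v).2 (Nat.nth (Visits x v) r)) with ha
  have hab : ∀ v r, |a v r| ≤ 1 := fun v r => hb _ _
  have htot : ∑ s ∈ Finset.range t, H (node x s) ((ω (node x s)).1, x s) =
      ∑ v ∈ F, ∑ r ∈ Finset.range (n v), a v r := by
    rw [← sum_time_eq x ht hF fun v i => H v ((ω v).1, (ω v).2 i)]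
    refine Finset.sum_congr rfl fun s _ => ?_
    rw [hx, ← nodeSeq_eq]
  set len : ℕ → ℝ := fun l => (grid q (l + 1) : ℝ) - grid q l with hlen
  have hlenpos : ∀ l, 0 < len l := fun l => by
    have : (grid q l : ℝ) < grid q (l + 1) := by
      exact_mod_cast grid_strictMono q (Nat.lt_succ_self l)
    simp only [hlen]; linarith
  have hgpos : ∀ l, 0 < grid q (l + 1) := fun l => Nat.succ_pos _
  set B : ℕ → List A → ℝ := fun l v => ∑ r ∈ Finset.Ico (grid q l) (grid q (l + 1)), a v r with hB
  have hBle : ∀ l v, |B l v| ≤ len l := by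
    intro l v
    refine (Finset.abs_sum_le_sum_abs _ _).trans
      ((Finset.sum_le_card_nsmul _ _ 1 fun r _ => hab v r).trans ?_)
    rw [Nat.card_Ico, nsmul_eq_mul, mul_one,
      Nat.cast_sub (grid_strictMono q (Nat.lt_succ_self l)).le]
  -- `S l` is the controlled sum of block averages over the nodes that have completed block `l`, and
  -- `N l` counts these nodes.
  set S : ℕ → ℝ := fun l => ∑ v ∈ F, if grid q (l + 1) ≤ n v then B l v / len l else 0 with hS
  set N : ℕ → ℝ := fun l => ∑ v ∈ F, if grid q (l + 1) ≤ n v then (1 : ℝ) else 0 with hN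
  have hNnn : ∀ l, 0 ≤ N l := fun l => Finset.sum_nonneg fun v _ => by split_ifs <;> norm_num
  have hS' : ∀ l, ∑ i ∈ Finset.range m, increment
        (fun m (ω : List A → T × (ℕ → A)) => hitNode (nodeSeq ω) (grid q (l + 1)) m)
        (blockAverage H (grid q l) (grid q (l + 1))) i ω = S l := by
    intro l
    refine Eq.trans ?_ (sum_hitNode x (hgpos l) m hF fun v => B l v / len l)
    refine Finset.sum_congr rfl fun i _ => ?_
    simp only [increment, ← hx]
    rcases hw : hitNode x (grid q (l + 1)) i with _ | w
    · rfl
    · rw [hitNode_eq_some_iff] at hw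
      simp only [Option.elim_some]
      rw [blockAverage_eq H hw]
  have hN' : ∀ l, ∑ i ∈ Finset.range m, (if (hitNode x (grid q (l + 1)) i).isSome then (1 : ℝ)
      else 0) = N l := by
    intro l
    refine Eq.trans ?_ (sum_hitNode x (hgpos l) m hF fun _ => 1)
    refine Finset.sum_congr rfl fun i _ => ?_
    rcases hitNode x (grid q (l + 1)) i with _ | w <;> simp
  simp only [hS', hN'] at hL
  have hSN : ∀ l, |S l| ≤ N l := by
    intro l
    refine (Finset.abs_sum_le_sum_abs _ _).trans (Finset.sum_le_sum fun v _ => ?_)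
    split_ifs
    · rw [abs_div, abs_of_pos (hlenpos l), div_le_one (hlenpos l)]; exact hBle l v
    · simp
  have hzero : ∀ l, ¬ grid q (l + 1) ≤ m → N l = 0 := by
    intro l hl
    refine Finset.sum_eq_zero fun v _ => if_neg fun h => hl (h.trans (hnm v))
  have hNF : ∀ l, N l ≤ m + 1 := by
    intro l
    refine (Finset.sum_le_card_nsmul F _ 1 fun v _ => by split_ifs <;> norm_num).trans ?_
    rw [hFc]; simp
  -- Dropping the unfinished block of each node costs at most a fraction 1/q of its visits.
  have h1 : |∑ v ∈ F, ∑ r ∈ Finset.range (n v), a v r - ∑ l ∈ Finset.range m, len l * S l| ≤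
      t / q := by
    have : ∑ l ∈ Finset.range m, len l * S l =
        ∑ v ∈ F, ∑ l ∈ Finset.range m, if grid q (l + 1) ≤ n v then B l v else 0 := by
      rw [Finset.sum_comm]
      refine Finset.sum_congr rfl fun l _ => ?_
      rw [hS, Finset.mul_sum]
      refine Finset.sum_congr rfl fun v _ => ?_
      split_ifs
      · rw [mul_div_cancel₀ _ (hlenpos l).ne']
      · simp
    rw [this, ← Finset.sum_sub_distrib, ← hsumn, Finset.sum_div]
    exact (Finset.abs_sum_le_sum_abs _ _).trans
      (Finset.sum_le_sum fun v _ => abs_sum_sub_blocks_le (hab v) (hnm v))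
  -- The complete blocks of a node are disjoint sets of its visits, and there are `t` visits in all.
  have h2 : ∑ l ∈ Finset.range m, len l * N l ≤ t := by
    have : ∑ l ∈ Finset.range m, len l * N l =
        ∑ v ∈ F, ∑ l ∈ Finset.range m, if grid q (l + 1) ≤ n v then len l else 0 := by
      rw [Finset.sum_comm]
      refine Finset.sum_congr rfl fun l _ => ?_
      rw [hN, Finset.mul_sum]
      refine Finset.sum_congr rfl fun v _ => ?_
      split_ifs <;> simp
    rw [this, ← hsumn]
    exact Finset.sum_le_sum fun v _ => sum_len_le q (hnm v)
  set κ := Real.log m / Real.log (1 + 1 / (q : ℝ)) with hκ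
  have hκ0 : 0 ≤ κ := div_nonneg (Real.log_natCast_nonneg m) (Real.log_nonneg (by
    have : (0 : ℝ) ≤ 1 / q := by positivity
    linarith))
  -- Three cases: the first `L` blocks are bounded trivially; later blocks that fit below `m` obey
  -- `hL`, with `l` at most κ; longer blocks are completed by no node.
  have h3 : ∀ l ∈ Finset.range m, len l * |S l| ≤
      (if l < L then len l * (m + 1) else 0) + ε * (len l * N l) +
        ε * (κ * if grid q (l + 1) ≤ m then len l else 0) := by
    intro l _
    have hl := (hlenpos l).le
    have e2 : 0 ≤ ε * (len l * N l) := mul_nonneg hε (mul_nonneg hl (hNnn l))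
    have e3 : 0 ≤ ε * (κ * if grid q (l + 1) ≤ m then len l else 0) := by
      refine mul_nonneg hε (mul_nonneg hκ0 ?_); split_ifs <;> simp [hl]
    by_cases hlL : l < L
    · rw [if_pos hlL]
      have := mul_le_mul_of_nonneg_left ((hSN l).trans (hNF l)) hl
      linarith
    · rw [if_neg hlL]
      by_cases hg : grid q (l + 1) ≤ m
      · rw [if_pos hg]
        have h4 := mul_le_mul_of_nonneg_left (hL l (not_lt.1 hlL)) hl
        have h5 := mul_le_mul_of_nonneg_left (mul_le_mul_of_nonneg_left
          (le_log_of_grid_le hq hg) hε) hl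
        rw [← hκ] at h5
        linarith
      · have h0 : |S l| = 0 := le_antisymm ((hSN l).trans (hzero l hg).le) (abs_nonneg _)
        rw [h0]; linarith
  have h4 : ∑ l ∈ Finset.range m, (if l < L then len l * ((m : ℝ) + 1) else 0) ≤
      (m + 1) * grid q L := by
    have : ∑ l ∈ Finset.range L, len l = grid q L := by
      rw [hlen, Finset.sum_range_sub (fun l => (grid q l : ℝ))]; simp [grid]
    rw [← this, mul_comm, Finset.sum_mul, ← Finset.sum_filter]
    refine Finset.sum_le_sum_of_subset_of_nonneg (fun l hl => ?_) fun l _ _ => ?_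
    · simp at hl ⊢; exact hl.2
    · have := (hlenpos l).le
      positivity
  have h5 := sum_len_le q (le_refl m)
  have h6 : |∑ l ∈ Finset.range m, len l * S l| ≤
      (m + 1) * grid q L + ε * t + ε * (m * κ) := by
    refine (Finset.abs_sum_le_sum_abs _ _).trans ?_
    have : ∀ l ∈ Finset.range m, |len l * S l| = len l * |S l| := fun l _ => by
      rw [abs_mul, abs_of_pos (hlenpos l)]
    rw [Finset.sum_congr rfl this]
    refine (Finset.sum_le_sum h3).trans ?_
    rw [Finset.sum_add_distrib, Finset.sum_add_distrib, ← Finset.mul_sum, ← Finset.mul_sum,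
      ← Finset.mul_sum]
    have e1 := mul_le_mul_of_nonneg_left h2 hε
    have e2 := mul_le_mul_of_nonneg_left (mul_le_mul_of_nonneg_left h5 hκ0) hε
    linarith [mul_comm κ (m : ℝ)]
  rw [htot]
  have h7 := abs_sub_abs_le_abs_sub (∑ v ∈ F, ∑ r ∈ Finset.range (n v), a v r)
    (∑ l ∈ Finset.range m, len l * S l)
  linarith

end Accounting

/-! ### Growth of the number of phrases. -/

section Growth

variable {A : Type*} [DecidableEq A] [Fintype A]

/-- Uniform in the sequence, since the only input is that distinct phrases are long on average; this
uniformity is needed again for the block entropy. -/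
theorem eventually_phrase_le (δ : ℝ) (hδ : 0 < δ) :
    ∀ᶠ n : ℕ in atTop, ∀ x : ℕ → A, (phrase x n : ℝ) ≤ δ * n := by
  obtain ⟨d, hd⟩ := exists_nat_gt (2 / δ)
  have hd0 : (0 : ℝ) < d := lt_trans (by positivity) hd
  filter_upwards [tendsto_natCast_atTop_atTop.eventually_ge_atTop
    (2 / δ * ((Fintype.card A : ℝ) + 1) ^ d)] with n hn x
  have h1 : (d : ℝ) * phrase x n ≤ n + d * ((Fintype.card A : ℝ) + 1) ^ d := by
    exact_mod_cast mul_phrase_le x n d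
  have h2 : ((Fintype.card A : ℝ) + 1) ^ d ≤ δ / 2 * n := by
    have := mul_le_mul_of_nonneg_left hn (by positivity : 0 ≤ δ / 2)
    have h3 : δ / 2 * (2 / δ * ((Fintype.card A : ℝ) + 1) ^ d) =
      ((Fintype.card A : ℝ) + 1) ^ d := by field_simp
    linarith
  have h4 : (n : ℝ) ≤ d * (δ / 2 * n) := by
    have : 1 ≤ d * (δ / 2) := by
      rw [div_lt_iff₀ hδ] at hd; linarith
    calc (n : ℝ) = 1 * n := (one_mul _).symm
      _ ≤ d * (δ / 2) * n := by gcongr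
      _ = _ := by ring
  have h5 : (d : ℝ) * phrase x n ≤ d * (δ * n) := by
    have := mul_le_mul_of_nonneg_left h2 hd0.le
    linarith
  exact le_of_mul_le_mul_left h5 hd0

theorem phrase_mul_log_le [Nonempty A] : ∃ C : ℝ, 0 < C ∧ ∃ m₀ : ℕ, ∀ (x : ℕ → A) (t : ℕ),
    m₀ ≤ phrase x t → phrase x t * Real.log (phrase x t) ≤ C * t := by
  set a := Fintype.card A + 1 with ha
  have ha2 : 2 ≤ a := by have := Fintype.card_pos (α := A); omega
  have hla : 0 < Real.log a := Real.log_pos (by exact_mod_cast ha2)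
  refine ⟨6 * Real.log a, by positivity, 2 * a, fun x t hm => ?_⟩
  set m := phrase x t
  -- This depth is so small that at most half of the phrases can be of length at most `d`, and it is
  -- still comparable to log m.
  set d := Nat.log a (m / 2)
  have hm2 : a ≤ m / 2 := by omega
  have hd1 : 1 ≤ d := Nat.log_pos (by omega) hm2
  have h1 : a ^ d ≤ m / 2 := Nat.pow_log_le_self a (by omega)
  have h2 : m / 2 < a ^ (d + 1) := Nat.lt_pow_succ_log_self (by omega) _
  have h3 := mul_phrase_le x t d
  have h4 : d * m ≤ 2 * t := by
    have := Nat.mul_le_mul_left d h1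
    have h5 : d * (m / 2) * 2 ≤ d * m := by
      rw [mul_assoc]; exact Nat.mul_le_mul_left d (Nat.div_mul_le_self m 2)
    change d * m ≤ t + d * a ^ d at h3
    omega
  have hm0 : (0 : ℝ) < m := by
    have : 0 < m := by omega
    exact_mod_cast this
  have h5 : (m : ℝ) ≤ a * (a : ℝ) ^ (d + 1) := by
    have : m ≤ a * a ^ (d + 1) := by
      have := Nat.mul_le_mul_right (a ^ (d + 1)) ha2
      omega
    exact_mod_cast this
  have h6 : Real.log m ≤ 3 * (d * Real.log a) := by
    have ha0 : (0 : ℝ) < a := by exact_mod_cast (by omega : 0 < a)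
    have := Real.log_le_log hm0 h5
    rw [Real.log_mul ha0.ne' (by positivity), Real.log_pow] at this
    have hd1' : (1 : ℝ) ≤ d := by exact_mod_cast hd1
    push_cast at this
    nlinarith
  have h4' : (d : ℝ) * m ≤ 2 * t := by exact_mod_cast h4
  calc m * Real.log m ≤ m * (3 * (d * Real.log a)) := by gcongr
    _ = 3 * Real.log a * (d * m) := by ring
    _ ≤ 3 * Real.log a * (2 * t) := by gcongr
    _ = _ := by ring

theorem tendsto_phrase_atTop (x : ℕ → A) : Tendsto (phrase x) atTop atTop :=
  tendsto_atTop_atTop.2 fun m => by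
    obtain ⟨t, ht⟩ := phrase_unbounded x m
    exact ⟨t, fun n hn => ht.trans (phrase_mono x hn)⟩

end Growth

theorem nonempty_of_isProbabilityMeasure {A : Type*} [Fintype A]
    (prior : Measure (stdSimplex ℝ A)) [IsProbabilityMeasure prior] : Nonempty A := by
  by_contra h
  rw [not_nonempty_iff] at h
  have : IsEmpty (stdSimplex ℝ A) := ⟨fun θ => by simpa using θ.2.2⟩
  have h1 := measure_univ (μ := prior)
  rw [Set.univ_eq_empty_iff.2 this, measure_empty] at h1
  exact zero_ne_one h1

/-! ### The law of large numbers along the tree. -/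

section LLN

variable {A : Type*} [DecidableEq A] [Fintype A] [MeasurableSpace A] [MeasurableSingletonClass A]
variable (prior : Measure (stdSimplex ℝ A)) [IsProbabilityMeasure prior]

/-- The law of large numbers along the tree, for centred functions of a parameter and a symbol that
may depend on the node. -/
theorem ae_tendsto_average_of_bounded_one {H : List A → stdSimplex ℝ A × A → ℝ}
    (hm : ∀ v, Measurable (H v)) (hb : ∀ v p, |H v p| ≤ 1)
    (h0 : ∀ v, ∫ p, H v p ∂(prior ⊗ₘ symbolKernel) = 0) :
    ∀ᵐ ω ∂(Measure.infinitePi fun _ : List A => nodeLaw prior),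
      Tendsto (fun n : ℕ => (∑ s ∈ Finset.range n,
        H (node (nodeSeq ω) s) ((ω (node (nodeSeq ω) s)).1, nodeSeq ω s)) / n) atTop (𝓝 0) := by
  -- Countably many grids and precisions 1/(k+1), so one null set serves them all. The constants
  -- below can then be chosen for each outcome.
  have hall : ∀ᵐ ω ∂(Measure.infinitePi fun _ : List A => nodeLaw prior), ∀ q k : ℕ,
      ∀ᶠ l : ℕ in atTop, ∀ m, |∑ i ∈ Finset.range m, increment
        (fun m (ω : List A → stdSimplex ℝ A × (ℕ → A)) => hitNode (nodeSeq ω) (grid q (l + 1)) m)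
        (blockAverage H (grid q l) (grid q (l + 1))) i ω| <
      (1 / ((k : ℝ) + 1)) * (∑ i ∈ Finset.range m,
        (if (hitNode (nodeSeq ω) (grid q (l + 1)) i).isSome then (1 : ℝ) else 0) + l) := by
    rw [ae_all_iff]; intro q
    rw [ae_all_iff]; intro k
    exact ae_eventually_abs_sum_increment_lt (fun l => predictableSelection_hitNode prior hm hb h0
      (grid_strictMono q (Nat.lt_succ_self l))) (by positivity)
  have : Nonempty A := nonempty_of_isProbabilityMeasure prior
  obtain ⟨C, hC, m₀, hgrow⟩ := phrase_mul_log_le (A := A)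
  filter_upwards [hall] with ω hω
  rw [Metric.tendsto_atTop']
  intro η hη
  -- The order of choice matters: `q` for the unfinished blocks; then ε, which depends on κ and thus
  -- on `q`, for the boundary terms; then `L`, which depends on both; finally `n₀`, to absorb the
  -- first `L` blocks. Each of the three errors is at most η/5 per symbol.
  obtain ⟨q, hq⟩ := exists_nat_gt (5 / η)
  have hq0 : (0 : ℝ) < q := lt_trans (by positivity) hq
  have hq1 : 0 < q := by exact_mod_cast hq0
  set κ := Real.log (1 + 1 / (q : ℝ)) with hκ
  have hκ0 : 0 < κ := Real.log_pos (by have : (0 : ℝ) < 1 / q := by positivity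
                                       linarith)
  obtain ⟨k, hk⟩ := exists_nat_gt (5 / η + 5 / η * (C / κ))
  set ε : ℝ := 1 / ((k : ℝ) + 1) with hε
  have hε0 : 0 < ε := by positivity
  have hqe : 1 / (q : ℝ) ≤ η / 5 := by
    rw [div_le_div_iff₀ hq0 (by norm_num)]
    rw [div_lt_iff₀ hη] at hq; linarith
  have hCκ : 0 < C / κ := by positivity
  have h5η : 0 < 5 / η := by positivity
  have hεe : ε * (1 + C / κ) ≤ η / 5 := by
    rw [hε, one_div_mul_eq_div, div_le_iff₀ (by positivity)]
    have e1 : 5 / η * (1 + C / κ) ≤ k + 1 := by linarith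
    have e2 := mul_le_mul_of_nonneg_left e1 (by positivity : 0 ≤ η / 5)
    have e3 : η / 5 * (5 / η * (1 + C / κ)) = 1 + C / κ := by field_simp
    linarith
  obtain ⟨L, hL⟩ := eventually_atTop.1 (hω q k)
  set x := nodeSeq ω with hx
  have hδ : (0 : ℝ) < η / 5 / (2 * (grid q L + 1)) := by positivity
  have hev := ((eventually_phrase_le (A := A) _ hδ).and
    ((tendsto_phrase_atTop x).eventually_ge_atTop (max m₀ 1))).and (eventually_gt_atTop 0)
  obtain ⟨n₀, hn₀⟩ := eventually_atTop.1 hev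
  refine ⟨n₀, fun n hn => ?_⟩
  obtain ⟨⟨hn1, hn2⟩, hn3⟩ := hn₀ n hn.le
  have hn' : (0 : ℝ) < n := by exact_mod_cast hn3
  set m := phrase x n with hmdef
  -- The block estimate holds at starts of phrases. Going back to the start of the current phrase
  -- loses at most `m` times.
  obtain ⟨t, ht1, ht2, ht3⟩ := exists_phrase_start x m
  have htn : t ≤ n := by
    by_contra! h
    exact lt_irrefl _ ((ht3 n).1 h)
  have hnt : n - t ≤ m := by
    have h1 := (node_of_phrase_eq x htn (by rw [ht1])).2
    rw [ht2, List.length_nil] at h1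
    have h2 := length_node_le x n
    omega
  have key := abs_sum_phrases_le ω hb hq1 hε0.le ht1 ht3 (L := L) fun l hl => (hL l hl m).le
  rw [← hx, ← hκ] at key
  set f : ℕ → ℝ := fun s => H (node x s) ((ω (node x s)).1, x s) with hf
  have hfin : |∑ s ∈ Finset.range n, f s| ≤ |∑ s ∈ Finset.range t, f s| + m := by
    rw [← Finset.sum_range_add_sum_Ico f htn]
    refine (abs_add_le _ _).trans (add_le_add le_rfl ?_)
    refine (Finset.abs_sum_le_sum_abs _ _).trans
      ((Finset.sum_le_card_nsmul _ _ 1 fun r _ => hb _ _).trans ?_)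
    rw [Nat.card_Ico, nsmul_eq_mul, mul_one]
    exact_mod_cast hnt
  have hg := hgrow x n ((le_max_left _ _).trans hn2)
  have hm1 : (1 : ℝ) ≤ m := by exact_mod_cast (le_max_right _ _).trans hn2
  have htn' : (t : ℝ) ≤ n := by exact_mod_cast htn
  have e1 : (t : ℝ) / q ≤ η / 5 * n := by
    calc (t : ℝ) / q = 1 / q * t := by ring
      _ ≤ η / 5 * n := by gcongr
  have e2 : ε * (m * (Real.log m / κ)) ≤ ε * (C / κ) * n := by
    calc ε * (m * (Real.log m / κ)) = ε / κ * (m * Real.log m) := by ring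
      _ ≤ ε / κ * (C * n) := by gcongr
      _ = _ := by ring
  have e3 : ε * t ≤ ε * n := by gcongr
  have e4 : ((m : ℝ) + 1) * grid q L + m ≤ η / 5 * n := by
    have h1 : (m : ℝ) * (2 * (grid q L + 1)) ≤ η / 5 * n := by
      have := mul_le_mul_of_nonneg_right (hn1 x) (by positivity : (0 : ℝ) ≤ 2 * (grid q L + 1))
      refine this.trans (le_of_eq ?_)
      field_simp
    have h2 : (0 : ℝ) ≤ grid q L := by positivity
    nlinarith
  have e5 : ε * n + ε * (C / κ) * n ≤ η / 5 * n := by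
    have := mul_le_mul_of_nonneg_right hεe hn'.le
    linarith
  rw [Real.dist_eq, sub_zero, abs_div, abs_of_pos hn', div_lt_iff₀ hn']
  have : 0 < η * n := by positivity
  linarith

theorem ae_tendsto_average {H : List A → stdSimplex ℝ A × A → ℝ}
    (hm : ∀ v, Measurable (H v)) {C : ℝ} (hb : ∀ v p, |H v p| ≤ C) {c : List A → ℝ}
    (h0 : ∀ v, ∫ p, H v p ∂(prior ⊗ₘ symbolKernel) = c v) :
    ∀ᵐ ω ∂(Measure.infinitePi fun _ : List A => nodeLaw prior),
      Tendsto (fun n : ℕ => (∑ s ∈ Finset.range n,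
        (H (node (nodeSeq ω) s) ((ω (node (nodeSeq ω) s)).1, nodeSeq ω s) -
          c (node (nodeSeq ω) s))) / n) atTop (𝓝 0) := by
  set D : ℝ := 2 * |C| + 1 with hD
  have hDpos : 0 < D := by positivity
  have hint : ∀ v, Integrable (H v) (prior ⊗ₘ symbolKernel) := fun v =>
    integrable_of_bounded (hm v) (hb v)
  have hc : ∀ v, |c v| ≤ |C| := fun v => by
    have := norm_integral_le_of_norm_le_const (μ := prior ⊗ₘ symbolKernel) (f := H v) (C := |C|)
      (ae_of_all _ fun p => (hb v p).trans (le_abs_self C))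
    simpa [h0 v] using this
  have h := ae_tendsto_average_of_bounded_one prior (H := fun v p => (H v p - c v) / D)
    (fun v => ((hm v).sub_const _).div_const _) (fun v p => by
      rw [abs_div, abs_of_pos hDpos, div_le_one hDpos]
      have h1 := abs_sub (H v p) (c v)
      have h2 := hb v p
      have h3 := hc v
      have h4 := le_abs_self C
      linarith) (fun v => by
      rw [integral_div, integral_sub (hint v) (integrable_const _), h0]
      simp)
  filter_upwards [h] with ω hω
  have := hω.mul_const D
  rw [zero_mul] at this
  refine this.congr fun n => ?_
  rw [← Finset.sum_div]
  field_simp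

end LLN

/-! ### Limiting frequencies of words. -/

section Frequencies

variable {A : Type*} [DecidableEq A]

/-- Relative frequency of the word `w` among the first `n` windows of `x`. -/
noncomputable def windowFreq {k : ℕ} (x : ℕ → A) (w : Fin k → A) (n : ℕ) : ℝ :=
  (∑ i ∈ Finset.range n, if ∀ j : Fin k, x (i + j) = w j then (1 : ℝ) else 0) / n

/-- All words have the limiting frequencies of an i.i.d. sequence with mass function `p`. -/
def HasIIDFrequencies (p : A → ℝ) (x : ℕ → A) : Prop :=
  ∀ (k : ℕ) (w : Fin k → A), Tendsto (windowFreq x w) atTop (𝓝 (∏ j, p (w j)))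

theorem forall_snoc_iff {k : ℕ} (x : ℕ → A) (i : ℕ) (u : Fin k → A) (a : A) :
    (∀ j : Fin (k + 1), x (i + j) = (Fin.snoc u a : Fin (k + 1) → A) j) ↔
      (∀ j : Fin k, x (i + j) = u j) ∧ x (i + k) = a := by
  rw [Fin.forall_fin_succ']
  simp

theorem tendsto_div_of_abs_sub_le {f g e : ℕ → ℝ} (h : ∀ n, |f n - g n| ≤ e n)
    (hg : Tendsto (fun n : ℕ => g n / n) atTop (𝓝 0))
    (he : Tendsto (fun n : ℕ => e n / n) atTop (𝓝 0)) :
    Tendsto (fun n : ℕ => f n / n) atTop (𝓝 0) := by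
  have h1 : Tendsto (fun n : ℕ => (f n - g n) / n) atTop (𝓝 0) := by
    refine squeeze_zero_norm (fun n => ?_) he
    rw [Real.norm_eq_abs, abs_div, abs_of_nonneg (Nat.cast_nonneg n : (0 : ℝ) ≤ n)]
    gcongr
    exact h n
  have := h1.add hg
  rw [add_zero] at this
  refine this.congr fun n => ?_
  rw [← add_div, sub_add_cancel]

theorem abs_ite_zero_le_one {P : Prop} [Decidable P] {c : ℝ} (h : |c| ≤ 1) :
    |if P then c else 0| ≤ 1 := by
  split_ifs
  · exact h
  · simp

variable [Fintype A]

theorem tendsto_phrase_div (x : ℕ → A) :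
    Tendsto (fun n : ℕ => (phrase x n : ℝ) / n) atTop (𝓝 0) := by
  rw [Metric.tendsto_atTop']
  intro η hη
  obtain ⟨N, hN⟩ := eventually_atTop.1
    ((eventually_phrase_le (A := A) (η / 2) (half_pos hη)).and (eventually_gt_atTop 0))
  refine ⟨N, fun n hn => ?_⟩
  obtain ⟨h1, h2⟩ := hN n hn.le
  have h2' : (0 : ℝ) < n := by exact_mod_cast h2
  rw [Real.dist_eq, sub_zero, abs_of_nonneg (by positivity), div_lt_iff₀ h2']
  have := h1 x
  nlinarith

theorem tendsto_comp_add_div {f : ℕ → ℝ} (k : ℕ)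
    (h : Tendsto (fun n : ℕ => f n / n) atTop (𝓝 0)) :
    Tendsto (fun n : ℕ => f (n + k) / n) atTop (𝓝 0) := by
  have h1 := (tendsto_add_atTop_iff_nat k).2 h
  have h2 : Tendsto (fun n : ℕ => ((n + k : ℕ) : ℝ) / n) atTop (𝓝 1) := by
    have h3 : Tendsto (fun n : ℕ => 1 + (k : ℝ) / n) atTop (𝓝 (1 + 0)) :=
      tendsto_const_nhds.add (tendsto_const_div_atTop_nhds_zero_nat _)
    rw [add_zero] at h3
    refine h3.congr' ?_
    filter_upwards [eventually_gt_atTop 0] with n hn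
    have : (n : ℝ) ≠ 0 := by exact_mod_cast hn.ne'
    push_cast; field_simp
  have := h1.mul h2
  rw [zero_mul] at this
  refine this.congr' ?_
  filter_upwards [eventually_gt_atTop 0] with n hn
  have h4 : (n : ℝ) ≠ 0 := by exact_mod_cast hn.ne'
  have h5 : ((n + k : ℕ) : ℝ) ≠ 0 := by exact_mod_cast (by omega : n + k ≠ 0)
  field_simp

/-- The law of large numbers along the nodes that end in a given word yields the frequencies of all
words. -/
theorem hasIIDFrequencies_of_node {p : A → ℝ} (hp : ∀ a, p a ∈ Set.Icc (0 : ℝ) 1) {x : ℕ → A}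
    (h : ∀ (k : ℕ) (u : Fin k → A) (a : A), Tendsto (fun n : ℕ => (∑ s ∈ Finset.range n,
      (if List.ofFn u <:+ node x s then (if x s = a then 1 else 0) - p a else 0)) / n)
      atTop (𝓝 0)) :
    HasIIDFrequencies p x := by
  intro k
  induction k with
  | zero =>
    intro w
    simp only [Finset.univ_eq_empty, Finset.prod_empty]
    refine tendsto_const_nhds.congr' ?_
    filter_upwards [eventually_gt_atTop 0] with n hn
    have : (n : ℝ) ≠ 0 := by exact_mod_cast hn.ne'
    simp [windowFreq, this]
  | succ k ih =>
    intro w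
    obtain ⟨u, a, rfl⟩ : ∃ (u : Fin k → A) (a : A), w = Fin.snoc u a :=
      ⟨Fin.init w, w (Fin.last k), (Fin.snoc_init_self w).symm⟩
    set φ : ℕ → ℝ := fun s =>
      if List.ofFn u <:+ node x s then (if x s = a then 1 else 0) - p a else 0 with hφ
    set ψ : ℕ → ℝ := fun i =>
      if ∀ j : Fin k, x (i + j) = u j then (if x (i + k) = a then 1 else 0) - p a else 0 with hψ
    have hbd : ∀ s, |(if x s = a then (1 : ℝ) else 0) - p a| ≤ 1 := by
      intro s
      obtain ⟨h1, h2⟩ := hp a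
      split_ifs <;> rw [abs_le] <;> constructor <;> linarith
    have hφ1 : ∀ s, |φ s| ≤ 1 := fun s => abs_ite_zero_le_one (hbd s)
    -- The window condition and the node condition agree unless the node is shallower than `k`,
    -- which happens at o(n) times.
    have hdiff : ∀ i, |ψ i - φ (i + k)| ≤ if (node x (i + k)).length < k then 1 else 0 := by
      intro i
      split_ifs with hlen
      · have : ¬ List.ofFn u <:+ node x (i + k) := fun hs => by
          have := hs.length_le
          simp at this; omega
        simp only [hφ, if_neg this, sub_zero, hψ]
        exact abs_ite_zero_le_one (hbd (i + k))
      · have := ofFn_suffix_node_iff x (not_lt.1 hlen) u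
        simp only [hφ, hψ, this, Nat.add_sub_cancel]
        simp
    have hψ0 : Tendsto (fun n : ℕ => (∑ i ∈ Finset.range n, ψ i) / n) atTop (𝓝 0) := by
      refine tendsto_div_of_abs_sub_le (g := fun n => ∑ s ∈ Finset.range (n + k), φ s)
        (e := fun n => ((phrase x (n + k) : ℝ) + 1) * k + k) (fun n => ?_)
        (tendsto_comp_add_div k (h k u a)) ?_
      · rw [add_comm n k, Finset.sum_range_add, ← sub_sub, sub_right_comm,
          ← Finset.sum_sub_distrib]
        refine (abs_sub _ _).trans (add_le_add ?_ ?_)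
        · refine (Finset.abs_sum_le_sum_abs _ _).trans ?_
          have h1 : ∑ i ∈ Finset.range n, |ψ i - φ (k + i)| ≤
              ∑ i ∈ Finset.range n, if (node x (k + i)).length < k then (1 : ℝ) else 0 :=
            Finset.sum_le_sum fun i _ => by rw [add_comm k i]; exact hdiff i
          refine h1.trans ?_
          have h2 : ∑ i ∈ Finset.range n, (if (node x (k + i)).length < k then (1 : ℝ) else 0) ≤
              ∑ s ∈ Finset.range (k + n), if (node x s).length < k then (1 : ℝ) else 0 := by
            rw [Finset.sum_range_add]
            exact le_add_of_nonneg_left (Finset.sum_nonneg fun _ _ => by split_ifs <;> norm_num)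
          refine h2.trans ?_
          rw [Finset.sum_boole]
          exact_mod_cast card_short_node_le x (k + n) k
        · refine (Finset.abs_sum_le_sum_abs _ _).trans
            ((Finset.sum_le_card_nsmul _ _ 1 fun r _ => hφ1 r).trans ?_)
          simp
      · have h1 := (tendsto_comp_add_div k (tendsto_phrase_div x)).mul_const (k : ℝ)
        have h2 := tendsto_const_div_atTop_nhds_zero_nat ((k : ℝ) + k)
        have := h1.add h2
        rw [zero_mul, add_zero] at this
        refine this.congr fun n => ?_
        ring
    -- The frequency of `u` followed by `a` is that of `u` times `p a`, plus an average that tends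
    -- to zero.
    have h1 : ∀ n, windowFreq x (Fin.snoc u a : Fin (k + 1) → A) n =
        (∑ i ∈ Finset.range n, ψ i) / n + windowFreq x u n * p a := by
      intro n
      rw [windowFreq, windowFreq, div_mul_eq_mul_div, ← add_div, Finset.sum_mul,
        ← Finset.sum_add_distrib]
      congr 1
      refine Finset.sum_congr rfl fun i _ => ?_
      simp only [forall_snoc_iff, hψ]
      by_cases h1 : ∀ j : Fin k, x (i + j) = u j <;> by_cases h2 : x (i + k) = a <;> simp [h1, h2]
    rw [show windowFreq x (Fin.snoc u a : Fin (k + 1) → A) = _ from funext h1,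
      Fin.prod_univ_castSucc]
    have := hψ0.add ((ih u).mul_const (p a))
    simpa using this

variable [MeasurableSpace A] [MeasurableSingletonClass A]
variable (prior : Measure (stdSimplex ℝ A)) [IsProbabilityMeasure prior]

theorem integrable_coord (a : A) : Integrable (fun θ : stdSimplex ℝ A => θ.1 a) prior :=
  integrable_of_bounded ((measurable_pi_apply a).comp measurable_subtype_coe) (C := 1) fun θ => by
    rw [abs_of_nonneg (θ.2.1 a), ← θ.2.2]
    exact Finset.single_le_sum (fun b _ => θ.2.1 b) (Finset.mem_univ a)

theorem meanPMF_nonneg (a : A) : 0 ≤ meanPMF prior a := integral_nonneg fun θ => θ.2.1 a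

theorem sum_meanPMF : ∑ a, meanPMF prior a = 1 := by
  simp only [meanPMF]
  rw [← integral_finsetSum _ fun a _ => integrable_coord prior a]
  have : ∀ θ : stdSimplex ℝ A, ∑ a, θ.1 a = 1 := fun θ => θ.2.2
  simp [this]

theorem meanPMF_le_one (a : A) : meanPMF prior a ≤ 1 := by
  rw [← sum_meanPMF prior]
  exact Finset.single_le_sum (fun b _ => meanPMF_nonneg prior b) (Finset.mem_univ a)

theorem integral_compProd_symbolKernel {f : stdSimplex ℝ A × A → ℝ}
    (hf : Integrable f (prior ⊗ₘ symbolKernel)) :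
    ∫ p, f p ∂(prior ⊗ₘ symbolKernel) = ∫ θ, ∑ a, θ.1 a * f (θ, a) ∂prior := by
  rw [Measure.integral_compProd hf]
  refine integral_congr_ae (ae_of_all _ fun θ => ?_)
  exact integral_symbolMeasure θ fun a => f (θ, a)

/-- The words in a sequence drawn from the LZ78 source have the frequencies of an i.i.d. sequence
with the mean law. -/
theorem ae_hasIIDFrequencies : ∀ᵐ x ∂source prior, HasIIDFrequencies (meanPMF prior) x := by
  have h1 : ∀ᵐ x ∂source prior, ∀ (k : ℕ) (u : Fin k → A) (a : A),
      Tendsto (fun n : ℕ => (∑ s ∈ Finset.range n,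
        (if List.ofFn u <:+ node x s then (if x s = a then 1 else 0) - meanPMF prior a else 0)) / n)
      atTop (𝓝 0) := by
    rw [ae_all_iff]; intro k
    rw [ae_all_iff]; intro u
    rw [ae_all_iff]; intro a
    have hmeas : MeasurableSet {x : ℕ → A | Tendsto (fun n : ℕ => (∑ s ∈ Finset.range n,
        (if List.ofFn u <:+ node x s then (if x s = a then 1 else 0) - meanPMF prior a else 0)) / n)
      atTop (𝓝 0)} := by
      refine measurableSet_tendsto _ fun n => Measurable.div_const
        (Finset.measurable_fun_sum _ fun s _ => ?_) _
      refine Measurable.ite (measurableSet_parse s fun q => List.ofFn u <:+ q.cur) ?_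
        measurable_const
      exact (Measurable.ite ((measurableSet_singleton a).preimage (measurable_pi_apply s))
        measurable_const measurable_const).sub_const _
    rw [source_eq_map_nodeSeq, ae_map_iff measurable_nodeSeq.aemeasurable hmeas]
    have hm : Measurable fun p : stdSimplex ℝ A × A => if p.2 = a then (1 : ℝ) else 0 :=
      Measurable.ite ((measurableSet_singleton a).preimage measurable_snd) measurable_const
        measurable_const
    have hb : ∀ p : stdSimplex ℝ A × A, |if p.2 = a then (1 : ℝ) else 0| ≤ 1 := fun p => by
      split_ifs <;> simp
    -- Node-dependent functions enter here: the past word `u` is read off the node, and the function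
    -- vanishes at nodes that do not end in `u`.
    have h := ae_tendsto_average prior
      (H := fun v p => if List.ofFn u <:+ v then (if p.2 = a then 1 else 0) else 0) (C := 1)
      (c := fun v => if List.ofFn u <:+ v then meanPMF prior a else 0)
      (fun v => by split_ifs <;> first | exact hm | exact measurable_const)
      (fun v p => by split_ifs <;> simp)
      (fun v => by
        split_ifs
        · rw [integral_compProd_symbolKernel prior (integrable_of_bounded hm hb)]
          simp [meanPMF]
        · simp)
    filter_upwards [h] with ω hω
    refine hω.congr fun n => ?_
    congr 1
    refine Finset.sum_congr rfl fun s _ => ?_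
    split_ifs <;> simp
  filter_upwards [h1] with x hx
  exact hasIIDFrequencies_of_node
    (fun a => ⟨meanPMF_nonneg prior a, meanPMF_le_one prior a⟩) hx

end Frequencies

/-! ### Markov log loss. -/

section MarkovLoss

variable {A : Type*} [DecidableEq A] [Fintype A]

theorem continuous_mul_logb : Continuous fun t : ℝ => t * Real.logb 2 t := by
  have : (fun t : ℝ => t * Real.logb 2 t) = fun t => -Real.negMulLog t / Real.log 2 := by
    funext t; simp [Real.negMulLog, Real.logb, mul_div_assoc]
  rw [this]
  exact Real.continuous_negMulLog.neg.div_const _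

/-- Replaces the quotient by differences of t log t, a form that is continuous also where
frequencies vanish. -/
theorem sum_mul_logb_div {ι : Type*} [Fintype ι] {e : ι → ℝ} (he : ∀ a, 0 ≤ e a) :
    ∑ a, e a * Real.logb 2 ((∑ b, e b) / e a) =
      (∑ a, e a) * Real.logb 2 (∑ a, e a) - ∑ a, e a * Real.logb 2 (e a) := by
  rw [Finset.sum_mul, ← Finset.sum_sub_distrib]
  refine Finset.sum_congr rfl fun a _ => ?_
  rcases (he a).eq_or_lt with h | h
  · simp [← h]
  · have : 0 < ∑ b, e b :=
      h.trans_le (Finset.single_le_sum (fun b _ => he b) (Finset.mem_univ a))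
    rw [Real.logb_div this.ne' h.ne']; ring

theorem empirical_eq_windowFreq (k : ℕ) (x : ℕ → A) (n : ℕ) (u : Fin k → A) (a : A) :
    empirical k x n u a = windowFreq x (Fin.snoc u a : Fin (k + 1) → A) (n - k) := by
  rw [empirical, windowFreq, Finset.sum_boole]
  simp only [forall_snoc_iff]

variable {p : A → ℝ} (hp0 : ∀ a, 0 ≤ p a) (hp1 : ∑ a, p a = 1)
include hp0 hp1

/-- By continuity the limit is the conditional entropy of a product law, which is the entropy of `p`
whatever the order `k`. -/
theorem HasIIDFrequencies.tendsto_empiricalCondEntropy {x : ℕ → A} (hx : HasIIDFrequencies p x)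
    (k : ℕ) : Tendsto (fun n => empiricalCondEntropy k x n) atTop (𝓝 (entropy p)) := by
  have he : ∀ (u : Fin k → A) (a : A), Tendsto (fun n => empirical k x n u a) atTop
      (𝓝 ((∏ j, p (u j)) * p a)) := by
    intro u a
    simp only [empirical_eq_windowFreq]
    have h1 := (hx (k + 1) (Fin.snoc u a : Fin (k + 1) → A)).comp (tendsto_sub_atTop_nat k)
    rw [Fin.prod_univ_castSucc] at h1
    simpa [Function.comp_def] using h1
  have hn : ∀ n u a, 0 ≤ empirical k x n u a := fun n u a => by rw [empirical]; positivity
  have h1 : ∀ n, empiricalCondEntropy k x n = ∑ u : Fin k → A,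
      ((∑ a, empirical k x n u a) * Real.logb 2 (∑ a, empirical k x n u a) -
        ∑ a, empirical k x n u a * Real.logb 2 (empirical k x n u a)) := fun n =>
    Finset.sum_congr rfl fun u _ => sum_mul_logb_div (hn n u)
  simp only [h1]
  have hlim : entropy p = ∑ u : Fin k → A,
      ((∑ a, (∏ j, p (u j)) * p a) * Real.logb 2 (∑ a, (∏ j, p (u j)) * p a) -
        ∑ a, (∏ j, p (u j)) * p a * Real.logb 2 ((∏ j, p (u j)) * p a)) := by
    have hP : ∀ u : Fin k → A, 0 ≤ ∏ j, p (u j) := fun u => Finset.prod_nonneg fun j _ => hp0 _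
    have h2 : ∀ u : Fin k → A,
        ((∑ a, (∏ j, p (u j)) * p a) * Real.logb 2 (∑ a, (∏ j, p (u j)) * p a) -
        ∑ a, (∏ j, p (u j)) * p a * Real.logb 2 ((∏ j, p (u j)) * p a)) =
        (∏ j, p (u j)) * entropy p := by
      intro u
      rw [← sum_mul_logb_div fun a => mul_nonneg (hP u) (hp0 a), ← Finset.mul_sum, hp1, mul_one,
        entropy, ← Finset.sum_neg_distrib, Finset.mul_sum]
      refine Finset.sum_congr rfl fun a _ => ?_
      rcases (hP u).eq_or_lt with h | h
      · simp [← h]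
      · rw [div_mul_cancel_left₀ h.ne', Real.logb_inv]; ring
    rw [Finset.sum_congr rfl fun u _ => h2 u, ← Finset.sum_mul, ← Fintype.sum_pow, hp1, one_pow,
      one_mul]
  rw [hlim]
  refine tendsto_finsetSum _ fun u _ => Tendsto.sub ?_ (tendsto_finsetSum _ fun a _ => ?_)
  · exact (continuous_mul_logb.tendsto _).comp (tendsto_finsetSum _ fun a _ => he u a)
  · exact (continuous_mul_logb.tendsto _).comp (he u a)

theorem HasIIDFrequencies.markovLogLoss_eq {x : ℕ → A} (hx : HasIIDFrequencies p x) (k : ℕ) :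
    markovLogLoss k x = entropy p :=
  (hx.tendsto_empiricalCondEntropy hp0 hp1 k).limsup_eq

end MarkovLoss

/-! ### Gibbs' inequality. -/

section Gibbs

theorem entropy_nonneg {ι : Type*} [Fintype ι] {p : ι → ℝ} (h0 : ∀ i, 0 ≤ p i)
    (h1 : ∀ i, p i ≤ 1) : 0 ≤ entropy p := by
  rw [entropy, ← Finset.sum_neg_distrib]
  refine Finset.sum_nonneg fun i _ => ?_
  rw [← mul_neg]
  exact mul_nonneg (h0 i) (neg_nonneg.2 (Real.logb_nonpos (by norm_num) (h0 i) (h1 i)))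

/-- Gibbs' inequality for a mass function and a weight of total mass at most `K`. -/
theorem entropy_sub_logb_le {ι : Type*} [Fintype ι] {f φ : ι → ℝ} (hf : ∀ i, 0 ≤ f i)
    (hf1 : ∑ i, f i = 1) (hφ : ∀ i, 0 ≤ φ i) {K : ℝ} (hK : 0 < K) (hφK : ∑ i, φ i ≤ K)
    (hpos : ∀ i, f i ≠ 0 → 0 < φ i) :
    entropy f - Real.logb 2 K ≤ ∑ i, f i * -Real.logb 2 (φ i) := by
  have hl2 : 0 < Real.log 2 := Real.log_pos (by norm_num)
  have key : ∀ i, -(f i * Real.logb 2 (f i)) - f i * Real.logb 2 K ≤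
      f i * -Real.logb 2 (φ i) + (φ i / K - f i) / Real.log 2 := by
    intro i
    rcases (hf i).eq_or_lt with h | h
    · rw [← h]
      have : 0 ≤ φ i / K / Real.log 2 := div_nonneg (div_nonneg (hφ i) hK.le) hl2.le
      simpa using this
    · have hφi := hpos i h.ne'
      -- log y ≤ y - 1 at y = φ / (K f), multiplied by f below.
      have h1 := Real.log_le_sub_one_of_pos (x := φ i / K / f i) (by positivity)
      rw [Real.log_div (by positivity) h.ne', Real.log_div hφi.ne' hK.ne'] at h1
      have h2 := mul_le_mul_of_nonneg_left h1 h.le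
      have h3 : f i * (φ i / K / f i - 1) = φ i / K - f i := by field_simp
      rw [h3] at h2
      simp only [Real.logb]
      rw [← sub_nonneg] at h2 ⊢
      have h4 : f i * -(Real.log (φ i) / Real.log 2) + (φ i / K - f i) / Real.log 2 -
          (-(f i * (Real.log (f i) / Real.log 2)) - f i * (Real.log K / Real.log 2)) =
          (φ i / K - f i - f i * (Real.log (φ i) - Real.log K - Real.log (f i))) / Real.log 2 := by
        field_simp; ring
      rw [h4]
      exact div_nonneg h2 hl2.le
  have hsum := Finset.sum_le_sum fun i (_ : i ∈ Finset.univ) => key i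
  rw [Finset.sum_sub_distrib, Finset.sum_add_distrib, ← Finset.sum_mul, hf1, ← Finset.sum_div,
    Finset.sum_sub_distrib, ← Finset.sum_div, hf1, Finset.sum_neg_distrib, one_mul] at hsum
  have h5 : (∑ i, φ i) / K - 1 ≤ 0 := by
    have := (div_le_one hK).2 hφK
    linarith
  have h6 := div_nonpos_of_nonpos_of_nonneg h5 hl2.le
  rw [entropy]
  linarith

end Gibbs

/-! ### Lower bound on costs through sliding windows. -/

section Windows

variable {A : Type*} [DecidableEq A] [Fintype A]

theorem windowFreq_nonneg {k : ℕ} (x : ℕ → A) (w : Fin k → A) (n : ℕ) : 0 ≤ windowFreq x w n :=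
  div_nonneg (Finset.sum_nonneg fun _ _ => by split_ifs <;> norm_num) (Nat.cast_nonneg n)

theorem sum_windowFreq_mul {k : ℕ} (x : ℕ → A) (G : (Fin k → A) → ℝ) (n : ℕ) :
    ∑ w, windowFreq x w n * G w =
      (∑ i ∈ Finset.range n, G fun j : Fin k => x (i + j)) / n := by
  simp only [windowFreq, div_mul_eq_mul_div, Finset.sum_mul, ← Finset.sum_div]
  rw [Finset.sum_comm]
  congr 1
  refine Finset.sum_congr rfl fun i _ => ?_
  simp only [ite_mul, one_mul, zero_mul]
  rw [Finset.sum_eq_single fun j : Fin k => x (i + j)]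
  · simp
  · intro w _ hw
    exact if_neg fun h => hw (funext fun j => (h j).symm)
  · simp

theorem sum_windowFreq {k : ℕ} (x : ℕ → A) {n : ℕ} (hn : 0 < n) :
    ∑ w : Fin k → A, windowFreq x w n = 1 := by
  have h := sum_windowFreq_mul x (fun _ : Fin k → A => 1) n
  have : (n : ℝ) ≠ 0 := by exact_mod_cast hn.ne'
  simpa [this] using h

/-- Each time lies in at most `k` windows. -/
theorem sum_sliding_le {c : ℕ → ℝ} (hc : ∀ t, 0 ≤ c t) (k N : ℕ) :
    ∑ i ∈ Finset.range N, ∑ j ∈ Finset.range k, c (i + j) ≤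
      k * ∑ t ∈ Finset.range (N + k), c t := by
  rw [Finset.sum_comm]
  have key : ∀ j ∈ Finset.range k, ∑ i ∈ Finset.range N, c (i + j) ≤
      ∑ t ∈ Finset.range (N + k), c t := by
    intro j hj
    have hj' := Finset.mem_range.1 hj
    calc ∑ i ∈ Finset.range N, c (i + j) ≤ ∑ t ∈ Finset.range (j + N), c t := by
          rw [Finset.sum_range_add]
          simp only [add_comm _ j]
          exact le_add_of_nonneg_left (Finset.sum_nonneg fun t _ => hc t)
      _ ≤ _ := Finset.sum_le_sum_of_subset_of_nonneg (by
          intro t; simp only [Finset.mem_range]; omega) fun t _ _ => hc t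
  refine (Finset.sum_le_card_nsmul _ _ _ key).trans (le_of_eq ?_)
  rw [Finset.card_range, nsmul_eq_mul]

/-- A nonnegative cost that satisfies a Kraft-type inequality on windows of length `k` is at least
the empirical entropy of the windows. -/
theorem windowEntropy_le_cost {x : ℕ → A} {k N : ℕ} (hN : 0 < N) {c : ℕ → ℝ} (hc : ∀ t, 0 ≤ c t)
    {φ : (Fin k → A) → ℝ} (hφ : ∀ w, 0 ≤ φ w) {K : ℝ} (hK : 0 < K) (hφK : ∑ w, φ w ≤ K)
    (h : ∀ i < N, (2 : ℝ) ^ (-∑ j ∈ Finset.range k, c (i + j)) ≤ φ fun j => x (i + j)) :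
    N * (entropy (fun w : Fin k → A => windowFreq x w N) - Real.logb 2 K) ≤
      k * ∑ t ∈ Finset.range (N + k), c t := by
  have hN' : (0 : ℝ) < N := by exact_mod_cast hN
  have h1 := entropy_sub_logb_le (fun w => windowFreq_nonneg x w N) (sum_windowFreq x hN) hφ hK hφK
    (fun w hw => by
      have : ∃ i ∈ Finset.range N, (if ∀ j : Fin k, x (i + j) = w j then (1 : ℝ) else 0) ≠ 0 := by
        by_contra! hcon
        exact hw (by rw [windowFreq, Finset.sum_eq_zero hcon, zero_div])
      obtain ⟨i, hi, hwi⟩ := this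
      have hwi' : ∀ j : Fin k, x (i + j) = w j := by
        by_contra hne; exact hwi (if_neg hne)
      rw [show w = fun j : Fin k => x (i + j) from funext fun j => (hwi' j).symm]
      exact (Real.rpow_pos_of_pos (by norm_num) _).trans_le (h i (Finset.mem_range.1 hi)))
  rw [sum_windowFreq_mul x (fun w => -Real.logb 2 (φ w)), le_div_iff₀ hN'] at h1
  rw [mul_comm]
  refine h1.trans (le_trans (Finset.sum_le_sum fun i hi => ?_) (sum_sliding_le hc k N))
  have h2 := h i (Finset.mem_range.1 hi)
  have h3 := Real.logb_le_logb_of_le (b := 2) (by norm_num)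
    (Real.rpow_pos_of_pos (by norm_num) _) h2
  rw [Real.logb_rpow (by norm_num) (by norm_num)] at h3
  linarith

variable {p : A → ℝ}

theorem entropy_tensor (hp1 : ∑ a, p a = 1) (k : ℕ) :
    entropy (fun w : Fin k → A => ∏ j, p (w j)) = k * entropy p := by
  induction k with
  | zero => simp [entropy]
  | succ k ih =>
    have h1 : ∀ a (u : Fin k → A), (p a * ∏ j, p (u j)) * Real.logb 2 (p a * ∏ j, p (u j)) =
        (p a * Real.logb 2 (p a)) * ∏ j, p (u j) +
          p a * ((∏ j, p (u j)) * Real.logb 2 (∏ j, p (u j))) := by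
      intro a u
      rcases eq_or_ne (p a) 0 with h | h
      · simp [h]
      · rcases eq_or_ne (∏ j, p (u j)) 0 with h' | h'
        · simp [h']
        · rw [Real.logb_mul h h']; ring
    rw [entropy, ← (Fin.consEquiv fun _ => A).sum_comp, Fintype.sum_prod_type]
    simp only [Fin.consEquiv_apply, Fin.prod_univ_succ, Fin.cons_zero, Fin.cons_succ, h1]
    simp only [Finset.sum_add_distrib, ← Finset.mul_sum, ← Finset.sum_mul, ← Fintype.sum_pow, hp1,
      one_pow, mul_one, one_mul]
    rw [entropy] at ih
    rw [neg_add, ih, entropy]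
    push_cast; ring

variable (hp0 : ∀ a, 0 ≤ p a) (hp1 : ∑ a, p a = 1)
include hp0 hp1

theorem HasIIDFrequencies.tendsto_windowEntropy {x : ℕ → A} (hx : HasIIDFrequencies p x) (k : ℕ) :
    Tendsto (fun N => entropy fun w : Fin k → A => windowFreq x w N) atTop
      (𝓝 (k * entropy p)) := by
  rw [← entropy_tensor hp1]
  exact (tendsto_finsetSum _ fun w _ => (continuous_mul_logb.tendsto _).comp (hx k w)).neg

/-- The common converse for models and encoders. The threshold in `n` does not depend on `c` or `φ`,
as needed because the best machine may change with `n`. Large `k` makes the penalty for `K`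
negligible when log K = o(k). -/
theorem HasIIDFrequencies.eventually_le_average {x : ℕ → A} (hx : HasIIDFrequencies p x)
    {k : ℕ} (hk : 0 < k) {K : ℝ} (hK : 0 < K) {δ : ℝ} (hδ : 0 < δ) :
    ∀ᶠ n : ℕ in atTop, ∀ (c : ℕ → ℝ) (φ : (Fin k → A) → ℝ), (∀ t, 0 ≤ c t) → (∀ w, 0 ≤ φ w) →
      ∑ w, φ w ≤ K →
      (∀ i, i + k ≤ n → (2 : ℝ) ^ (-∑ j ∈ Finset.range k, c (i + j)) ≤ φ fun j => x (i + j)) →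
      entropy p - Real.logb 2 K / k - δ ≤ (∑ t ∈ Finset.range n, c t) / n := by
  have hk' : (0 : ℝ) < k := by exact_mod_cast hk
  have h1 : Tendsto (fun N : ℕ => (N : ℝ) / (N + k : ℕ) *
      ((entropy (fun w : Fin k → A => windowFreq x w N) - Real.logb 2 K) / k)) atTop
      (𝓝 (1 * ((k * entropy p - Real.logb 2 K) / k))) := by
    refine Tendsto.mul ?_ (((hx.tendsto_windowEntropy hp0 hp1 k).sub_const _).div_const _)
    push_cast
    exact tendsto_natCast_div_add_atTop (k : ℝ)
  have h2 : (1 : ℝ) * ((k * entropy p - Real.logb 2 K) / k) =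
      entropy p - Real.logb 2 K / k := by field_simp
  rw [h2] at h1
  have h3 := h1.eventually_const_le (show entropy p - Real.logb 2 K / k - δ <
    entropy p - Real.logb 2 K / k by linarith)
  filter_upwards [(tendsto_sub_atTop_nat k).eventually (h3.and (eventually_gt_atTop 0))]
    with n hn c φ hc hφ hφK h
  obtain ⟨hn1, hn2⟩ := hn
  refine hn1.trans ?_
  have hnk : n - k + k = n := by omega
  have h4 := windowEntropy_le_cost (x := x) hn2 hc hφ hK hφK fun i hi => h i (by omega)
  rw [hnk] at h4 ⊢
  have hn0 : (0 : ℝ) < n := by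
    have : 0 < n := by omega
    exact_mod_cast this
  rw [le_div_iff₀ hn0]
  have h5 : ((n - k : ℕ) : ℝ) / n * ((entropy (fun w : Fin k → A => windowFreq x w (n - k)) -
      Real.logb 2 K) / k) * n = ((n - k : ℕ) *
      (entropy (fun w : Fin k → A => windowFreq x w (n - k)) - Real.logb 2 K)) / k := by
    field_simp
  rw [h5, div_le_iff₀ hk']
  linarith

omit hp0 hp1

theorem HasIIDFrequencies.tendsto_average {x : ℕ → A} (hx : HasIIDFrequencies p x) (g : A → ℝ) :
    Tendsto (fun n : ℕ => (∑ t ∈ Finset.range n, g (x t)) / n) atTop (𝓝 (∑ a, p a * g a)) := by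
  have h1 : ∀ n : ℕ, (∑ t ∈ Finset.range n, g (x t)) / n =
      ∑ w : Fin 1 → A, windowFreq x w n * g (w 0) := fun n => by
    rw [sum_windowFreq_mul x fun w : Fin 1 → A => g (w 0)]; simp
  have h2 : ∑ a, p a * g a = ∑ w : Fin 1 → A, (∏ j, p (w j)) * g (w 0) := by
    rw [← (Equiv.funUnique (Fin 1) A).symm.sum_comp]
    simp
  simp only [h1, h2]
  exact tendsto_finsetSum _ fun w _ => (hx 1 w).mul_const _

end Windows

/-! ### Smoothing a mass function. -/

section Smoothing

variable {A : Type*} [Fintype A]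

/-- A mass function without zeros whose cross entropy is close to the entropy. -/
theorem exists_pos_crossEntropy_le {p : A → ℝ} (hp0 : ∀ a, 0 ≤ p a) (hp1 : ∑ a, p a = 1) {δ : ℝ}
    (hδ : 0 < δ) : ∃ q : stdSimplex ℝ A, (∀ a, 0 < q.1 a) ∧
      ∑ a, p a * -Real.logb 2 (q.1 a) ≤ entropy p + δ := by
  -- Adding ε to each mass and renormalising raises the cross entropy by at most this quantity above
  -- the entropy.
  have hc : Tendsto (fun ε : ℝ => Real.logb 2 (1 + ε * Fintype.card A)) (𝓝[>] 0) (𝓝 0) := by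
    have : Tendsto (fun ε : ℝ => Real.logb 2 (1 + ε * Fintype.card A)) (𝓝 0)
        (𝓝 (Real.logb 2 (1 + 0 * Fintype.card A))) := by
      refine Tendsto.logb ?_ (by simp)
      exact tendsto_const_nhds.add (tendsto_id.mul_const _)
    simp only [zero_mul, add_zero, Real.logb_one] at this
    exact this.mono_left nhdsWithin_le_nhds
  obtain ⟨ε, hε1, hε0⟩ := ((hc.eventually_le_const hδ).and self_mem_nhdsWithin).exists
  have hε0 : 0 < ε := hε0
  set D : ℝ := 1 + ε * Fintype.card A with hD
  have hDpos : 0 < D := by positivity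
  have hqpos : ∀ a, 0 < (p a + ε) / D := fun a =>
    div_pos (add_pos_of_nonneg_of_pos (hp0 a) hε0) hDpos
  refine ⟨⟨fun a => (p a + ε) / D, fun a => (hqpos a).le, ?_⟩, hqpos, ?_⟩
  · rw [← Finset.sum_div, Finset.sum_add_distrib, hp1]
    simp only [Finset.sum_const, Finset.card_univ, nsmul_eq_mul]
    rw [mul_comm, ← hD, div_self hDpos.ne']
  · have h1 : ∀ a, p a * -Real.logb 2 ((p a + ε) / D) ≤
        -(p a * Real.logb 2 (p a)) + p a * Real.logb 2 D := by
      intro a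
      rcases (hp0 a).eq_or_lt with h | h
      · simp [← h]
      · rw [Real.logb_div (by positivity) hDpos.ne']
        have := Real.logb_le_logb_of_le (b := 2) (by norm_num) h (by linarith : p a ≤ p a + ε)
        nlinarith
    refine (Finset.sum_le_sum fun a _ => h1 a).trans ?_
    rw [Finset.sum_add_distrib, ← Finset.sum_mul, hp1, Finset.sum_neg_distrib, entropy]
    linarith

end Smoothing

/-! ### Finite-state log loss. -/

section FSModels

variable {A : Type*} [Fintype A]

namespace FSModel

variable {m : ℕ}

/-- The probability assigned to a word that is read from the state `s`. -/
def wordProb (q : FSModel m A) : Fin m → List A → ℝ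
  | _, [] => 1
  | s, a :: w => (q.prob s).1 a * q.wordProb (q.next s a) w

theorem wordProb_nonneg (q : FSModel m A) (s : Fin m) (w : List A) : 0 ≤ q.wordProb s w := by
  induction w generalizing s with
  | nil => exact zero_le_one
  | cons a w ih => exact mul_nonneg ((q.prob s).2.1 a) (ih _)

theorem sum_wordProb (q : FSModel m A) (s : Fin m) (k : ℕ) :
    ∑ w : Fin k → A, q.wordProb s (List.ofFn w) = 1 := by
  induction k generalizing s with
  | zero => simp [wordProb]
  | succ k ih =>
    rw [← (Fin.consEquiv fun _ => A).sum_comp, Fintype.sum_prod_type]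
    simp only [Fin.consEquiv_apply, List.ofFn_succ, Fin.cons_zero, Fin.cons_succ, wordProb,
      ← Finset.mul_sum, ih, mul_one]
    exact (q.prob s).2.2

theorem prod_assigned (q : FSModel m A) (x : ℕ → A) (i k : ℕ) :
    ∏ j ∈ Finset.range k, q.assigned x (i + j) =
      q.wordProb (q.state x i) (List.ofFn fun j : Fin k => x (i + j)) := by
  induction k generalizing i with
  | zero => simp [wordProb]
  | succ k ih =>
    rw [Finset.prod_range_succ', mul_comm, List.ofFn_succ]
    have := ih (i + 1)
    simp only [add_assoc, add_comm 1] at this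
    rw [this]
    simp only [wordProb, assigned, Fin.val_zero, add_zero, Fin.val_succ]
    rfl

theorem assigned_nonneg (q : FSModel m A) (x : ℕ → A) (t : ℕ) : 0 ≤ q.assigned x t :=
  (q.prob _).2.1 _

theorem assigned_le_one (q : FSModel m A) (x : ℕ → A) (t : ℕ) : q.assigned x t ≤ 1 := by
  rw [assigned, ← (q.prob (q.state x t)).2.2]
  exact Finset.single_le_sum (fun b _ => (q.prob (q.state x t)).2.1 b) (Finset.mem_univ _)

theorem loss_nonneg (q : FSModel m A) (x : ℕ → A) (t : ℕ) :
    0 ≤ -Real.logb 2 (q.assigned x t) :=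
  neg_nonneg.2 (Real.logb_nonpos (by norm_num) (q.assigned_nonneg x t) (q.assigned_le_one x t))

end FSModel

theorem bddBelow_fsLoss (M : ℕ) (x : ℕ → A) (n : ℕ) :
    BddBelow {r : ℝ | ∃ m ≤ M, ∃ q : FSModel m A, (∀ t < n, 0 < q.assigned x t) ∧
      r = (∑ t ∈ Finset.range n, -Real.logb 2 (q.assigned x t)) / n} := by
  refine ⟨0, ?_⟩
  rintro r ⟨m, -, q, -, rfl⟩
  exact div_nonneg (Finset.sum_nonneg fun t _ => q.loss_nonneg x t) (Nat.cast_nonneg n)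

/-- The assignment with a single state. -/
def FSModel.single (q : stdSimplex ℝ A) : FSModel 1 A := ⟨0, fun _ _ => 0, fun _ => q⟩

theorem exists_nat_div_le (C : ℝ) {δ : ℝ} (hδ : 0 < δ) : ∃ k : ℕ, 0 < k ∧ C / k ≤ δ := by
  obtain ⟨k, hk⟩ := exists_nat_gt (|C| / δ)
  have hk0 : (0 : ℝ) < k := lt_of_le_of_lt (by positivity) hk
  refine ⟨k, by exact_mod_cast hk0, ?_⟩
  rw [div_lt_iff₀ hδ] at hk
  rw [div_le_iff₀ hk0]
  linarith [le_abs_self C]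

theorem limsup_mem_Icc {u : ℕ → ℝ} {a b : ℝ} (ha : ∀ᶠ n in atTop, a ≤ u n)
    (hb : ∀ᶠ n in atTop, u n ≤ b) : limsup u atTop ∈ Set.Icc a b := by
  have h1 : IsBoundedUnder (· ≤ ·) atTop u := ⟨b, hb⟩
  have h2 : IsBoundedUnder (· ≥ ·) atTop u := ⟨a, ha⟩
  exact ⟨le_limsup_of_frequently_le ha.frequently h1,
    limsup_le_of_le h2.isCoboundedUnder_le hb⟩

variable [DecidableEq A] {p : A → ℝ} (hp0 : ∀ a, 0 ≤ p a) (hp1 : ∑ a, p a = 1)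
include hp0 hp1

/-- One state already attains the limit, by smoothing `p`; any fixed number of states gains nothing
asymptotically. -/
theorem HasIIDFrequencies.tendsto_fsLogLossAt {x : ℕ → A} (hx : HasIIDFrequencies p x) {M : ℕ}
    (hM : 0 < M) : Tendsto (fun n => fsLogLossAt M x n) atTop (𝓝 (entropy p)) := by
  have hM' : (0 : ℝ) < M := by exact_mod_cast hM
  -- Nonemptiness is recorded along with the bound, since the infimum of the empty set is zero and
  -- would spoil the lower bound.
  have hup : ∀ δ > 0, ∀ᶠ n in atTop, fsLogLossAt M x n ≤ entropy p + δ ∧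
      {r : ℝ | ∃ m ≤ M, ∃ q : FSModel m A, (∀ t < n, 0 < q.assigned x t) ∧
        r = (∑ t ∈ Finset.range n, -Real.logb 2 (q.assigned x t)) / n}.Nonempty := by
    intro δ hδ
    obtain ⟨q, hq0, hq⟩ := exists_pos_crossEntropy_le hp0 hp1 (half_pos hδ)
    have h1 := (hx.tendsto_average fun a => -Real.logb 2 (q.1 a)).eventually_le_const
      (show ∑ a, p a * -Real.logb 2 (q.1 a) < entropy p + δ by linarith)
    filter_upwards [h1] with n hn
    have hmem : (∑ t ∈ Finset.range n, -Real.logb 2 (q.1 (x t))) / n ∈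
        {r : ℝ | ∃ m ≤ M, ∃ q : FSModel m A, (∀ t < n, 0 < q.assigned x t) ∧
        r = (∑ t ∈ Finset.range n, -Real.logb 2 (q.assigned x t)) / n} :=
      ⟨1, hM, FSModel.single q, fun t _ => hq0 _, rfl⟩
    exact ⟨(csInf_le (bddBelow_fsLoss M x n) hmem).trans hn, ⟨_, hmem⟩⟩
  have hlow : ∀ δ > 0, ∀ᶠ n in atTop, entropy p - δ ≤ fsLogLossAt M x n := by
    intro δ hδ
    obtain ⟨k, hk, hkδ⟩ := exists_nat_div_le (Real.logb 2 M) (half_pos hδ)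
    filter_upwards [hup δ hδ, hx.eventually_le_average hp0 hp1 hk hM' (half_pos hδ)]
      with n hn1 hn2
    refine le_csInf hn1.2 ?_
    rintro r ⟨m, hm, q, hq, rfl⟩
    have hm' : (m : ℝ) ≤ M := by exact_mod_cast hm
    -- The state at the start of a window is unknown, so the weight adds the word probabilities over
    -- all states; its total mass is the number of states.
    have := hn2 (fun t => -Real.logb 2 (q.assigned x t))
      (fun w => ∑ s, q.wordProb s (List.ofFn w)) (fun t => q.loss_nonneg x t)
      (fun w => Finset.sum_nonneg fun s _ => q.wordProb_nonneg s _)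
      (by rw [Finset.sum_comm]; simp only [q.sum_wordProb]; simpa using hm')
      (fun i hi => by
        have hpos : ∀ j ∈ Finset.range k, 0 < q.assigned x (i + j) := fun j hj =>
          hq _ (by have := Finset.mem_range.1 hj; omega)
        rw [Finset.sum_neg_distrib, neg_neg, ← Real.logb_prod _ _ fun j hj => (hpos j hj).ne',
          Real.rpow_logb (by norm_num) (by norm_num) (Finset.prod_pos hpos), q.prod_assigned]
        exact Finset.single_le_sum (f := fun s => q.wordProb s (List.ofFn fun j : Fin k => x (i + j)))
          (fun s _ => q.wordProb_nonneg s _) (Finset.mem_univ (q.state x i)))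
    linarith
  refine tendsto_order.2 ⟨fun a ha => ?_, fun a ha => ?_⟩
  · filter_upwards [hlow ((entropy p - a) / 2) (by linarith)] with n hn
    linarith
  · filter_upwards [hup ((a - entropy p) / 2) (by linarith)] with n hn
    linarith [hn.1]

theorem HasIIDFrequencies.fsLogLoss_eq {x : ℕ → A} (hx : HasIIDFrequencies p x) {M : ℕ}
    (hM : 0 < M) : fsLogLoss M x = entropy p :=
  (hx.tendsto_fsLogLossAt hp0 hp1 hM).limsup_eq

end FSModels

/-! ### A near-optimal block code. -/

section BlockCode

theorem ofFn_testBit_inj {h i j : ℕ} (hi : i < 2 ^ h) (hj : j < 2 ^ h)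
    (heq : (List.ofFn fun b : Fin h => i.testBit b) = List.ofFn fun b : Fin h => j.testBit b) :
    i = j := by
  rw [List.ofFn_inj] at heq
  refine Nat.eq_of_testBit_eq fun b => ?_
  by_cases hb : b < h
  · exact congrFun heq ⟨b, hb⟩
  · have h2 : 2 ^ h ≤ 2 ^ b := Nat.pow_le_pow_right (by norm_num) (by omega)
    rw [Nat.testBit_lt_two_pow (hi.trans_le h2), Nat.testBit_lt_two_pow (hj.trans_le h2)]

theorem exists_injOn_lt {α : Type*} (s : Finset α) :
    ∃ f : α → ℕ, Set.InjOn f s ∧ ∀ v ∈ s, f v < s.card := by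
  classical
  refine ⟨fun v => if h : v ∈ s then s.equivFin ⟨v, h⟩ else 0, ?_, ?_⟩
  · intro v hv w hw hvw
    have hv' : v ∈ s := hv
    have hw' : w ∈ s := hw
    simp only [hv', hw', dif_pos] at hvw
    simpa using s.equivFin.injective (Fin.ext hvw)
  · intro v hv
    simp [hv]

variable {A : Type*} [Fintype A]

/-- A header of `h` bits can hold any rounded length of a block of `l` symbols that cost at most `C`
each, while header and rounding together take at most δ bits per symbol. -/
theorem exists_block_length (C : ℝ) {δ : ℝ} (hδ : 0 < δ) :
    ∃ l h : ℕ, 0 < l ∧ l * C + 1 < (2 : ℝ) ^ h ∧ (h : ℝ) + 1 ≤ δ * l := by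
  have h1 : Tendsto (fun h : ℕ => ((h : ℝ) * (|C| / δ) + (|C| / δ + |C| + 1)) / 2 ^ h) atTop
      (𝓝 0) := by
    have h2 := (tendsto_pow_const_div_const_pow_of_one_lt 1 (r := (2 : ℝ)) (by norm_num)).mul_const
      (|C| / δ)
    have h3 := (tendsto_pow_const_div_const_pow_of_one_lt 0 (r := (2 : ℝ)) (by norm_num)).mul_const
      (|C| / δ + |C| + 1)
    have := h2.add h3
    simp only [zero_mul, add_zero] at this
    refine this.congr fun h => ?_
    simp only [pow_one, pow_zero]; ring
  obtain ⟨h, hh⟩ := (h1.eventually_lt_const (show (0 : ℝ) < 1 by norm_num)).exists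
  rw [div_lt_one (by positivity)] at hh
  have h4 : 0 < ((h : ℝ) + 1) / δ := by positivity
  refine ⟨⌈((h : ℝ) + 1) / δ⌉₊, h, Nat.ceil_pos.2 h4, ?_, ?_⟩
  · have h5 := (Nat.ceil_lt_add_one h4.le).le
    have h6 : (⌈((h : ℝ) + 1) / δ⌉₊ : ℝ) * C ≤ (((h : ℝ) + 1) / δ + 1) * |C| := by
      refine (mul_le_mul_of_nonneg_left (le_abs_self C) (Nat.cast_nonneg _)).trans ?_
      gcongr
    have h7 : (((h : ℝ) + 1) / δ + 1) * |C| = h * (|C| / δ) + (|C| / δ + |C|) := by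
      field_simp
      ring
    linarith
  · have := Nat.le_ceil (((h : ℝ) + 1) / δ)
    rw [div_le_iff₀ hδ] at this
    linarith

/-- A block code in which a codeword determines its length by a header, and whose lengths are close
to the ideal ones for the mass function `q`. -/
theorem exists_block_code (q : stdSimplex ℝ A) (hq : ∀ a, 0 < q.1 a) {δ : ℝ} (hδ : 0 < δ) :
    ∃ l : ℕ, 0 < l ∧ ∃ code : (Fin l → A) → List Bool,
      (∀ v w r r', code v ++ r = code w ++ r' → v = w) ∧
      ∀ v, ((code v).length : ℝ) ≤ ∑ j, -Real.logb 2 (q.1 (v j)) + δ * l := by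
  classical
  set g : A → ℝ := fun a => -Real.logb 2 (q.1 a) with hg
  have hg0 : ∀ a, 0 ≤ g a := fun a => neg_nonneg.2 (Real.logb_nonpos (by norm_num) (hq a).le (by
    rw [← q.2.2]
    exact Finset.single_le_sum (f := fun b => q.1 b) (fun b _ => (hq b).le) (Finset.mem_univ a)))
  obtain ⟨l, h, hl, hlh, hhl⟩ := exists_block_length (∑ a, g a) hδ
  set len : (Fin l → A) → ℕ := fun w => ⌈∑ j, g (w j)⌉₊ with hlen
  have hlen_lt : ∀ w, len w < 2 ^ h := by
    intro w
    have h1 : ∑ j, g (w j) ≤ l * ∑ a, g a := by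
      refine (Finset.sum_le_card_nsmul Finset.univ (fun j => g (w j)) (∑ a, g a) fun j _ =>
        Finset.single_le_sum (f := g) (fun b _ => hg0 b) (Finset.mem_univ (w j))).trans ?_
      simp
    have h2 := Nat.ceil_lt_add_one (Finset.sum_nonneg fun j (_ : j ∈ Finset.univ) => hg0 (w j))
    have h3 : (len w : ℝ) < (2 : ℝ) ^ h := by linarith
    exact_mod_cast h3
  -- A block with rounded ideal length `j` has probability at least 2^(-j), so there are at most 2^j
  -- of them and `j` bits suffice for an index.
  have hcard : ∀ j : ℕ, (Finset.univ.filter fun w => len w = j).card ≤ 2 ^ j := by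
    intro j
    have h1 : ∀ w ∈ Finset.univ.filter (fun w => len w = j),
        ((2 : ℝ) ^ j)⁻¹ ≤ ∏ i, q.1 (w i) := by
      intro w hw
      have hwj : len w = j := (Finset.mem_filter.1 hw).2
      have h2 : ∑ i, g (w i) ≤ (j : ℝ) := by rw [← hwj]; exact Nat.le_ceil _
      have h3 : ∏ i, q.1 (w i) = (2 : ℝ) ^ (-∑ i, g (w i)) := by
        simp only [hg]
        rw [Finset.sum_neg_distrib, neg_neg, ← Real.logb_prod _ _ fun i _ => (hq (w i)).ne',
          Real.rpow_logb (by norm_num) (by norm_num) (Finset.prod_pos fun i _ => hq (w i))]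
      rw [h3, ← Real.rpow_natCast, ← Real.rpow_neg (by norm_num)]
      exact Real.rpow_le_rpow_of_exponent_le (by norm_num) (neg_le_neg h2)
    have h4 := Finset.card_nsmul_le_sum _ _ _ h1
    have h5 : ∑ w ∈ Finset.univ.filter (fun w => len w = j), ∏ i, q.1 (w i) ≤ 1 := by
      refine (Finset.sum_le_sum_of_subset_of_nonneg (Finset.filter_subset _ Finset.univ)
        fun w _ _ => Finset.prod_nonneg fun i _ => (hq (w i)).le).trans ?_
      rw [← Fintype.sum_pow, show ∑ a, q.1 a = 1 from q.2.2, one_pow]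
    have h6 := h4.trans h5
    rw [nsmul_eq_mul, ← div_eq_mul_inv, div_le_one (by positivity)] at h6
    exact_mod_cast h6
  choose f hf1 hf2 using fun j : ℕ => exists_injOn_lt (Finset.univ.filter fun w => len w = j)
  -- The codeword is the length in `h` bits, followed by the index among the blocks of that length.
  refine ⟨l, hl, fun w => (List.ofFn fun b : Fin h => (len w).testBit b) ++
    List.ofFn fun b : Fin (len w) => (f (len w) w).testBit b, ?_, ?_⟩
  · intro v w r r' hvw
    rw [List.append_assoc, List.append_assoc] at hvw
    obtain ⟨h1, h2⟩ := List.append_inj hvw (by simp)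
    have h3 := ofFn_testBit_inj (hlen_lt v) (hlen_lt w) h1
    obtain ⟨h4, -⟩ := List.append_inj h2 (by simp [h3])
    have hv : v ∈ Finset.univ.filter fun w' => len w' = len w := by simp [h3]
    have hw : w ∈ Finset.univ.filter fun w' => len w' = len w := by simp
    rw [h3] at h4
    exact hf1 _ hv hw (ofFn_testBit_inj ((hf2 _ v hv).trans_le (hcard _))
      ((hf2 _ w hw).trans_le (hcard _)) h4)
  · intro w
    have h2 := Nat.ceil_lt_add_one (Finset.sum_nonneg fun j (_ : j ∈ Finset.univ) => hg0 (w j))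
    simp only [List.length_append, List.length_ofFn, Nat.cast_add]
    have h3 : (len w : ℝ) < ∑ j, g (w j) + 1 := h2
    simp only [hg] at h3
    linarith

end BlockCode

/-! ### Finite-state realisation of a block code. -/

section BlockEncoder

variable {A : Type*}

/-- An encoder that buffers blocks of length `l` and outputs the codeword of each complete block. -/
structure IsBlockEncoder {m : ℕ} (E : FSEncoder m A) (buf : Fin m → List A) (l : ℕ)
    (code : List A → List Bool) : Prop where
  buf_start : buf E.start = []
  buf_next : ∀ i a, buf (E.next i a) = if (buf i).length + 1 = l then [] else buf i ++ [a]
  out_eq : ∀ i a, E.out i a = if (buf i).length + 1 = l then code (buf i ++ [a]) else []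

theorem exists_blockEncoder [Finite A] {l : ℕ} (hl : 0 < l) (code : List A → List Bool) :
    ∃ (m : ℕ) (E : FSEncoder m A) (buf : Fin m → List A), IsBlockEncoder E buf l code := by
  have : Finite {v : List A // v.length < l} := (List.finite_length_lt A l).to_subtype
  let e := Finite.equivFin {v : List A // v.length < l}
  have hnext : ∀ (v : {v : List A // v.length < l}) (a : A),
      (if v.1.length + 1 = l then [] else v.1 ++ [a]).length < l := by
    intro v a
    have := v.2
    split_ifs
    · exact hl
    · simp; omega
  -- The states are the words shorter than `l`, that is, the possible buffer contents.
  refine ⟨_, ⟨e ⟨[], hl⟩, fun i a => e ⟨_, hnext (e.symm i) a⟩,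
    fun i a => if (e.symm i).1.length + 1 = l then code ((e.symm i).1 ++ [a]) else []⟩,
    fun i => (e.symm i).1, by simp, by simp, fun i a => rfl⟩

namespace IsBlockEncoder

variable {m : ℕ} {E : FSEncoder m A} {buf : Fin m → List A} {l : ℕ} {code : List A → List Bool}

/-- Two initial states with buffers of equal length are allowed so that the induction survives
inside a block, where nothing is output. A buffered symbol is recovered from a later codeword or, if
its block stays incomplete, from the final state. -/
theorem eq_of_output_eq (h : IsBlockEncoder E buf l code)
    (hcode : ∀ v w r r', v.length = l → w.length = l → code v ++ r = code w ++ r' → v = w)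
    (v w : List A) (i j : Fin m) (hvw : v.length = w.length)
    (hij : (buf i).length = (buf j).length) (ho : E.output i v = E.output j w)
    (hr : E.run i v = E.run j w) : buf i = buf j ∧ v = w := by
  induction v generalizing w i j with
  | nil =>
    obtain rfl : w = [] := List.length_eq_zero_iff.1 (by simpa using hvw.symm)
    simp only [FSEncoder.run, List.foldl_nil] at hr
    exact ⟨by rw [hr], rfl⟩
  | cons a v ih =>
    rcases w with _ | ⟨b, w⟩
    · simp at hvw
    simp only [List.length_cons, Nat.add_right_cancel_iff] at hvw
    simp only [FSEncoder.output, h.out_eq, ← hij] at ho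
    simp only [FSEncoder.run, List.foldl_cons] at hr
    have hlen : (buf (E.next i a)).length = (buf (E.next j b)).length := by
      rw [h.buf_next, h.buf_next, ← hij]; split_ifs <;> simp [hij]
    split_ifs at ho with hl
    · have h1 := hcode _ _ _ _ (by simpa using hl) (by simpa [← hij] using hl) ho
      rw [h1] at ho
      obtain ⟨-, h2⟩ := ih w _ _ hvw hlen (List.append_cancel_left ho) hr
      obtain ⟨h3, h4⟩ := List.append_inj h1 hij
      exact ⟨h3, by rw [h2, List.singleton_inj.1 h4]⟩
    · obtain ⟨h1, h2⟩ := ih w _ _ hvw hlen (by simpa using ho) hr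
      rw [h.buf_next, h.buf_next, ← hij, if_neg hl, if_neg hl] at h1
      obtain ⟨h3, h4⟩ := List.append_inj h1 hij
      exact ⟨h3, by rw [h2, List.singleton_inj.1 h4]⟩

theorem informationLossless (h : IsBlockEncoder E buf l code)
    (hcode : ∀ v w r r', v.length = l → w.length = l → code v ++ r = code w ++ r' → v = w) :
    E.InformationLossless := fun z v w hvw ho hr =>
  (h.eq_of_output_eq hcode v w z z hvw rfl ho hr).2

/-- Buffered symbols are charged in advance; the block left incomplete at the end outputs nothing
and costs nothing. -/
theorem length_output_le (h : IsBlockEncoder E buf l code) {g : A → ℝ} (hg : ∀ a, 0 ≤ g a)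
    {δ : ℝ} (hδ : 0 ≤ δ)
    (hlen : ∀ v, v.length = l → ((code v).length : ℝ) ≤ (v.map g).sum + δ * l) (v : List A)
    (i : Fin m) : ((E.output i v).length : ℝ) ≤
      ((buf i ++ v).map g).sum + δ * (buf i ++ v).length := by
  induction v generalizing i with
  | nil =>
    have h1 : 0 ≤ ((buf i ++ []).map g).sum := List.sum_nonneg fun x hx => by
      obtain ⟨a, -, rfl⟩ := List.mem_map.1 hx; exact hg a
    simp only [FSEncoder.output, List.length_nil, Nat.cast_zero]
    positivity
  | cons a v ih =>
    have h1 := ih (E.next i a)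
    simp only [FSEncoder.output, List.length_append, Nat.cast_add, h.out_eq]
    rw [h.buf_next] at h1
    split_ifs at h1 ⊢ with hl
    · have h2 := hlen (buf i ++ [a]) (by simpa using hl)
      have hl' : ((buf i).length : ℝ) + 1 = l := by exact_mod_cast hl
      simp only [List.map_append, List.map_cons, List.map_nil, List.sum_append, List.sum_cons,
        List.sum_nil, List.length_cons, List.nil_append, Nat.cast_add, Nat.cast_one] at h1 h2 ⊢
      rw [← hl'] at h2
      linarith
    · simp only [List.append_assoc, List.singleton_append, List.length_append] at h1
      simpa using h1

end IsBlockEncoder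

end BlockEncoder

/-! ### A Kraft-type bound for information lossless encoders. -/

section EncoderBound

theorem card_filter_length_eq_le (s : Finset (List Bool)) (j : ℕ) :
    (s.filter fun v => v.length = j).card ≤ 2 ^ j := by
  have h : Fintype.card (Fin j → Bool) = 2 ^ j := by simp
  rw [← h, ← Finset.card_univ]
  refine Finset.card_le_card_of_injOn (fun v (i : Fin j) => v.getD i false) (fun _ _ => by simp) ?_
  intro v hv w hw hvw
  simp only [Finset.coe_filter, Set.mem_ofPred_eq] at hv hw
  refine List.ext_getElem (by omega) fun i h1 h2 => ?_
  have := congrFun hvw ⟨i, by omega⟩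
  simpa [h1, h2] using this

/-- Distinct binary words cannot all be short. -/
theorem sum_two_pow_neg_length_le (s : Finset (List Bool)) {T : ℕ} (hs : s.card ≤ 2 ^ T) :
    ∑ v ∈ s, (2 : ℝ) ^ (-(v.length : ℝ)) ≤ T + 1 := by
  -- Each length below `T` contributes at most one, and the at most 2^T longer words contribute at
  -- most one together. No prefix property is available, hence `T + 1` in place of one.
  rw [← Finset.sum_filter_add_sum_filter_not s fun v => v.length < T]
  have hpow : ∀ n : ℕ, (2 : ℝ) ^ (-(n : ℝ)) = ((2 : ℝ) ^ n)⁻¹ := fun n => by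
    rw [Real.rpow_neg (by norm_num), Real.rpow_natCast]
  refine add_le_add ?_ ?_
  · rw [← Finset.sum_fiberwise_of_maps_to (s := s.filter fun v => v.length < T)
      (t := Finset.range T) (g := List.length) (by simp)]
    refine (Finset.sum_le_card_nsmul (Finset.range T) _ 1 fun j _ => ?_).trans (by simp)
    have h1 : ∀ v ∈ (s.filter fun v => v.length < T).filter fun v => v.length = j,
        (2 : ℝ) ^ (-(v.length : ℝ)) ≤ ((2 : ℝ) ^ j)⁻¹ := by
      intro v hv
      rw [hpow, (Finset.mem_filter.1 hv).2]
    refine (Finset.sum_le_card_nsmul _ _ _ h1).trans ?_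
    rw [nsmul_eq_mul, ← div_eq_mul_inv, div_le_one (by positivity)]
    exact_mod_cast card_filter_length_eq_le _ j
  · have h1 : ∀ v ∈ s.filter fun v => ¬ v.length < T,
        (2 : ℝ) ^ (-(v.length : ℝ)) ≤ ((2 : ℝ) ^ T)⁻¹ := by
      intro v hv
      rw [hpow]
      have := not_lt.1 (Finset.mem_filter.1 hv).2
      gcongr
      norm_num
    refine (Finset.sum_le_card_nsmul _ _ _ h1).trans ?_
    rw [nsmul_eq_mul, ← div_eq_mul_inv, div_le_one (by positivity)]
    exact_mod_cast (Finset.card_filter_le _ _).trans hs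

namespace FSEncoder

variable {A : Type*} {m : ℕ}

theorem output_append (E : FSEncoder m A) (z : Fin m) (v w : List A) :
    E.output z (v ++ w) = E.output z v ++ E.output (E.run z v) w := by
  induction v generalizing z with
  | nil => rfl
  | cons a v ih => simp [output, run, ih]

/-- The state after the first `t` symbols. -/
def stateAt (E : FSEncoder m A) (x : ℕ → A) (t : ℕ) : Fin m :=
  E.run E.start ((List.range t).map x)

theorem length_output_window (E : FSEncoder m A) (x : ℕ → A) (i k : ℕ) :
    (E.output (E.stateAt x i) (List.ofFn fun j : Fin k => x (i + j))).length =
      ∑ j ∈ Finset.range k, (E.out (E.stateAt x (i + j)) (x (i + j))).length ∧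
    E.run (E.stateAt x i) (List.ofFn fun j : Fin k => x (i + j)) = E.stateAt x (i + k) := by
  induction k with
  | zero => simp [output, run]
  | succ k ih =>
    have h1 : (List.ofFn fun j : Fin (k + 1) => x (i + j)) =
        (List.ofFn fun j : Fin k => x (i + j)) ++ [x (i + k)] := by
      rw [List.ofFn_succ_last]; simp
    rw [h1, output_append, ih.2, List.length_append, ih.1, Finset.sum_range_succ]
    refine ⟨by simp [output], ?_⟩
    have h2 := ih.2
    simp only [run] at h2
    rw [run, List.foldl_append, h2]
    simp only [stateAt, run, ← add_assoc, List.range_succ, List.map_append, List.foldl_append]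
    rfl

theorem length_output (E : FSEncoder m A) (x : ℕ → A) (n : ℕ) :
    (E.output E.start ((List.range n).map x)).length =
      ∑ t ∈ Finset.range n, (E.out (E.stateAt x t) (x t)).length := by
  have h := (E.length_output_window x 0 n).1
  have h1 : (List.ofFn fun j : Fin n => x (0 + j)) = (List.range n).map x := by
    apply List.ext_getElem <;> simp
  rw [h1] at h
  simpa [stateAt, run] using h

variable [Fintype A]

/-- For fixed initial and final states the outputs of words of length `k` are distinct, and there
are at most |A|^k ≤ 2^(|A| k) of them. Summing over the pairs of states leaves a bound linear in
`k`, whose logarithm is o(k). -/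
theorem InformationLossless.sum_output_le {E : FSEncoder m A} (hE : E.InformationLossless)
    (k : ℕ) :
    ∑ w : Fin k → A, ∑ z, (2 : ℝ) ^ (-((E.output z (List.ofFn w)).length : ℝ)) ≤
      m * (m * ((Fintype.card A * k : ℕ) + 1)) := by
  classical
  rw [Finset.sum_comm]
  have h1 : ∀ z z' : Fin m, ∑ w ∈ Finset.univ.filter
      (fun w : Fin k → A => E.run z (List.ofFn w) = z'),
      (2 : ℝ) ^ (-((E.output z (List.ofFn w)).length : ℝ)) ≤ (Fintype.card A * k : ℕ) + 1 := by
    intro z z'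
    have hinj : Set.InjOn (fun w : Fin k → A => E.output z (List.ofFn w))
        (Finset.univ.filter fun w : Fin k → A => E.run z (List.ofFn w) = z') := by
      intro v hv w hw hvw
      simp only [Finset.coe_filter, Finset.mem_univ, true_and, Set.mem_ofPred_eq] at hv hw
      exact List.ofFn_injective (hE z _ _ (by simp) hvw (hv.trans hw.symm))
    rw [← Finset.sum_image (f := fun v : List Bool => (2 : ℝ) ^ (-(v.length : ℝ))) hinj]
    refine sum_two_pow_neg_length_le _ (Finset.card_image_le.trans
      ((Finset.card_filter_le _ _).trans ?_))
    rw [Finset.card_univ, Fintype.card_fun, Fintype.card_fin, pow_mul]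
    exact Nat.pow_le_pow_left Nat.lt_two_pow_self.le k
  have h2 : ∀ z : Fin m, ∑ w : Fin k → A,
      (2 : ℝ) ^ (-((E.output z (List.ofFn w)).length : ℝ)) ≤
        m * ((Fintype.card A * k : ℕ) + 1) := by
    intro z
    rw [← Finset.sum_fiberwise Finset.univ fun w : Fin k → A => E.run z (List.ofFn w)]
    refine (Finset.sum_le_card_nsmul _ _ _ fun z' _ => h1 z z').trans (le_of_eq ?_)
    rw [Finset.card_univ, Fintype.card_fin, nsmul_eq_mul]
  refine (Finset.sum_le_card_nsmul _ _ _ fun z _ => h2 z).trans (le_of_eq ?_)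
  rw [Finset.card_univ, Fintype.card_fin, nsmul_eq_mul]

end FSEncoder

end EncoderBound

/-! ### Finite-state compressibility. -/

section Compression

variable {A : Type*} [Fintype A]

theorem sum_map_range (f : ℕ → ℝ) (n : ℕ) :
    ((List.range n).map f).sum = ∑ t ∈ Finset.range n, f t := by
  induction n with
  | zero => simp
  | succ n ih => simp [List.range_succ, Finset.sum_range_succ, ih]

theorem bddBelow_ratio (s : ℕ) (x : ℕ → A) (n : ℕ) :
    BddBelow {r : ℝ | ∃ m ≤ s, ∃ E : FSEncoder m A, E.InformationLossless ∧
      r = ((E.output E.start ((List.range n).map x)).length : ℝ) /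
        (n * Real.logb 2 (Fintype.card A))} := by
  refine ⟨0, ?_⟩
  rintro r ⟨m, -, E, -, rfl⟩
  refine div_nonneg (Nat.cast_nonneg _) (mul_nonneg (Nat.cast_nonneg n) ?_)
  rcases Nat.eq_zero_or_pos (Fintype.card A) with h | h
  · simp [h]
  · exact Real.logb_nonneg (by norm_num) (by exact_mod_cast h)

theorem tendsto_log_affine_div (a b c : ℝ) (ha : 0 < a) (hb : 0 < b) (hc : 0 < c) :
    Tendsto (fun k : ℕ => Real.logb 2 (a * (b * k + c)) / k) atTop (𝓝 0) := by
  have h1 : Tendsto (fun t : ℝ => Real.log t / t) atTop (𝓝 0) := by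
    simpa using Real.isLittleO_log_id_atTop.tendsto_div_nhds_zero
  have h2 : Tendsto (fun k : ℕ => a * (b * (k : ℝ) + c)) atTop atTop :=
    ((tendsto_natCast_atTop_atTop.const_mul_atTop hb).atTop_add tendsto_const_nhds).const_mul_atTop ha
  have h3 := h1.comp h2
  have h4 : Tendsto (fun k : ℕ => a * b + a * c / (k : ℝ)) atTop (𝓝 (a * b + 0)) :=
    tendsto_const_nhds.add (tendsto_const_div_atTop_nhds_zero_nat _)
  have h5 := (h3.mul h4).div_const (Real.log 2)
  rw [zero_mul, zero_div] at h5
  refine h5.congr' ?_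
  filter_upwards [eventually_gt_atTop 0] with k hk
  have hk' : (0 : ℝ) < k := by exact_mod_cast hk
  have h6 : 0 < b * (k : ℝ) + c := by positivity
  simp only [Function.comp_apply, Real.logb]
  field_simp

variable [DecidableEq A] {p : A → ℝ} (hp0 : ∀ a, 0 ≤ p a) (hp1 : ∑ a, p a = 1)
include hp0 hp1

/-- The block encoder fixes `s₀`. The existence of some lossless encoder is also recorded, because
the infimum defining the ratio is zero when there is none. -/
theorem HasIIDFrequencies.exists_forall_eventually_ratio_le {x : ℕ → A}
    (hx : HasIIDFrequencies p x) (hA : 1 < Fintype.card A) {δ : ℝ} (hδ : 0 < δ) :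
    ∃ s₀, ∀ s ≥ s₀, (∃ m ≤ s, ∃ E : FSEncoder m A, E.InformationLossless) ∧ ∀ᶠ n in atTop,
      Real.logb 2 (Fintype.card A) * fsCompressionRatio s x n ≤ entropy p + δ := by
  have hlg : 0 < Real.logb 2 (Fintype.card A) :=
    Real.logb_pos (by norm_num) (by exact_mod_cast hA)
  obtain ⟨q, hq0, hq⟩ := exists_pos_crossEntropy_le hp0 hp1 (δ := δ / 3) (by positivity)
  obtain ⟨l, hl, code, hc1, hc2⟩ := exists_block_code q hq0 (δ := δ / 3) (by positivity)
  set code' : List A → List Bool := fun v =>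
    if h : v.length = l then code fun i => v.get (i.cast h.symm) else [] with hcode'
  have hof : ∀ (v : List A) (h : v.length = l), v = List.ofFn fun i : Fin l => v.get (i.cast h.symm) := by
    intro v h
    apply List.ext_getElem <;> simp [h]
  have hc1' : ∀ v w r r', v.length = l → w.length = l → code' v ++ r = code' w ++ r' → v = w := by
    intro v w r r' hv hw hvw
    simp only [hcode', hv, hw, dif_pos] at hvw
    rw [hof v hv, hof w hw, hc1 _ _ _ _ hvw]
  have hc2' : ∀ v, v.length = l → ((code' v).length : ℝ) ≤
      (v.map fun a => -Real.logb 2 (q.1 a)).sum + δ / 3 * l := by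
    intro v hv
    simp only [hcode', hv, dif_pos]
    refine (hc2 _).trans (le_of_eq ?_)
    congr 1
    conv_rhs => rw [hof v hv]
    rw [List.map_ofFn, List.sum_ofFn]
    rfl
  obtain ⟨m, E, buf, hE⟩ := exists_blockEncoder hl code'
  have hIL := hE.informationLossless hc1'
  have hg0 : ∀ a, 0 ≤ -Real.logb 2 (q.1 a) := fun a =>
    neg_nonneg.2 (Real.logb_nonpos (by norm_num) (hq0 a).le (by
      rw [← q.2.2]
      exact Finset.single_le_sum (f := fun b => q.1 b) (fun b _ => (hq0 b).le)
        (Finset.mem_univ a)))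
  refine ⟨m, fun s hs => ⟨⟨m, hs, E, hIL⟩, ?_⟩⟩
  have h1 := (hx.tendsto_average fun a => -Real.logb 2 (q.1 a)).eventually_le_const
    (show ∑ a, p a * -Real.logb 2 (q.1 a) < entropy p + δ / 3 + δ / 3 by linarith)
  filter_upwards [h1, eventually_gt_atTop 0] with n hn hn0
  have hn' : (0 : ℝ) < n := by exact_mod_cast hn0
  have h2 := csInf_le (bddBelow_ratio s x n) ⟨m, hs, E, hIL, rfl⟩
  have h3 := hE.length_output_le hg0 (δ := δ / 3) (by positivity) hc2' ((List.range n).map x) E.start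
  rw [hE.buf_start, List.nil_append, List.map_map, List.length_map, List.length_range] at h3
  have h4 : ((List.range n).map ((fun a => -Real.logb 2 (q.1 a)) ∘ x)).sum =
      ∑ t ∈ Finset.range n, -Real.logb 2 (q.1 (x t)) := sum_map_range _ n
  rw [h4] at h3
  rw [div_le_iff₀ hn'] at hn
  calc Real.logb 2 (Fintype.card A) * fsCompressionRatio s x n
      ≤ Real.logb 2 (Fintype.card A) * (((E.output E.start ((List.range n).map x)).length : ℝ) /
        (n * Real.logb 2 (Fintype.card A))) := by gcongr; exact h2
    _ = ((E.output E.start ((List.range n).map x)).length : ℝ) / n := by field_simp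
    _ ≤ entropy p + δ := by rw [div_le_iff₀ hn']; linarith

/-- The Kraft-type bound with `K = s² (|A| k + 1)` enters the window inequality, for a `k` large
enough to make (log K)/k small. -/
theorem HasIIDFrequencies.eventually_le_ratio {x : ℕ → A}
    (hx : HasIIDFrequencies p x) (hA : 1 < Fintype.card A) {δ : ℝ} (hδ : 0 < δ) {s : ℕ}
    (hs : ∃ m ≤ s, ∃ E : FSEncoder m A, E.InformationLossless) :
    ∀ᶠ n in atTop, entropy p - δ ≤ Real.logb 2 (Fintype.card A) * fsCompressionRatio s x n := by
  have hlg : 0 < Real.logb 2 (Fintype.card A) :=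
    Real.logb_pos (by norm_num) (by exact_mod_cast hA)
  have hA' : (0 : ℝ) < Fintype.card A := by
    have : 0 < Fintype.card A := by omega
    exact_mod_cast this
  obtain ⟨m₀, hm₀, E₀, hE₀⟩ := hs
  have hs0 : (0 : ℝ) < s := by
    have : 0 < s := (Fin.pos E₀.start).trans_le hm₀
    exact_mod_cast this
  obtain ⟨k, hk, hk0⟩ := (((tendsto_log_affine_div (s * s : ℝ) (Fintype.card A) 1 (by positivity)
    hA' one_pos).eventually_le_const (half_pos hδ)).and (eventually_gt_atTop 0)).exists
  filter_upwards [hx.eventually_le_average hp0 hp1 hk0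
    (K := s * s * (Fintype.card A * k + 1)) (by positivity) (half_pos hδ), eventually_gt_atTop 0]
    with n hn hn0
  have hn' : (0 : ℝ) < n := by exact_mod_cast hn0
  rw [← div_le_iff₀' hlg]
  refine le_csInf ⟨_, m₀, hm₀, E₀, hE₀, rfl⟩ ?_
  rintro r ⟨m, hm, E, hE, rfl⟩
  rw [mul_comm (n : ℝ), ← div_div, div_right_comm, div_le_div_iff_of_pos_right hlg]
  have hms : (m : ℝ) ≤ s := by exact_mod_cast hm
  have h1 := hn (fun t => ((E.out (E.stateAt x t) (x t)).length : ℝ))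
    (fun w => ∑ z, (2 : ℝ) ^ (-((E.output z (List.ofFn w)).length : ℝ)))
    (fun t => Nat.cast_nonneg _) (fun w => Finset.sum_nonneg fun z _ => by positivity)
    ((hE.sum_output_le k).trans (by
      push_cast
      rw [← mul_assoc]
      gcongr))
    (fun i hi => by
      have h2 := (E.length_output_window x i k).1
      rw [← Nat.cast_sum, ← h2]
      exact Finset.single_le_sum (f := fun z =>
        (2 : ℝ) ^ (-((E.output z (List.ofFn fun j : Fin k => x (i + j))).length : ℝ)))
        (fun z _ => by positivity) (Finset.mem_univ (E.stateAt x i)))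
  rw [E.length_output, Nat.cast_sum]
  linarith

/-- The scaled finite-state compressibility. -/
theorem HasIIDFrequencies.tendsto_fsCompressibility {x : ℕ → A} (hx : HasIIDFrequencies p x)
    (hA : 1 < Fintype.card A) :
    Tendsto (fun s => Real.logb 2 (Fintype.card A) * fsCompressibility s x) atTop
      (𝓝 (entropy p)) := by
  have hlg : 0 < Real.logb 2 (Fintype.card A) :=
    Real.logb_pos (by norm_num) (by exact_mod_cast hA)
  refine Metric.tendsto_atTop.2 fun ε hε => ?_
  obtain ⟨s₀, hs₀⟩ := hx.exists_forall_eventually_ratio_le hp0 hp1 hA (half_pos hε)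
  refine ⟨s₀, fun s hs => ?_⟩
  obtain ⟨h1, h2⟩ := hs₀ s hs
  have h3 := hx.eventually_le_ratio hp0 hp1 hA (half_pos hε) h1
  have h4 := limsup_mem_Icc (u := fun n => fsCompressionRatio s x n)
    (h3.mono fun n hn => (div_le_iff₀' hlg).2 hn) (h2.mono fun n hn => (le_div_iff₀' hlg).2 hn)
  have h5 := (div_le_iff₀' hlg).1 h4.1
  have h6 := (le_div_iff₀' hlg).1 h4.2
  rw [Real.dist_eq, abs_lt]
  change Real.logb 2 (Fintype.card A) * fsCompressibility s x ≤ _ at h6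
  change _ ≤ Real.logb 2 (Fintype.card A) * fsCompressibility s x at h5
  constructor <;> linarith

end Compression

/-! ### Finite words as beginnings of sequences. -/

section Words

/-- Some infinite sequence that starts with the word `w`. -/
noncomputable def extendWord {A : Type*} [Nonempty A] {n : ℕ} (w : Fin n → A) (t : ℕ) : A :=
  if h : t < n then w ⟨t, h⟩ else Classical.arbitrary A

theorem extendWord_apply {A : Type*} [Nonempty A] {n : ℕ} (w : Fin n → A) (i : Fin n) :
    extendWord w i = w i := by
  simp [extendWord]

theorem eq_extendWord_iff {A : Type*} [Nonempty A] {n : ℕ} (x : ℕ → A) (w : Fin n → A) :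
    (∀ t < n, x t = extendWord w t) ↔ (fun i : Fin n => x i) = w := by
  rw [funext_iff]
  constructor
  · intro h i
    rw [h i i.2, extendWord_apply]
  · intro h t ht
    rw [extendWord, dif_pos ht, ← h ⟨t, ht⟩]

end Words

/-! ### Word probabilities and mean losses in the node coupling. -/

section TreeMeasure

variable {A : Type*} [DecidableEq A] [Fintype A] [MeasurableSpace A] [MeasurableSingletonClass A]
variable (prior : Measure (stdSimplex ℝ A)) [IsProbabilityMeasure prior]

/-- The joint law of the parameters and the symbols of all nodes. -/
noncomputable abbrev treeMeasure : Measure (List A → stdSimplex ℝ A × (ℕ → A)) :=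
  Measure.infinitePi fun _ : List A => nodeLaw prior

theorem coord_le_one (θ : stdSimplex ℝ A) (a : A) : θ.1 a ≤ 1 := by
  rw [← θ.2.2]
  exact Finset.single_le_sum (f := fun b => θ.1 b) (fun b _ => θ.2.1 b) (Finset.mem_univ a)

theorem measurable_coord (a : A) : Measurable fun θ : stdSimplex ℝ A => θ.1 a :=
  (measurable_pi_apply a).comp measurable_subtype_coe

/-- The total of a function of the parameter of the current node and of the symbol emitted there. -/
noncomputable def nodeSum (F : stdSimplex ℝ A × A → ℝ) (θ : List A → stdSimplex ℝ A) (x : ℕ → A)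
    (n : ℕ) : ℝ :=
  ∑ t ∈ Finset.range n, F (θ (node x t), x t)

/-- The probability of the first symbols given the parameters of all nodes. -/
noncomputable def nodeLik (θ : List A → stdSimplex ℝ A) (x : ℕ → A) (n : ℕ) : ℝ :=
  ∏ t ∈ Finset.range n, (θ (node x t)).1 (x t)

theorem nodeSum_congr (F : stdSimplex ℝ A × A → ℝ) (θ : List A → stdSimplex ℝ A) {x y : ℕ → A}
    {n : ℕ} (h : ∀ t < n, x t = y t) : nodeSum F θ x n = nodeSum F θ y n := by
  refine Finset.sum_congr rfl fun t ht => ?_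
  have ht := Finset.mem_range.1 ht
  rw [h t ht, node_congr fun s hs => h s (hs.trans ht)]

theorem abs_nodeSum_le {F : stdSimplex ℝ A × A → ℝ} {C : ℝ} (hb : ∀ p, |F p| ≤ C)
    (θ : List A → stdSimplex ℝ A) (x : ℕ → A) (n : ℕ) : |nodeSum F θ x n| ≤ n * C := by
  refine (Finset.abs_sum_le_sum_abs _ _).trans
    ((Finset.sum_le_card_nsmul _ _ C fun t _ => hb _).trans (le_of_eq ?_))
  rw [Finset.card_range, nsmul_eq_mul]

theorem nodeLik_mem_Icc (θ : List A → stdSimplex ℝ A) (x : ℕ → A) (n : ℕ) :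
    nodeLik θ x n ∈ Set.Icc (0 : ℝ) 1 :=
  ⟨Finset.prod_nonneg fun _ _ => (θ _).2.1 _,
    Finset.prod_le_one (fun _ _ => (θ _).2.1 _) fun _ _ => coord_le_one _ _⟩

theorem measurable_nodeSum {F : stdSimplex ℝ A × A → ℝ} (hF : Measurable F) (x : ℕ → A) (n : ℕ) :
    Measurable fun θ : List A → stdSimplex ℝ A => nodeSum F θ x n :=
  Finset.measurable_fun_sum _ fun t _ =>
    hF.comp ((measurable_pi_apply (node x t)).prodMk measurable_const)

theorem measurable_nodeLik (x : ℕ → A) (n : ℕ) :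
    Measurable fun θ : List A → stdSimplex ℝ A => nodeLik θ x n :=
  Finset.measurable_fun_prod _ fun t _ => (measurable_coord (x t)).comp (measurable_pi_apply _)

theorem measurable_params : Measurable fun (ω : List A → stdSimplex ℝ A × (ℕ → A)) i => (ω i).1 :=
  measurable_pi_lambda _ fun i => (measurable_pi_apply i).fst

theorem measurableSet_nodeSeq_cylinder (x : ℕ → A) (n : ℕ) :
    MeasurableSet {ω : List A → stdSimplex ℝ A × (ℕ → A) | ∀ t < n, nodeSeq ω t = x t} :=
  measurable_nodeSeq (measurableSet_cylinder x n)

theorem integral_cylinder (x : ℕ → A) (n : ℕ) {G : (List A → stdSimplex ℝ A) → ℝ}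
    (hG : Measurable G) (hG0 : ∀ θ, 0 ≤ G θ) :
    ∫ ω, (if ∀ t < n, nodeSeq ω t = x t then G fun i => (ω i).1 else 0) ∂treeMeasure prior =
      ∫ ω, nodeLik (fun i => (ω i).1) x n * G (fun i => (ω i).1) ∂treeMeasure prior := by
  have hm := hG.comp (measurable_params (A := A))
  rw [integral_eq_lintegral_of_nonneg_ae, integral_eq_lintegral_of_nonneg_ae]
  · congr 1
    have h := freshAddr_nodeAddr.lintegral_cylinder (prior := prior) x n hG.ennreal_ofReal
    refine Eq.trans (lintegral_congr fun ω => ?_) (h.trans (lintegral_congr fun ω => ?_))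
    · by_cases hω : ∀ t < n, nodeSeq ω t = x t
      · rw [if_pos hω, if_pos (show ∀ t < n, addrSeq nodeAddr ω t = x t from hω)]
      · rw [if_neg hω, if_neg (show ¬ ∀ t < n, addrSeq nodeAddr ω t = x t from hω),
          ENNReal.ofReal_zero]
    · rw [ENNReal.ofReal_mul (nodeLik_mem_Icc _ _ _).1, nodeLik,
        ENNReal.ofReal_prod_of_nonneg fun _ _ => (ω _).1.2.1 _]
      rfl
  · exact ae_of_all _ fun ω => mul_nonneg (nodeLik_mem_Icc _ _ _).1 (hG0 _)
  · exact (((measurable_nodeLik x n).comp measurable_params).mul hm).aestronglyMeasurable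
  · exact ae_of_all _ fun ω => by
      dsimp only
      split_ifs
      · exact hG0 _
      · exact le_rfl
  · exact (hm.ite (measurableSet_nodeSeq_cylinder x n) measurable_const).aestronglyMeasurable

/-- The probability of a word. -/
noncomputable def wordMass {n : ℕ} (w : Fin n → A) : ℝ :=
  (source prior).real {x | ∀ i : Fin n, x i = w i}

theorem wordMass_eq_integral_ite [Nonempty A] {n : ℕ} (w : Fin n → A) :
    wordMass prior w =
      ∫ ω, (if ∀ t < n, nodeSeq ω t = extendWord w t then 1 else 0) ∂treeMeasure prior := by
  have h1 : {x : ℕ → A | ∀ i : Fin n, x i = w i} = {x | ∀ t < n, x t = extendWord w t} := by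
    ext x
    simp only [Set.mem_ofPred_eq]
    rw [eq_extendWord_iff, funext_iff]
  rw [wordMass, h1, source_eq_map_nodeSeq, map_measureReal_apply measurable_nodeSeq
    (measurableSet_cylinder _ n), ← integral_indicator_one
    (measurable_nodeSeq (measurableSet_cylinder _ n))]
  refine integral_congr_ae (ae_of_all _ fun ω => ?_)
  simp [Set.indicator_apply]

theorem wordMass_eq [Nonempty A] {n : ℕ} (w : Fin n → A) :
    wordMass prior w = ∫ ω, nodeLik (fun i => (ω i).1) (extendWord w) n ∂treeMeasure prior := by
  rw [wordMass_eq_integral_ite]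
  have := integral_cylinder prior (extendWord w) n (G := fun _ => 1) measurable_const
    fun _ => zero_le_one
  simpa using this

theorem sum_ite_extendWord [Nonempty A] {n : ℕ} (x : ℕ → A) (g : (Fin n → A) → ℝ) :
    ∑ w, (if ∀ t < n, x t = extendWord w t then g w else 0) = g fun i => x i := by
  simp only [eq_extendWord_iff]
  simp

/-- Splitting by the first `n` symbols replaces the random path by a fixed one, so that
`integral_cylinder` applies to each term. -/
theorem integral_nodeSeq_eq_sum [Nonempty A] {n : ℕ}
    {g : (List A → stdSimplex ℝ A) → (ℕ → A) → ℝ} (hg : ∀ x, Measurable fun θ => g θ x) {C : ℝ}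
    (hC : ∀ θ x, |g θ x| ≤ C) (hloc : ∀ θ x y, (∀ t < n, x t = y t) → g θ x = g θ y) :
    ∫ ω, g (fun i => (ω i).1) (nodeSeq ω) ∂treeMeasure prior = ∑ w : Fin n → A, ∫ ω,
      (if ∀ t < n, nodeSeq ω t = extendWord w t then g (fun i => (ω i).1) (extendWord w) else 0)
        ∂treeMeasure prior := by
  rw [← integral_finsetSum]
  · refine integral_congr_ae (ae_of_all _ fun ω => ?_)
    dsimp only
    rw [sum_ite_extendWord (nodeSeq ω) fun w => g (fun i => (ω i).1) (extendWord w)]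
    refine hloc _ _ _ fun t ht => ?_
    exact (extendWord_apply (fun i : Fin n => nodeSeq ω i) ⟨t, ht⟩).symm
  · intro w _
    refine integrable_of_bounded (C := |C|) (((hg _).comp measurable_params).ite
      (measurableSet_nodeSeq_cylinder _ n) measurable_const) fun ω => ?_
    split_ifs
    · exact (hC _ _).trans (le_abs_self C)
    · simp

theorem wordMass_nonneg {n : ℕ} (w : Fin n → A) : 0 ≤ wordMass prior w := measureReal_nonneg

theorem sum_wordMass_mul [Nonempty A] {n : ℕ} (g : (Fin n → A) → ℝ) :
    ∑ w, wordMass prior w * g w = ∫ ω, g (fun i => nodeSeq ω i) ∂treeMeasure prior := by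
  have h := integral_nodeSeq_eq_sum prior (n := n) (g := fun _ x => g fun i => x i)
    (fun _ => measurable_const) (C := ∑ w, |g w|)
    (fun _ x => Finset.single_le_sum (f := fun w => |g w|) (fun w _ => abs_nonneg _)
      (Finset.mem_univ fun i : Fin n => x i))
    fun _ x y hxy => congrArg g (funext fun i => hxy i i.2)
  rw [h]
  refine Finset.sum_congr rfl fun w _ => ?_
  rw [wordMass_eq_integral_ite, ← integral_mul_const]
  refine integral_congr_ae (ae_of_all _ fun ω => ?_)
  simp only [extendWord_apply]
  split_ifs <;> simp

theorem sum_wordMass [Nonempty A] (n : ℕ) : ∑ w : Fin n → A, wordMass prior w = 1 := by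
  have := sum_wordMass_mul prior (n := n) fun _ => 1
  simpa using this

theorem blockEntropy_source (n : ℕ) :
    blockEntropy (source prior) n = entropy fun w : Fin n → A => wordMass prior w := rfl

theorem measurable_nodeSum_nodeSeq {F : stdSimplex ℝ A × A → ℝ} (hF : Measurable F) (n : ℕ) :
    Measurable fun ω : List A → stdSimplex ℝ A × (ℕ → A) =>
      nodeSum F (fun i => (ω i).1) (nodeSeq ω) n := by
  refine Finset.measurable_fun_sum _ fun t _ => hF.comp (Measurable.prodMk ?_
    ((measurable_pi_apply t).comp measurable_nodeSeq))
  let _ : MeasurableSpace (List A) := ⊤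
  have h1 : Measurable fun ω : List A → stdSimplex ℝ A × (ℕ → A) => node (nodeSeq ω) t :=
    measurable_to_countable' fun v =>
      measurable_nodeSeq (measurableSet_parse t fun s => s.cur = v)
  have h2 : Measurable fun p : (List A → stdSimplex ℝ A × (ℕ → A)) × List A => (p.1 p.2).1 :=
    measurable_from_prod_countable_left fun v => (measurable_pi_apply v).fst
  exact h2.comp (measurable_id.prodMk h1)

/-- Mean averages converge to the mean under one draw of a parameter and a symbol. -/
theorem tendsto_integral_nodeSum_div {F : stdSimplex ℝ A × A → ℝ} (hF : Measurable F) {C : ℝ}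
    (hb : ∀ p, |F p| ≤ C) :
    Tendsto (fun n : ℕ => (∫ ω, nodeSum F (fun i => (ω i).1) (nodeSeq ω) n ∂treeMeasure prior) / n)
      atTop (𝓝 (∫ p, F p ∂(prior ⊗ₘ symbolKernel))) := by
  have h1 := ae_tendsto_average prior (H := fun _ => F) (fun _ => hF) (fun _ => hb) (fun _ => rfl)
  have h2 : Tendsto (fun n : ℕ => ∫ ω, nodeSum F (fun i => (ω i).1) (nodeSeq ω) n / n
      ∂treeMeasure prior) atTop (𝓝 (∫ _, ∫ p, F p ∂(prior ⊗ₘ symbolKernel) ∂treeMeasure prior)) := by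
    refine tendsto_integral_of_dominated_convergence (fun _ => |C|)
      (fun n => ((measurable_nodeSum_nodeSeq hF n).div_const _).aestronglyMeasurable)
      (integrable_const _) (fun n => ae_of_all _ fun ω => ?_) ?_
    · rw [Real.norm_eq_abs, abs_div, Nat.abs_cast]
      refine div_le_of_le_mul₀ (Nat.cast_nonneg n) (abs_nonneg C) ?_
      refine (abs_nodeSum_le hb _ _ n).trans ?_
      rw [mul_comm]
      gcongr
      exact le_abs_self C
    · filter_upwards [h1] with ω hω
      have h3 := hω.add_const (∫ p, F p ∂(prior ⊗ₘ symbolKernel))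
      rw [zero_add] at h3
      refine h3.congr' ?_
      filter_upwards [eventually_gt_atTop 0] with n hn
      have hn' : (n : ℝ) ≠ 0 := by exact_mod_cast hn.ne'
      rw [Finset.sum_sub_distrib, Finset.sum_const, Finset.card_range, nsmul_eq_mul, nodeSum]
      field_simp
      ring
  simpa [integral_div] using h2

end TreeMeasure

/-! ### Bounds for the block entropy. -/

section EntropyRate

variable {A : Type*} [DecidableEq A] [Fintype A] [MeasurableSpace A] [MeasurableSingletonClass A]
variable (prior : Measure (stdSimplex ℝ A)) [IsProbabilityMeasure prior]

theorem neg_mul_logb_eq (t : ℝ) : -(t * Real.logb 2 t) = Real.negMulLog t / Real.log 2 := by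
  rw [Real.negMulLog, Real.logb]; ring

/-- Jensen's inequality for `-t log t`. -/
theorem integral_neg_mul_logb_le {Ω : Type*} [MeasurableSpace Ω] {μ : Measure Ω}
    [IsProbabilityMeasure μ] {f : Ω → ℝ} (hf : Measurable f) (h01 : ∀ ω, f ω ∈ Set.Icc (0 : ℝ) 1) :
    ∫ ω, -(f ω * Real.logb 2 (f ω)) ∂μ ≤ -((∫ ω, f ω ∂μ) * Real.logb 2 (∫ ω, f ω ∂μ)) := by
  simp only [neg_mul_logb_eq]
  rw [integral_div]
  refine div_le_div_of_nonneg_right ?_ (Real.log_nonneg (by norm_num))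
  obtain ⟨C, hC⟩ := isCompact_Icc.exists_bound_of_continuousOn
    (s := Set.Icc (0 : ℝ) 1) Real.continuous_negMulLog.continuousOn
  exact Real.concaveOn_negMulLog.le_map_integral Real.continuous_negMulLog.continuousOn isClosed_Ici
    (ae_of_all _ fun ω => (h01 ω).1)
    (integrable_of_bounded hf (C := 1) fun ω => by rw [abs_of_nonneg (h01 ω).1]; exact (h01 ω).2)
    (integrable_of_bounded (Real.continuous_negMulLog.measurable.comp hf) fun ω => hC _ (h01 ω))

/-- Minus the logarithm of the conditional likelihood is the sum of the ideal lengths, which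
dominate `F` wherever the mass is positive; if the likelihood vanishes, both sides do. -/
theorem nodeLik_mul_nodeSum_le {F : stdSimplex ℝ A × A → ℝ}
    (hF : ∀ θ a, 0 < θ.1 a → F (θ, a) ≤ -Real.logb 2 (θ.1 a)) (θ : List A → stdSimplex ℝ A)
    (x : ℕ → A) (n : ℕ) :
    nodeLik θ x n * nodeSum F θ x n ≤ -(nodeLik θ x n * Real.logb 2 (nodeLik θ x n)) := by
  rcases (nodeLik_mem_Icc θ x n).1.eq_or_lt with h | h
  · rw [← h]; simp
  · have hpos : ∀ t ∈ Finset.range n, 0 < (θ (node x t)).1 (x t) := fun t ht =>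
      ((θ (node x t)).2.1 (x t)).lt_of_ne' (Finset.prod_ne_zero_iff.1 h.ne' t ht)
    rw [← mul_neg]
    refine mul_le_mul_of_nonneg_left ?_ h.le
    rw [nodeLik, Real.logb_prod _ _ fun t ht => (hpos t ht).ne', ← Finset.sum_neg_distrib]
    exact Finset.sum_le_sum fun t ht => hF _ _ (hpos t ht)

/-- Conditioning reduces entropy: Jensen for -t log t, word by word, with the conditional likelihood
as the random variable. A bounded `F` stands in for the possibly unbounded ideal length. -/
theorem integral_nodeSum_le_blockEntropy {F : stdSimplex ℝ A × A → ℝ} (hFm : Measurable F) {C : ℝ}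
    (h0 : ∀ p, 0 ≤ F p) (hC : ∀ p, F p ≤ C)
    (hF : ∀ θ a, 0 < θ.1 a → F (θ, a) ≤ -Real.logb 2 (θ.1 a)) (n : ℕ) :
    ∫ ω, nodeSum F (fun i => (ω i).1) (nodeSeq ω) n ∂treeMeasure prior ≤
      blockEntropy (source prior) n := by
  have : Nonempty A := nonempty_of_isProbabilityMeasure prior
  have habs : ∀ p, |F p| ≤ C := fun p => by rw [abs_of_nonneg (h0 p)]; exact hC p
  rw [integral_nodeSeq_eq_sum prior (n := n) (g := fun θ x => nodeSum F θ x n)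
    (fun x => measurable_nodeSum hFm x n) (abs_nodeSum_le habs · · n)
    (fun θ x y h => nodeSum_congr F θ h), blockEntropy_source, entropy, ← Finset.sum_neg_distrib]
  refine Finset.sum_le_sum fun w _ => ?_
  rw [integral_cylinder prior (extendWord w) n (measurable_nodeSum hFm _ n)
    fun θ => Finset.sum_nonneg fun t _ => h0 _, wordMass_eq]
  have hm : Measurable fun ω : List A → stdSimplex ℝ A × (ℕ → A) =>
      nodeLik (fun i => (ω i).1) (extendWord w) n := (measurable_nodeLik _ n).comp measurable_params
  refine le_trans (integral_mono ?_ ?_ fun ω => nodeLik_mul_nodeSum_le hF _ (extendWord w) n)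
    (integral_neg_mul_logb_le hm fun ω => nodeLik_mem_Icc _ _ n)
  · refine integrable_of_bounded (hm.mul ((measurable_nodeSum hFm _ n).comp measurable_params))
      (C := n * C) fun ω => ?_
    rw [abs_mul, abs_of_nonneg (nodeLik_mem_Icc _ _ n).1]
    exact (mul_le_of_le_one_left (abs_nonneg _) (nodeLik_mem_Icc _ _ n).2).trans
      (abs_nodeSum_le habs _ _ n)
  · obtain ⟨C', hC'⟩ := isCompact_Icc.exists_bound_of_continuousOn
      (s := Set.Icc (0 : ℝ) 1) continuous_mul_logb.continuousOn
    refine integrable_of_bounded (C := C') (continuous_mul_logb.measurable.comp hm).neg fun ω => ?_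
    rw [abs_neg]
    exact hC' _ (nodeLik_mem_Icc _ _ n)

theorem card_image_node_le (x : ℕ → A) (n : ℕ) :
    ((Finset.range n).image (node x)).card ≤ phrase x n + 1 := by
  rw [← tree_length_eq]
  refine (Finset.card_le_card (t := (parse x n).tree.toFinset) fun v hv => ?_).trans
    (List.toFinset_card_le _)
  obtain ⟨t, ht, rfl⟩ := Finset.mem_image.1 hv
  exact List.mem_toFinset.2 (tree_subset x (Finset.mem_range.1 ht).le (node_mem_tree x t))

/-- The prior that picks one of finitely many mass functions. -/
noncomputable def uniformPrior {Z : Type*} [Fintype Z] [Nonempty Z] (q : Z → stdSimplex ℝ A) :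
    Measure (stdSimplex ℝ A) :=
  (Fintype.card Z : ENNReal)⁻¹ • ∑ z, Measure.dirac (q z)

instance {Z : Type*} [Fintype Z] [Nonempty Z] (q : Z → stdSimplex ℝ A) :
    IsProbabilityMeasure (uniformPrior q) := by
  constructor
  simp only [uniformPrior, Measure.smul_apply, Measure.coe_finsetSum, Finset.sum_apply,
    measure_univ, Finset.sum_const, Finset.card_univ, nsmul_eq_mul, mul_one, smul_eq_mul]
  exact ENNReal.inv_mul_cancel (by simp) (by simp)

theorem le_uniformPrior_singleton {Z : Type*} [Fintype Z] [Nonempty Z] (q : Z → stdSimplex ℝ A)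
    (z : Z) : (Fintype.card Z : ENNReal)⁻¹ ≤ uniformPrior q {q z} := by
  simp only [uniformPrior, Measure.smul_apply, Measure.coe_finsetSum, Finset.sum_apply,
    smul_eq_mul]
  refine le_mul_of_one_le_right zero_le ?_
  refine le_trans ?_ (Finset.single_le_sum (f := fun z' => Measure.dirac (q z') {q z})
    (fun _ _ => zero_le) (Finset.mem_univ z))
  simp

/-- Under the uniform prior, the parameters of all nodes visited along `w` equal those prescribed by
`ζ` with probability at least |Z|^(-number of these nodes), and then the likelihood is the
prescribed one. -/
theorem le_wordMass_uniformPrior [Nonempty A] {Z : Type*} [Fintype Z] [Nonempty Z]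
    (q : Z → stdSimplex ℝ A) (ζ : List A → Z) {n : ℕ} (w : Fin n → A) :
    ((Fintype.card Z : ℝ)⁻¹) ^ ((Finset.range n).image (node (extendWord w))).card *
      nodeLik (fun v => q (ζ v)) (extendWord w) n ≤ wordMass (uniformPrior q) w := by
  set V := (Finset.range n).image (node (extendWord w)) with hV
  set S : Set (List A → stdSimplex ℝ A × (ℕ → A)) := Set.pi V fun v => Prod.fst ⁻¹' {q (ζ v)} with hS
  have hmS : MeasurableSet S := MeasurableSet.pi (Finset.countable_toSet V) fun v _ =>
    measurable_fst (measurableSet_singleton _)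
  have h1 : ((Fintype.card Z : ℝ)⁻¹) ^ V.card ≤ (treeMeasure (uniformPrior q)).real S := by
    have h2 : ((Fintype.card Z : ENNReal)⁻¹) ^ V.card ≤ treeMeasure (uniformPrior q) S := by
      rw [hS, Measure.infinitePi_pi _ fun v _ => measurable_fst (measurableSet_singleton _),
        ← Finset.prod_const]
      refine Finset.prod_le_prod' fun v _ => ?_
      rw [← Measure.map_apply measurable_fst (measurableSet_singleton _)]
      change _ ≤ (nodeLaw (uniformPrior q)).fst _
      rw [nodeLaw, Measure.fst_compProd]
      exact le_uniformPrior_singleton q (ζ v)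
    have := ENNReal.toReal_mono (measure_ne_top _ _) h2
    simpa [measureReal_def] using this
  rw [wordMass_eq]
  have hm : Measurable fun ω : List A → stdSimplex ℝ A × (ℕ → A) =>
      nodeLik (fun i => (ω i).1) (extendWord w) n := (measurable_nodeLik _ n).comp measurable_params
  have hlik := nodeLik_mem_Icc (fun v => q (ζ v)) (extendWord w) n
  calc _ ≤ (treeMeasure (uniformPrior q)).real S * nodeLik (fun v => q (ζ v)) (extendWord w) n :=
        mul_le_mul_of_nonneg_right h1 hlik.1
    _ = ∫ ω, S.indicator (fun _ => nodeLik (fun v => q (ζ v)) (extendWord w) n) ω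
        ∂treeMeasure (uniformPrior q) := by
      rw [integral_indicator_const _ hmS, smul_eq_mul]
    _ ≤ _ := by
      refine integral_mono ((integrable_const _).indicator hmS)
        (integrable_of_bounded hm (C := 1) fun ω => by
          rw [abs_of_nonneg (nodeLik_mem_Icc _ _ n).1]; exact (nodeLik_mem_Icc _ _ n).2) fun ω => ?_
      dsimp only
      by_cases hω : ω ∈ S
      · rw [Set.indicator_of_mem hω]
        refine le_of_eq (Finset.prod_congr rfl fun t ht => ?_)
        have : (ω (node (extendWord w) t)).1 = q (ζ (node (extendWord w) t)) :=
          hω _ (Finset.mem_coe.2 (Finset.mem_image_of_mem _ ht))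
        simp only [this]
      · rw [Set.indicator_of_notMem hω]
        exact (nodeLik_mem_Icc _ _ n).1

/-- Ideal codeword length for the mass function of the cell of the parameter. -/
noncomputable def cellLength {Z : Type*} (q : Z → stdSimplex ℝ A) (c : stdSimplex ℝ A → Z)
    (p : stdSimplex ℝ A × A) : ℝ :=
  -Real.logb 2 ((q (c p.1)).1 p.2)

theorem measurable_cellLength {Z : Type*} [Finite Z] [MeasurableSpace Z]
    [MeasurableSingletonClass Z] (q : Z → stdSimplex ℝ A) {c : stdSimplex ℝ A → Z}
    (hc : Measurable c) : Measurable (cellLength q c) := by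
  have h1 : Measurable fun p : Z × A => -Real.logb 2 ((q p.1).1 p.2) := measurable_of_countable _
  exact h1.comp ((hc.comp measurable_fst).prodMk measurable_snd)

theorem exists_abs_cellLength_le {Z : Type*} [Fintype Z] (q : Z → stdSimplex ℝ A)
    (c : stdSimplex ℝ A → Z) : ∃ C, ∀ p, |cellLength q c p| ≤ C :=
  ⟨∑ r : Z × A, |-Real.logb 2 ((q r.1).1 r.2)|, fun p =>
    Finset.single_le_sum (f := fun r : Z × A => |-Real.logb 2 ((q r.1).1 r.2)|)
      (fun _ _ => abs_nonneg _) (Finset.mem_univ (c p.1, p.2))⟩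

/-- The cost of describing the parameters of the nodes by cells and of coding each symbol with the
mass function of the cell bounds the entropy of a word. -/
theorem blockEntropy_le {Z : Type*} [Fintype Z] [Nonempty Z] [MeasurableSpace Z]
    [MeasurableSingletonClass Z] (q : Z → stdSimplex ℝ A) (hq : ∀ z a, 0 < (q z).1 a)
    {c : stdSimplex ℝ A → Z} (hc : Measurable c) {n b : ℕ} (hb : ∀ x : ℕ → A, phrase x n ≤ b) :
    blockEntropy (source prior) n ≤ (b + 1) * Real.logb 2 (Fintype.card Z) +
      ∫ ω, nodeSum (cellLength q c) (fun i => (ω i).1) (nodeSeq ω) n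
        ∂treeMeasure prior := by
  have : Nonempty A := nonempty_of_isProbabilityMeasure prior
  have hcard : (1 : ℝ) ≤ Fintype.card Z := by exact_mod_cast Fintype.card_pos (α := Z)
  have hlik : ∀ (ζ : List A → Z) (x : ℕ → A), 0 < nodeLik (fun v => q (ζ v)) x n := fun ζ x =>
    Finset.prod_pos fun t _ => hq _ _
  have hφ : ∀ (w : Fin n → A) (ζ : List A → Z), 0 < wordMass (uniformPrior q) w ∧
      -Real.logb 2 (wordMass (uniformPrior q) w) ≤ (b + 1) * Real.logb 2 (Fintype.card Z) +
        -Real.logb 2 (nodeLik (fun v => q (ζ v)) (extendWord w) n) := by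
    intro w ζ
    have h1 := le_wordMass_uniformPrior q ζ w
    have h2 := hlik ζ (extendWord w)
    set V := (Finset.range n).image (node (extendWord w))
    have h3 : 0 < ((Fintype.card Z : ℝ)⁻¹) ^ V.card := by positivity
    refine ⟨(mul_pos h3 h2).trans_le h1, ?_⟩
    have h4 := Real.logb_le_logb_of_le (b := 2) (by norm_num) (mul_pos h3 h2) h1
    rw [Real.logb_mul h3.ne' h2.ne', Real.logb_pow, Real.logb_inv] at h4
    have h5 : (V.card : ℝ) ≤ b + 1 := by
      exact_mod_cast (card_image_node_le _ n).trans (Nat.add_le_add_right (hb _) 1)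
    have h6 := mul_le_mul_of_nonneg_right h5 (Real.logb_nonneg (b := 2) (by norm_num) hcard)
    linarith
  set F := cellLength q c
  have hFm : Measurable F := measurable_cellLength q hc
  obtain ⟨C, hC⟩ : ∃ C, ∀ p, |F p| ≤ C := exists_abs_cellLength_le q c
  obtain ⟨z₀⟩ := ‹Nonempty Z›
  -- The coding distribution is the LZ78 source whose prior is uniform on the cell representatives.
  have hgibbs := entropy_sub_logb_le (f := fun w : Fin n → A => wordMass prior w)
    (φ := fun w => wordMass (uniformPrior q) w) (fun w => wordMass_nonneg prior w)
    (sum_wordMass prior n) (fun w => wordMass_nonneg _ w) one_pos (sum_wordMass _ n).le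
    (fun w _ => (hφ w fun _ => z₀).1)
  rw [Real.logb_one, sub_zero, sum_wordMass_mul prior fun w =>
    -Real.logb 2 (wordMass (uniformPrior q) w)] at hgibbs
  rw [blockEntropy_source]
  have hint : Integrable (fun ω : List A → stdSimplex ℝ A × (ℕ → A) =>
      nodeSum F (fun i => (ω i).1) (nodeSeq ω) n) (treeMeasure prior) :=
    integrable_of_bounded (measurable_nodeSum_nodeSeq hFm n) fun ω => abs_nodeSum_le hC _ _ n
  have hconst : (b + 1 : ℝ) * Real.logb 2 (Fintype.card Z) = ∫ _, (b + 1 : ℝ) *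
      Real.logb 2 (Fintype.card Z) ∂treeMeasure prior := by simp
  rw [hconst, ← integral_add (integrable_const _) hint]
  refine hgibbs.trans (integral_mono ?_ ((integrable_const _).add hint) fun ω => ?_)
  · have h1 : Measurable fun w : Fin n → A => -Real.logb 2 (wordMass (uniformPrior q) w) :=
      measurable_of_countable _
    refine integrable_of_bounded (C := ∑ w : Fin n → A, |-Real.logb 2 (wordMass (uniformPrior q) w)|)
      (h1.comp (measurable_pi_lambda _ fun i =>
        (measurable_pi_apply (i : ℕ)).comp measurable_nodeSeq)) fun ω => ?_
    exact Finset.single_le_sum (f := fun w : Fin n → A =>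
      |-Real.logb 2 (wordMass (uniformPrior q) w)|) (fun _ _ => abs_nonneg _)
      (Finset.mem_univ fun i : Fin n => nodeSeq ω i)
  · have hx : ∀ t < n, extendWord (fun i : Fin n => nodeSeq ω i) t = nodeSeq ω t := fun t ht =>
      extendWord_apply (fun i : Fin n => nodeSeq ω i) ⟨t, ht⟩
    -- The comparison assignment may depend on the outcome: each node is given the cell of its true
    -- parameter.
    refine ((hφ (fun i => nodeSeq ω i) fun v => c (ω v).1).2).trans (le_of_eq ?_)
    congr 1
    rw [nodeLik, Real.logb_prod _ _ fun t _ => (hq _ _).ne', ← Finset.sum_neg_distrib]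
    exact nodeSum_congr F (fun i => (ω i).1) hx

end EntropyRate

/-! ### The entropy rate. -/

section EntropyRateLimit

variable {A : Type*} [DecidableEq A] [Fintype A] [MeasurableSpace A] [MeasurableSingletonClass A]
variable (prior : Measure (stdSimplex ℝ A)) [IsProbabilityMeasure prior]

theorem entropy_mem_Icc (θ : stdSimplex ℝ A) :
    entropy θ.1 ∈ Set.Icc 0 (Real.logb 2 (Fintype.card A)) := by
  have : Nonempty A := by
    by_contra h
    rw [not_nonempty_iff] at h
    simpa using θ.2.2
  refine ⟨entropy_nonneg θ.2.1 (coord_le_one θ), ?_⟩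
  have h := entropy_sub_logb_le (φ := fun _ : A => 1) θ.2.1 θ.2.2 (fun _ => zero_le_one)
    (K := Fintype.card A) (by exact_mod_cast Fintype.card_pos) (by simp) (fun _ _ => one_pos)
  simpa using h

theorem measurable_entropy : Measurable fun θ : stdSimplex ℝ A => entropy θ.1 :=
  (Finset.measurable_fun_sum _ fun a _ =>
    continuous_mul_logb.measurable.comp (measurable_coord a)).neg

theorem measurable_eval : Measurable fun p : stdSimplex ℝ A × A => p.1.1 p.2 :=
  measurable_from_prod_countable_left fun a => measurable_coord a

/-- Ideal codeword length, truncated at `K`. -/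
noncomputable def truncLength (K : ℕ) (p : stdSimplex ℝ A × A) : ℝ :=
  min (-Real.logb 2 (p.1.1 p.2)) K

theorem measurable_truncLength (K : ℕ) : Measurable (truncLength (A := A) K) :=
  ((Real.measurable_log.comp measurable_eval).div_const _).neg.min measurable_const

theorem truncLength_nonneg (K : ℕ) (p : stdSimplex ℝ A × A) : 0 ≤ truncLength K p :=
  le_min (neg_nonneg.2 (Real.logb_nonpos (by norm_num) (p.1.2.1 _) (coord_le_one _ _)))
    (Nat.cast_nonneg K)

theorem tendsto_integral_truncLength :
    Tendsto (fun K : ℕ => ∫ p, truncLength K p ∂(prior ⊗ₘ symbolKernel)) atTop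
      (𝓝 (∫ θ, entropy θ.1 ∂prior)) := by
  have h1 : ∀ K : ℕ, ∫ p, truncLength K p ∂(prior ⊗ₘ symbolKernel) =
      ∫ θ, ∑ a, θ.1 a * truncLength K (θ, a) ∂prior := fun K =>
    integral_compProd_symbolKernel prior (integrable_of_bounded (measurable_truncLength K)
      (C := K) fun p => by
        rw [abs_of_nonneg (truncLength_nonneg K p)]; exact min_le_right _ _)
  simp only [h1]
  have h2 : ∀ θ : stdSimplex ℝ A, entropy θ.1 = ∑ a, θ.1 a * -Real.logb 2 (θ.1 a) := fun θ => by
    simp [entropy]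
  refine tendsto_integral_of_dominated_convergence (fun _ => Real.logb 2 (Fintype.card A))
    (fun K => (Finset.measurable_fun_sum _ fun a _ => (measurable_coord a).mul
      ((measurable_truncLength K).comp measurable_prodMk_right)).aestronglyMeasurable)
    (integrable_const _) (fun K => ae_of_all _ fun θ => ?_) (ae_of_all _ fun θ => ?_)
  · rw [Real.norm_eq_abs, abs_of_nonneg (Finset.sum_nonneg fun a _ =>
      mul_nonneg (θ.2.1 a) (truncLength_nonneg K _))]
    refine le_trans ?_ (entropy_mem_Icc θ).2
    rw [h2]
    exact Finset.sum_le_sum fun a _ => mul_le_mul_of_nonneg_left (min_le_left _ _) (θ.2.1 a)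
  · rw [h2]
    refine tendsto_finsetSum _ fun a _ => Tendsto.const_mul _ ?_
    refine tendsto_const_nhds.congr' ?_
    filter_upwards [eventually_ge_atTop ⌈-Real.logb 2 (θ.1 a)⌉₊] with K hK
    exact (min_eq_left (Nat.ceil_le.1 hK)).symm

/-- The mass function of a cell of the grid of mesh `1 / K`. -/
noncomputable def gridPMF [Nonempty A] {K : ℕ} (z : A → Fin (K + 1)) : stdSimplex ℝ A :=
  ⟨fun a => ((z a : ℝ) + 1) / ∑ b, ((z b : ℝ) + 1), fun a => by positivity, by
    have : 0 < ∑ b, ((z b : ℝ) + 1) :=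
      Finset.sum_pos (fun b _ => by positivity) Finset.univ_nonempty
    rw [← Finset.sum_div, div_self this.ne']⟩

theorem gridPMF_pos [Nonempty A] {K : ℕ} (z : A → Fin (K + 1)) (a : A) : 0 < (gridPMF z).1 a :=
  div_pos (by positivity) (Finset.sum_pos (fun b _ => by positivity) Finset.univ_nonempty)

/-- The cell of a mass function. -/
noncomputable def gridCell (K : ℕ) (θ : stdSimplex ℝ A) (a : A) : Fin (K + 1) :=
  Fin.ofNat (K + 1) ⌊K * θ.1 a⌋₊

theorem measurable_gridCell (K : ℕ) : Measurable (gridCell (A := A) K) := by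
  refine measurable_pi_lambda _ fun a => ?_
  have h1 : Measurable fun m : ℕ => Fin.ofNat (K + 1) m := measurable_of_countable _
  exact h1.comp (Nat.measurable_floor.comp ((measurable_coord a).const_mul _))

theorem gridCell_val (K : ℕ) (θ : stdSimplex ℝ A) (a : A) :
    ((gridCell K θ a : ℕ) : ℝ) = ⌊K * θ.1 a⌋₊ := by
  have h : ⌊K * θ.1 a⌋₊ ≤ K := Nat.floor_le_of_le
    (mul_le_of_le_one_right (Nat.cast_nonneg K) (coord_le_one θ a))
  rw [gridCell, Fin.val_ofNat, Nat.mod_eq_of_lt (by omega)]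

/-- Raising each floor by one keeps the numerator above `K θ(a)` and the normaliser at most `K +
|A|`; it also removes zeros. Replacing θ by its cell therefore costs at most log(1 + |A| / K). -/
theorem mul_le_gridPMF [Nonempty A] {K : ℕ} (θ : stdSimplex ℝ A) (a : A) :
    θ.1 a * (K / (K + Fintype.card A)) ≤ (gridPMF (gridCell K θ)).1 a := by
  have hcard : (0 : ℝ) < Fintype.card A := by exact_mod_cast Fintype.card_pos
  have h1 : ∑ b, ((gridCell K θ b : ℝ) + 1) ≤ K + Fintype.card A := by
    rw [Finset.sum_add_distrib]
    refine add_le_add ?_ (by simp)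
    calc ∑ b, (gridCell K θ b : ℝ) ≤ ∑ b, K * θ.1 b := Finset.sum_le_sum fun b _ => by
          rw [gridCell_val]
          exact Nat.floor_le (mul_nonneg (Nat.cast_nonneg K) (θ.2.1 b))
      _ = K := by rw [← Finset.mul_sum, show ∑ b, θ.1 b = 1 from θ.2.2, mul_one]
  have h2 : 0 < ∑ b, ((gridCell K θ b : ℝ) + 1) :=
    Finset.sum_pos (fun b _ => by positivity) Finset.univ_nonempty
  have h3 : K * θ.1 a ≤ (gridCell K θ a : ℝ) + 1 := by
    rw [gridCell_val]; exact (Nat.lt_floor_add_one _).le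
  change _ ≤ ((gridCell K θ a : ℝ) + 1) / _
  rw [← mul_div_assoc, mul_comm]
  exact div_le_div₀ (by positivity) h3 h2 h1

theorem crossEntropy_grid_le [Nonempty A] {K : ℕ} (hK : 0 < K) (θ : stdSimplex ℝ A) :
    ∑ a, θ.1 a * -Real.logb 2 ((gridPMF (gridCell K θ)).1 a) ≤
      entropy θ.1 + Real.logb 2 (1 + Fintype.card A / K) := by
  have hK' : (0 : ℝ) < K := by exact_mod_cast hK
  have hcard : (0 : ℝ) < Fintype.card A := by exact_mod_cast Fintype.card_pos
  have h1 : entropy θ.1 + Real.logb 2 (1 + Fintype.card A / K) =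
      ∑ a, θ.1 a * (-Real.logb 2 (θ.1 a) + Real.logb 2 (1 + Fintype.card A / K)) := by
    simp only [mul_add, Finset.sum_add_distrib, ← Finset.sum_mul]
    rw [show ∑ b, θ.1 b = 1 from θ.2.2, one_mul]
    simp [entropy]
  rw [h1]
  refine Finset.sum_le_sum fun a _ => ?_
  rcases (θ.2.1 a).eq_or_lt with h | h
  · rw [← h]; simp
  · refine mul_le_mul_of_nonneg_left ?_ h.le
    have h2 : 1 + (Fintype.card A : ℝ) / K = (K / (K + Fintype.card A) : ℝ)⁻¹ := by field_simp
    have h3 := Real.logb_le_logb_of_le (b := 2) (by norm_num) (by positivity) (mul_le_gridPMF (K := K) θ a)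
    rw [Real.logb_mul h.ne' (by positivity)] at h3
    rw [h2, Real.logb_inv]
    linarith

theorem eventually_blockEntropy_div_le [Nonempty A] {δ : ℝ} (hδ : 0 < δ) :
    ∀ᶠ n : ℕ in atTop, blockEntropy (source prior) n / n ≤ ∫ θ, entropy θ.1 ∂prior + δ := by
  have hlim : Tendsto (fun K : ℕ => Real.logb 2 (1 + (Fintype.card A : ℝ) / K)) atTop (𝓝 0) := by
    have h1 := (tendsto_const_div_atTop_nhds_zero_nat (Fintype.card A : ℝ)).const_add 1
    rw [add_zero] at h1
    have h2 := (Real.continuousAt_logb (b := 2) one_ne_zero).tendsto.comp h1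
    rwa [Real.logb_one] at h2
  obtain ⟨K, hK, hK0⟩ := ((hlim.eventually_le_const (show (0 : ℝ) < δ / 4 by positivity)).and
    (eventually_gt_atTop 0)).exists
  set F : stdSimplex ℝ A × A → ℝ := cellLength gridPMF (gridCell K) with hF
  have hFm : Measurable F := measurable_cellLength gridPMF (measurable_gridCell K)
  obtain ⟨C, hC⟩ : ∃ C, ∀ p, |F p| ≤ C := exists_abs_cellLength_le gridPMF (gridCell K)
  have hmean : ∫ p, F p ∂(prior ⊗ₘ symbolKernel) ≤ ∫ θ, entropy θ.1 ∂prior + δ / 4 := by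
    rw [integral_compProd_symbolKernel prior (integrable_of_bounded hFm hC)]
    have hent : Integrable (fun θ : stdSimplex ℝ A => entropy θ.1) prior :=
      integrable_of_bounded measurable_entropy fun θ => by
        rw [abs_of_nonneg (entropy_mem_Icc θ).1]; exact (entropy_mem_Icc θ).2
    have hconst : δ / 4 = ∫ _, δ / 4 ∂prior := by simp
    rw [hconst, ← integral_add hent (integrable_const _)]
    refine integral_mono (integrable_of_bounded (C := ∑ a : A, C)
      (Finset.measurable_fun_sum _ fun a _ => (measurable_coord a).mul
        (hFm.comp measurable_prodMk_right)) fun θ => ?_) (hent.add (integrable_const _)) fun θ => ?_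
    · refine (Finset.abs_sum_le_sum_abs _ _).trans (Finset.sum_le_sum fun a _ => ?_)
      rw [abs_mul, abs_of_nonneg (θ.2.1 a)]
      exact (mul_le_of_le_one_left (abs_nonneg _) (coord_le_one θ a)).trans (hC _)
    · exact (crossEntropy_grid_le hK0 θ).trans (add_le_add le_rfl hK)
  set L := Real.logb 2 (Fintype.card (A → Fin (K + 1))) with hL
  have hL0 : 0 ≤ L := Real.logb_nonneg (by norm_num) (by
    exact_mod_cast Fintype.card_pos (α := A → Fin (K + 1)))
  have hconst : Tendsto (fun n : ℕ => L / n) atTop (𝓝 0) := tendsto_const_div_atTop_nhds_zero_nat L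
  -- One quarter of δ each for the mesh of the grid, the description of the cells of at most `b`
  -- nodes, that of one further node, and the convergence of the mean loss.
  filter_upwards [eventually_gt_atTop 0,
    eventually_phrase_le (A := A) (δ / (4 * (L + 1))) (by positivity),
    hconst.eventually_le_const (show (0 : ℝ) < δ / 4 by positivity),
    (tendsto_integral_nodeSum_div prior hFm hC).eventually_le_const
      (show _ < ∫ p, F p ∂(prior ⊗ₘ symbolKernel) + δ / 4 by linarith)] with n hn hphrase hLn hS
  have hn' : (0 : ℝ) < n := by exact_mod_cast hn
  obtain ⟨b, hb, hb'⟩ : ∃ b : ℕ, (∀ x : ℕ → A, phrase x n ≤ b) ∧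
      (b : ℝ) ≤ δ / (4 * (L + 1)) * n :=
    ⟨⌊δ / (4 * (L + 1)) * n⌋₊, fun x => Nat.le_floor (hphrase x), Nat.floor_le (by positivity)⟩
  have hle := blockEntropy_le prior gridPMF gridPMF_pos (measurable_gridCell K) hb
  rw [div_le_iff₀ hn'] at hLn hS ⊢
  have h1 : (b : ℝ) * L ≤ δ / 4 * n := by
    have h2 : δ / (4 * (L + 1)) * n * L ≤ δ / 4 * n := by
      have h3 : δ / (4 * (L + 1)) * n * L = δ / 4 * n * (L / (L + 1)) := by field_simp
      rw [h3]
      exact mul_le_of_le_one_right (by positivity) ((div_le_one (by positivity)).2 (by linarith))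
    exact (mul_le_mul_of_nonneg_right hb' hL0).trans h2
  have h4 : (∫ p, F p ∂(prior ⊗ₘ symbolKernel)) * n ≤ (∫ θ, entropy θ.1 ∂prior + δ / 4) * n :=
    mul_le_mul_of_nonneg_right hmean hn'.le
  linarith

/-- The entropy rate of the LZ78 source. -/
theorem tendsto_blockEntropy_div :
    Tendsto (fun n : ℕ => blockEntropy (source prior) n / n) atTop
      (𝓝 (∫ θ, entropy θ.1 ∂prior)) := by
  have : Nonempty A := nonempty_of_isProbabilityMeasure prior
  refine tendsto_order.2 ⟨fun r hr => ?_, fun r hr => ?_⟩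
  -- Truncation makes the ideal length bounded, as the law of large numbers requires; the truncated
  -- means increase to the mean entropy.
  · obtain ⟨K, hK⟩ := ((tendsto_integral_truncLength prior).eventually_const_lt hr).exists
    have habs : ∀ p : stdSimplex ℝ A × A, |truncLength K p| ≤ K := fun p => by
      rw [abs_of_nonneg (truncLength_nonneg K p)]; exact min_le_right _ _
    filter_upwards [(tendsto_integral_nodeSum_div prior (measurable_truncLength K)
      habs).eventually_const_lt hK] with n hn
    refine hn.trans_le (div_le_div_of_nonneg_right ?_ (Nat.cast_nonneg n))
    exact integral_nodeSum_le_blockEntropy prior (measurable_truncLength K)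
      (fun p => truncLength_nonneg K p) (fun p => min_le_right _ _) (fun θ a _ => min_le_left _ _) n
  · filter_upwards [eventually_blockEntropy_div_le prior
      (show 0 < (r - ∫ θ, entropy θ.1 ∂prior) / 2 by linarith)] with n hn
    linarith

end EntropyRateLimit

/-! ### The Jensen gap as mutual information. -/

section MutualInformation

variable {A : Type*} [DecidableEq A] [Fintype A] [MeasurableSpace A] [MeasurableSingletonClass A]
variable (prior : Measure (stdSimplex ℝ A)) [IsProbabilityMeasure prior]

theorem lintegral_symbolMeasure (θ : stdSimplex ℝ A) (f : A → ENNReal) :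
    ∫⁻ a, f a ∂symbolMeasure θ = ∑ a, f a * ENNReal.ofReal (θ.1 a) := by
  rw [lintegral_fintype]
  simp only [symbolMeasure_singleton]

theorem comp_symbolKernel_singleton (a : A) :
    (symbolKernel ∘ₘ prior) {a} = ENNReal.ofReal (meanPMF prior a) := by
  rw [Measure.bind_apply (measurableSet_singleton a) symbolKernel.aemeasurable, meanPMF,
    ofReal_integral_eq_lintegral_ofReal (integrable_coord prior a)
      (ae_of_all _ fun θ => θ.2.1 a)]
  exact lintegral_congr fun θ => symbolMeasure_singleton θ a

theorem ae_coord_eq_zero : ∀ᵐ θ ∂prior, ∀ a, meanPMF prior a = 0 → θ.1 a = 0 := by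
  rw [ae_all_iff]
  intro a
  by_cases h : meanPMF prior a = 0
  · filter_upwards [(integral_eq_zero_iff_of_nonneg (fun θ : stdSimplex ℝ A => θ.2.1 a)
      (integrable_coord prior a)).1 h] with θ hθ _
    exact hθ
  · exact ae_of_all _ fun θ h' => absurd h' h

/-- The density of the joint law with respect to the product of the marginals. -/
noncomputable def jointDensity (p : stdSimplex ℝ A × A) : ENNReal :=
  ENNReal.ofReal (p.1.1 p.2 / meanPMF prior p.2)

theorem measurable_jointDensity : Measurable (jointDensity prior) :=
  (measurable_eval.div ((measurable_of_countable (meanPMF prior)).comp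
    measurable_snd)).ennreal_ofReal

theorem compProd_eq_withDensity : prior ⊗ₘ symbolKernel =
    (prior.prod (symbolKernel ∘ₘ prior)).withDensity (jointDensity prior) := by
  ext S hS
  rw [withDensity_apply _ hS, ← lintegral_indicator hS, ← lintegral_indicator_one hS,
    lintegral_prod _ ((measurable_jointDensity prior).indicator hS).aemeasurable,
    Measure.lintegral_compProd (measurable_one.indicator hS)]
  refine lintegral_congr_ae ?_
  filter_upwards [ae_coord_eq_zero prior] with θ hθ
  refine (lintegral_symbolMeasure θ _).trans ?_
  rw [lintegral_fintype]
  refine Finset.sum_congr rfl fun a _ => ?_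
  rw [comp_symbolKernel_singleton]
  by_cases h : (θ, a) ∈ S
  · rw [Set.indicator_of_mem h, Set.indicator_of_mem h, Pi.one_apply, one_mul, jointDensity,
      ← ENNReal.ofReal_mul (div_nonneg (θ.2.1 a) (meanPMF_nonneg prior a))]
    congr 1
    -- For a symbol of mean mass zero the quotient is zero by convention, which is correct because
    -- θ(a) = 0 almost surely.
    by_cases hp : meanPMF prior a = 0
    · rw [hθ a hp]; simp
    · exact (div_mul_cancel₀ _ hp).symm
  · rw [Set.indicator_of_notMem h, Set.indicator_of_notMem h, zero_mul, zero_mul]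

theorem absolutelyContinuous_compProd :
    prior ⊗ₘ symbolKernel ≪ prior.prod (symbolKernel ∘ₘ prior) := by
  rw [compProd_eq_withDensity]
  exact withDensity_absolutelyContinuous _ _

theorem ae_compProd_iff_coord {q : stdSimplex ℝ A × A → Prop} (hq : MeasurableSet {p | q p}) :
    (∀ᵐ p ∂(prior ⊗ₘ symbolKernel), q p) ↔ ∀ᵐ θ ∂prior, ∀ a, θ.1 a ≠ 0 → q (θ, a) := by
  rw [Measure.ae_compProd_iff hq]
  refine eventually_congr (ae_of_all _ fun θ => ?_)
  change (∀ᵐ a ∂symbolMeasure θ, _) ↔ _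
  rw [ae_iff_of_countable]
  refine forall_congr' fun a => ?_
  rw [symbolMeasure_singleton, Ne, ENNReal.ofReal_eq_zero, not_le]
  exact imp_congr_left ((θ.2.1 a).lt_iff_ne.trans ne_comm)

theorem llr_ae_eq : llr (prior ⊗ₘ symbolKernel) (prior.prod (symbolKernel ∘ₘ prior))
    =ᵐ[prior ⊗ₘ symbolKernel] fun p => Real.log (p.1.1 p.2) - Real.log (meanPMF prior p.2) := by
  have h1 := (Measure.rnDeriv_withDensity (prior.prod (symbolKernel ∘ₘ prior))
    (measurable_jointDensity prior))
  rw [← compProd_eq_withDensity] at h1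
  have hmean : Measurable fun p : stdSimplex ℝ A × A => meanPMF prior p.2 :=
    (measurable_of_countable (meanPMF prior)).comp measurable_snd
  -- Under the joint law the emitted symbol has positive mass under both θ and the mean, so the
  -- logarithm of the quotient splits.
  have h2 : ∀ᵐ p ∂(prior ⊗ₘ symbolKernel), p.1.1 p.2 ≠ 0 ∧ meanPMF prior p.2 ≠ 0 := by
    rw [ae_compProd_iff_coord]
    · filter_upwards [ae_coord_eq_zero prior] with θ hθ a ha
      exact ⟨ha, fun h => ha (hθ a h)⟩
    · exact ((measurableSet_singleton (0 : ℝ)).preimage measurable_eval).compl.inter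
        ((measurableSet_singleton (0 : ℝ)).preimage hmean).compl
  filter_upwards [(absolutelyContinuous_compProd prior).ae_le h1, h2] with p hp hp2
  rw [llr, hp, jointDensity,
    ENNReal.toReal_ofReal (div_nonneg (p.1.2.1 _) (meanPMF_nonneg prior _)),
    Real.log_div hp2.1 hp2.2]

/-- log θ(a) may be unbounded, but averaging over the symbol weights it by θ(a), and t log t is
bounded on [0, 1]. -/
theorem integrable_log_sub : Integrable
    (fun p : stdSimplex ℝ A × A => Real.log (p.1.1 p.2) - Real.log (meanPMF prior p.2))
    (prior ⊗ₘ symbolKernel) := by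
  have hm : Measurable fun p : stdSimplex ℝ A × A =>
      Real.log (p.1.1 p.2) - Real.log (meanPMF prior p.2) :=
    (Real.measurable_log.comp measurable_eval).sub
      ((measurable_of_countable fun a => Real.log (meanPMF prior a)).comp measurable_snd)
  rw [Measure.integrable_compProd_iff hm.aestronglyMeasurable]
  refine ⟨ae_of_all _ fun θ => .of_finite, ?_⟩
  have h1 : ∀ θ : stdSimplex ℝ A, ∫ a, ‖Real.log (θ.1 a) - Real.log (meanPMF prior a)‖
      ∂symbolKernel θ = ∑ a, θ.1 a * |Real.log (θ.1 a) - Real.log (meanPMF prior a)| := fun θ =>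
    integral_symbolMeasure θ _
  simp only [h1]
  obtain ⟨C, hC⟩ := isCompact_Icc.exists_bound_of_continuousOn
    (s := Set.Icc (0 : ℝ) 1) Real.continuous_mul_log.continuousOn
  refine integrable_of_bounded (C := ∑ a, (C + |Real.log (meanPMF prior a)|))
    (Finset.measurable_fun_sum _ fun a _ => (measurable_coord a).mul
      ((Real.measurable_log.comp (measurable_coord a)).sub_const _).norm) fun θ => ?_
  rw [abs_of_nonneg (Finset.sum_nonneg fun a _ => mul_nonneg (θ.2.1 a) (abs_nonneg _))]
  refine Finset.sum_le_sum fun a _ => ?_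
  have h2 : |θ.1 a * Real.log (θ.1 a)| ≤ C := hC _ ⟨θ.2.1 a, coord_le_one θ a⟩
  rw [abs_mul, abs_of_nonneg (θ.2.1 a)] at h2
  calc θ.1 a * |Real.log (θ.1 a) - Real.log (meanPMF prior a)|
      ≤ θ.1 a * (|Real.log (θ.1 a)| + |Real.log (meanPMF prior a)|) :=
        mul_le_mul_of_nonneg_left (abs_sub _ _) (θ.2.1 a)
    _ ≤ _ := by
      rw [mul_add]
      exact add_le_add h2 (mul_le_of_le_one_left (abs_nonneg _) (coord_le_one θ a))

theorem integral_log_sub :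
    ∫ p, (Real.log (p.1.1 p.2) - Real.log (meanPMF prior p.2)) ∂(prior ⊗ₘ symbolKernel) =
      Real.log 2 * (entropy (meanPMF prior) - ∫ θ, entropy θ.1 ∂prior) := by
  have hl : Real.log 2 ≠ 0 := (Real.log_pos (by norm_num)).ne'
  rw [integral_compProd_symbolKernel prior (integrable_log_sub prior)]
  have h1 : ∀ θ : stdSimplex ℝ A,
      ∑ a, θ.1 a * (Real.log (θ.1 a) - Real.log (meanPMF prior a)) =
        -(Real.log 2 * entropy θ.1) - ∑ a, θ.1 a * Real.log (meanPMF prior a) := by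
    intro θ
    rw [entropy, mul_neg, neg_neg, Finset.mul_sum, ← Finset.sum_sub_distrib]
    refine Finset.sum_congr rfl fun a _ => ?_
    rw [Real.logb]; field_simp
  simp only [h1]
  have hent : Integrable (fun θ : stdSimplex ℝ A => entropy θ.1) prior :=
    integrable_of_bounded measurable_entropy fun θ => by
      rw [abs_of_nonneg (entropy_mem_Icc θ).1]; exact (entropy_mem_Icc θ).2
  have hneg : Integrable (fun θ : stdSimplex ℝ A => -(Real.log 2 * entropy θ.1)) prior :=
    (hent.const_mul _).neg
  rw [integral_sub hneg (integrable_finsetSum _ fun a _ => (integrable_coord prior a).mul_const _), integral_neg,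
    integral_const_mul, integral_finsetSum _ fun a _ => (integrable_coord prior a).mul_const _]
  simp only [integral_mul_const]
  have h2 : ∑ a, (∫ θ, θ.1 a ∂prior) * Real.log (meanPMF prior a) =
      -(Real.log 2 * entropy (meanPMF prior)) := by
    rw [entropy, mul_neg, neg_neg, Finset.mul_sum]
    refine Finset.sum_congr rfl fun a _ => ?_
    rw [Real.logb, ← meanPMF]; field_simp
  rw [h2]
  ring

theorem mutualInformation_ne_top : mutualInformation prior ≠ ⊤ := by
  refine ENNReal.div_ne_top (InformationTheory.klDiv_ne_top (absolutelyContinuous_compProd prior)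
    ((integrable_congr (llr_ae_eq prior)).2 (integrable_log_sub prior))) ?_
  rw [Ne, ENNReal.ofReal_eq_zero, not_le]
  exact Real.log_pos (by norm_num)

theorem entropy_meanPMF_eq : entropy (meanPMF prior) =
    (∫ θ, entropy θ.1 ∂prior) + (mutualInformation prior).toReal := by
  have hl : 0 < Real.log 2 := Real.log_pos (by norm_num)
  rw [mutualInformation, ENNReal.toReal_div, ENNReal.toReal_ofReal hl.le,
    InformationTheory.toReal_klDiv_of_measure_eq (absolutelyContinuous_compProd prior)
      (by rw [measure_univ, measure_univ]),
    integral_congr_ae (llr_ae_eq prior), integral_log_sub]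
  field_simp
  ring

end MutualInformation

end LZ78

theorem mainTheorem5 {A : Type*} [Fintype A] [DecidableEq A] [MeasurableSpace A]
    [MeasurableSingletonClass A]
    (prior : Measure (stdSimplex ℝ A)) [IsProbabilityMeasure prior]
    {Ω : Type*} [MeasurableSpace Ω] (P : Measure Ω) (X : Ω → ℕ → A)
    (hX : HasLaw X (LZ78.source prior) P) :
    (∀ᵐ ω ∂P,
      Tendsto (fun k => LZ78.markovLogLoss k (X ω)) atTop
        (𝓝 (LZ78.entropy (LZ78.meanPMF prior))) ∧
      Tendsto (fun M => LZ78.fsLogLoss M (X ω)) atTop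
        (𝓝 (LZ78.entropy (LZ78.meanPMF prior))) ∧
      Tendsto (fun s => Real.logb 2 (Fintype.card A) * LZ78.fsCompressibility s (X ω)) atTop
        (𝓝 (LZ78.entropy (LZ78.meanPMF prior)))) ∧
    Tendsto (fun n : ℕ => LZ78.blockEntropy (P.map X) n / n) atTop
      (𝓝 (∫ θ, LZ78.entropy θ.1 ∂prior)) ∧
    LZ78.mutualInformation prior ≠ ⊤ ∧
    LZ78.entropy (LZ78.meanPMF prior) =
      (∫ θ, LZ78.entropy θ.1 ∂prior) + (LZ78.mutualInformation prior).toReal := by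
  have hA : Nonempty A := LZ78.nonempty_of_isProbabilityMeasure prior
  have h0 := LZ78.meanPMF_nonneg prior
  have h1 := LZ78.sum_meanPMF prior
  refine ⟨?_, ?_, LZ78.mutualInformation_ne_top prior, LZ78.entropy_meanPMF_eq prior⟩
  · have hae := LZ78.ae_hasIIDFrequencies prior
    rw [← hX.map_eq] at hae
    filter_upwards [ae_of_ae_map hX.aemeasurable hae] with ω hω
    refine ⟨?_, ?_, ?_⟩
    · exact tendsto_const_nhds.congr fun k => (hω.markovLogLoss_eq h0 h1 k).symm
    · refine tendsto_const_nhds.congr' ?_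
      -- For `M = 0` there is no model, and the infimum is the default value zero.
      filter_upwards [eventually_gt_atTop 0] with M hM
      exact (hω.fsLogLoss_eq h0 h1 hM).symm
    · rcases (Nat.one_le_iff_ne_zero.2 Fintype.card_ne_zero : 1 ≤ Fintype.card A).eq_or_lt
        with hcard | hcard
      -- With a single letter log |A| = 0 and the entropy is zero, so both sides vanish whatever the
      -- compression ratio is.
      · have hsub : Subsingleton A := Fintype.card_le_one_iff_subsingleton.1 hcard.ge
        have hp : ∀ a, LZ78.meanPMF prior a = 1 := fun a => by
          rw [← h1, Fintype.sum_subsingleton _ a]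
        simp [← hcard, LZ78.entropy, hp]
      · exact hω.tendsto_fsCompressibility h0 h1 hcard
  · rw [hX.map_eq]
    exact LZ78.tendsto_blockEntropy_div prior
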